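/- Let $n\ge 0$, let $[\cdot]:\{1,\dots,n\}\to\mathbb Z/2$ be a grading with $\mathcal M$ even and $\mathcal N$ odd indices ($\mathcal M+\mathcal N=n$), and put $c_k=\sum_{m=1}^k(-1)^{[m]}$, so $c_0=0$ and $c_n=\mathcal M-\mathcal N$. Let $\hbar\in\mathbb C$. The super-Yangian $\mathcal Y(\mathcal M|\mathcal N)$ is the $\mathbb Z/2$-graded algebra generated by $T^{(r)}_{ab}$ ($r\ge 0$, $1\le a,b\le n$) of parity $[a]+[b]$, with $T^{(0)}_{ab}=\delta_{ab}$ and supercommutators $$[T^{(r)}_{ab},T^{(s)}_{cd}\}=(-1)^{[a]([b]+[c])+[b][c]}\sum_{q=0}^{\min(r,s)-1}\bigl(T^{(q)}_{cb}T^{(r+s-1-q)}_{ad}-T^{(r+s-1-q)}_{cb}T^{(q)}_{ad}\bigr).$$ For $j=1,\dots,L$ let $V_j$ be a $\mathbb Z/2$-graded $\mathcal Y(\mathcal M|\mathcal N)$-module with a highest weight vector $v_j\ne0$, that is, $T^{(r)}_{ab}v_j=0$ for $b<a$ and $T^{(r)}_{aa}v_j=\lambda^{[j](r)}_a v_j$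 for all $r$. Let $a_1,\dots,a_L\in\mathbb C$, and put $T^{[j]}_{ab}(w)=(w-a_j)\sum_{r\ge0}(\hbar/w)^rT^{(r)}_{ab}$ on $V_j$ and $\lambda_k(w)=\prod_{j=1}^L(w-a_j)\sum_{r\ge0}\lambda^{[j](r)}_k(\hbar/w)^r$. All functions of $u$ are formal Laurent series in $u^{-1}$; in particular, functions of $-u+\text{const}$ and rational functions of $u$ are expanded in $u^{-1}$. Let $\mathcal T(w)$ be the $n\times n$ matrix with entries $$\mathcal T_{ab}(w)=\sum_{i_1,\dots,i_{L-1}}T^{[1]}_{ai_1}(w)\otimes T^{[2]}_{i_1i_2}(w)\otimes\cdots\otimes T^{[L]}_{i_{L-1}b}(w)$$ acting on the graded tensor product $V_1\otimes\cdots\otimes V_L$ (usual sign rule). Let $K(u)$, $K^+(u)$ be diagonal matrices with diagonal entries $K_j(u)$, $K^+_j(u)$ in $\mathbb C((u^{-1}))$. Then $\mathcal T(-u)$ is invertible, so that $$\mathcal B(u)=\mathcal T(u)K(u)\mathcal T(-u)^{-1},\qquad b(u)=\sum_{k=1}^n(-1)^{[k]}K^+_k(u)\,\mathcal B_{kk}(u)$$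 are defined; the scalar $D(u)=\prod_{m=1}^n\lambda_m(-u+\hbar c_{m-1})$ is nonzero; and $v^+=v_1\otimes\cdots\otimes v_L$ is a nonzero eigenvector of the normalized transfer matrix $\widehat b(u)=D(u)\,b(u)$: $$\widehat b(u)\,v^+=\Lambda_0(u)\,v^+,\qquad \Lambda_0(u)=\sum_{j=1}^n(-1)^{[j]}g_j(u)\,\beta_j(u).$$ Here $$\beta_j(u)=\prod_{m<j}\lambda_m(-u+\hbar c_m)\;\lambda_j(u)\;\prod_{m>j}\lambda_m(-u+\hbar c_{m-1}),$$ and the functions $g_j$ depend only on the boundary matrices (and on $\hbar$ and the grading): $$g_j(u)=\frac{2u\,(2u-\hbar(\mathcal M-\mathcal N))}{(2u-\hbar c_{j-1})(2u-\hbar c_j)}\;\widetilde K_j(u)\,\widetilde K^+_j(u),$$ $$\widetilde K_j=K_j+\frac{\hbar}{2u}\sum_{m<j}(-1)^{[m]}(K_m-K_j),\qquad \widetilde K^+_j=K^+_j-\frac{\hbar}{2u-\hbar(\mathcal M-\mathcal N)}\sum_{m>j}(-1)^{[m]}(K^+_m-K^+_j).$$ In particular, if $K$ and $K^+$ are scalar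 matrices, then $g_j(u)=\dfrac{2u\,(2u-\hbar(\mathcal M-\mathcal N))}{(2u-\hbar c_{j-1})(2u-\hbar c_j)}\,K_j(u)K_j^+(u)$. -/

import Mathlib

open scoped TensorProduct

noncomputable section

namespace SuperChain

/-! ### Gradings -/

/-- The sign `(-1)^z` of a parity `z ∈ ℤ/2`. -/
def sgn (z : ZMod 2) : ℂ := (-1) ^ z.val

/-- `c_k = ∑_{m ≤ k} (-1)^{[m]}`, the signed count of the first `k` indices (so `c_0 = 0`, and
`c_n = 𝓜 - 𝓝` where `𝓜`, `𝓝` are the numbers of even and odd indices). With indices in `Fin n`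
counted from `0`, the index `m` contributes to `c_k` exactly when `m < k`. -/
def csum {n : ℕ} (p : Fin n → ZMod 2) (k : ℕ) : ℂ :=
  ∑ m : Fin n, if m.val < k then sgn (p m) else 0

/-! ### The super-Yangian -/

/-- Defining relations of the super-Yangian `𝒴(𝓜|𝓝)` of the graded space with parities `p`.
The generator `(r, a, b)` is `T_{ab}^{(r)}`; it has parity `[a] + [b]`, `T_{ab}^{(0)} = δ_{ab}`, and
the supercommutator of `T_{ab}^{(r)}` and `T_{cd}^{(s)}` is
`(-1)^η ∑_{q < min(r,s)} (T_{cb}^{(q)} T_{ad}^{(r+s-1-q)} - T_{cb}^{(r+s-1-q)} T_{ad}^{(q)})`,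
`η = [a]([b] + [c]) + [b][c]`. -/
inductive YangianRel {n : ℕ} (p : Fin n → ZMod 2) :
    FreeAlgebra ℂ (ℕ × Fin n × Fin n) → FreeAlgebra ℂ (ℕ × Fin n × Fin n) → Prop
  | zero (a b : Fin n) :
      YangianRel p (FreeAlgebra.ι ℂ (0, a, b)) (if a = b then 1 else 0)
  | comm (r s : ℕ) (a b c d : Fin n) :
      YangianRel p
        (FreeAlgebra.ι ℂ (r, a, b) * FreeAlgebra.ι ℂ (s, c, d)
          - sgn ((p a + p b) * (p c + p d)) •
            (FreeAlgebra.ι ℂ (s, c, d) * FreeAlgebra.ι ℂ (r, a, b)))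
        (sgn (p a * (p b + p c) + p b * p c) •
          ∑ q ∈ Finset.range (min r s),
            (FreeAlgebra.ι ℂ (q, c, b) * FreeAlgebra.ι ℂ (r + s - 1 - q, a, d)
              - FreeAlgebra.ι ℂ (r + s - 1 - q, c, b) * FreeAlgebra.ι ℂ (q, a, d)))

/-- The super-Yangian `𝒴(𝓜|𝓝)`. -/
abbrev SuperYangian {n : ℕ} (p : Fin n → ZMod 2) : Type := RingQuot (YangianRel p)

/-- The generator `T_{ab}^{(r)}` of the super-Yangian. -/
def genT {n : ℕ} (p : Fin n → ZMod 2) (r : ℕ) (a b : Fin n) : SuperYangian p :=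
  RingQuot.mkAlgHom ℂ (YangianRel p) (FreeAlgebra.ι ℂ (r, a, b))

/-- The representation `π` on the `ℤ/2`-graded space `V = V_0 ⊕ V_1` respects the grading:
`T_{ab}^{(r)}` shifts the degree by `[a] + [b]`. -/
def IsGradedRep {n : ℕ} (p : Fin n → ZMod 2) {V : Type*} [AddCommGroup V] [Module ℂ V]
    (𝒱 : ZMod 2 → Submodule ℂ V) (π : SuperYangian p →ₐ[ℂ] Module.End ℂ V) : Prop :=
  ∀ (r : ℕ) (a b : Fin n) (z : ZMod 2), ∀ v ∈ 𝒱 z, π (genT p r a b) v ∈ 𝒱 (z + (p a + p b))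

/-- `v` is a highest weight vector of weight `λ(u)`, where
`λ_a(u) = ∑_r λ_a^{(r)} (ħ/u)^r` is given by its coefficients `ℓ a r = λ_a^{(r)}`:
`T_{ab}(u) v = 0` for `b < a` and `T_{aa}(u) v = λ_a(u) v`, coefficientwise. -/
structure IsHighestWeightVector {n : ℕ} (p : Fin n → ZMod 2) {V : Type*} [AddCommGroup V]
    [Module ℂ V] (π : SuperYangian p →ₐ[ℂ] Module.End ℂ V) (v : V) (ℓ : Fin n → ℕ → ℂ) :
    Prop where
  ne_zero : v ≠ 0
  lower : ∀ (r : ℕ) (a b : Fin n), b < a → π (genT p r a b) v = 0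
  diag : ∀ (r : ℕ) (a : Fin n), π (genT p r a a) v = ℓ a r • v

/-! ### Laurent series in `u⁻¹`

All functions of the spectral parameter are formal Laurent series in `u⁻¹`: the coefficient at
index `k : ℤ` is the coefficient of `u^{-k}`. Over `ℂ` they form a field. -/

/-- The spectral parameter `u`. -/
def u : LaurentSeries ℂ := HahnSeries.single (-1) 1

/-- A complex constant as a Laurent series. -/
def const (z : ℂ) : LaurentSeries ℂ := HahnSeries.C z

/-- A scalar Laurent series as a Laurent series of scalar operators. -/
def scalarOp {W : Type*} [AddCommGroup W] [Module ℂ W] (f : LaurentSeries ℂ) :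
    LaurentSeries (Module.End ℂ W) :=
  HahnSeries.map f (algebraMap ℂ (Module.End ℂ W))

/-- `b(u) v = Λ(u) v`, coefficientwise. -/
def HasSeriesEigenvalue {W : Type*} [AddCommGroup W] [Module ℂ W]
    (b : LaurentSeries (Module.End ℂ W)) (v : W) (Λ : LaurentSeries ℂ) : Prop :=
  ∀ k : ℤ, b.coeff k v = Λ.coeff k • v

/-! ### The chain -/

/-- The operator `v ↦ (-1)^{[v]} v` of a `ℤ/2`-graded space. -/
def parityOp {V : Type*} [AddCommGroup V] [Module ℂ V] (𝒱 : ZMod 2 → Submodule ℂ V)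
    [DirectSum.Decomposition 𝒱] : Module.End ℂ V :=
  ∑ z : ZMod 2, sgn z • ((𝒱 z).subtype ∘ₗ DirectSum.component ℂ (ZMod 2) (fun i => 𝒱 i) z ∘ₗ
    (DirectSum.decomposeLinearEquiv 𝒱).toLinearMap)

section Chain

variable {n L : ℕ} (p : Fin n → ZMod 2) {V : Fin L → Type*} [∀ i, AddCommGroup (V i)]
  [∀ i, Module ℂ (V i)] (𝒱 : ∀ i, ZMod 2 → Submodule ℂ (V i))
  [∀ i, DirectSum.Decomposition (𝒱 i)] (π : ∀ i, SuperYangian p →ₐ[ℂ] Module.End ℂ (V i))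

/-- `1 ⊗ ⋯ ⊗ T_{ab}^{(r)} ⊗ ⋯ ⊗ 1` with `T_{ab}^{(r)}` at site `j`, in the graded tensor product:
moving an operator of parity `[a] + [b]` past the sites `i < j` gives the sign
`(-1)^{([a]+[b])[v_i]}` there. -/
def siteOp (j : Fin L) (r : ℕ) (a b : Fin n) : Module.End ℂ (⨂[ℂ] i, V i) :=
  PiTensorProduct.map fun i =>
    if i < j then parityOp (𝒱 i) ^ (p a + p b).val else if i = j then π i (genT p r a b) else 1

/-- The matrix `T^{[j]}(εu)` of the site `j` at the spectral parameter `εu` (used for `ε = ±1`), in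
the normalization `T^{[j]}(w) = (w - a_j) ∑_r T^{(r)} (ħ/w)^r` with inhomogeneity `a_j`. -/
def siteMatrix (ħ : ℂ) (α : Fin L → ℂ) (ε : ℂ) (j : Fin L) :
    Matrix (Fin n) (Fin n) (LaurentSeries (Module.End ℂ (⨂[ℂ] i, V i))) :=
  Matrix.of fun a b =>
    scalarOp (const ε * u - const (α j)) *
      HahnSeries.ofPowerSeries ℤ _ (PowerSeries.mk fun r => (ħ / ε) ^ r • siteOp p 𝒱 π j r a b)

/-- The monodromy matrix `𝒯(εu) = T^{[1]}(εu) ⋯ T^{[L]}(εu)`, i.e. the iterated coproduct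
`𝒯_{ab} = ∑ T_{a i_1} ⊗ T_{i_1 i_2} ⊗ ⋯ ⊗ T_{i_{L-1} b}`. -/
def monodromy (ħ : ℂ) (α : Fin L → ℂ) (ε : ℂ) :
    Matrix (Fin n) (Fin n) (LaurentSeries (Module.End ℂ (⨂[ℂ] i, V i))) :=
  (List.ofFn fun j => siteMatrix p 𝒱 π ħ α ε j).prod

/-- `𝓑(u) = 𝒯(u) K(u) 𝒯⁻¹(-u)` for a diagonal matrix `K(u) = diag(K_1(u), …, K_n(u))`. -/
def openMonodromy (ħ : ℂ) (α : Fin L → ℂ) (K : Fin n → LaurentSeries ℂ) :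
    Matrix (Fin n) (Fin n) (LaurentSeries (Module.End ℂ (⨂[ℂ] i, V i))) :=
  monodromy p 𝒱 π ħ α 1 * Matrix.diagonal (fun j => scalarOp (K j)) *
    Ring.inverse (monodromy p 𝒱 π ħ α (-1))

/-- The open chain transfer matrix
`str (K⁺(u) 𝓑(u)) = ∑_k (-1)^{[k]} K⁺_{kk}(u) 𝓑_{kk}(u)`. -/
def openTransfer (ħ : ℂ) (α : Fin L → ℂ) (K Kplus : Fin n → LaurentSeries ℂ) :
    LaurentSeries (Module.End ℂ (⨂[ℂ] i, V i)) :=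
  ∑ k, scalarOp (const (sgn (p k)) * Kplus k) * openMonodromy p 𝒱 π ħ α K k k

end Chain

/-! ### The functions in the eigenvalue -/

/-- `λ_k(w) = ∏_j (w - a_j) λ_k^{[j]}(w)`, with `λ_k^{[j]}(w) = ∑_r ℓ j k r (ħ/w)^r` expanded in
`u⁻¹`; used for `w = ±u + constant`, for which `ħ/w` has no constant term. -/
def weight {n L : ℕ} (ħ : ℂ) (α : Fin L → ℂ) (ℓ : Fin L → Fin n → ℕ → ℂ) (k : Fin n)
    (w : LaurentSeries ℂ) : LaurentSeries ℂ :=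
  ∏ j, (w - const (α j)) * PowerSeries.heval (const ħ * w⁻¹) (PowerSeries.mk (ℓ j k))

/-- `β_j(u) = ∏_{m<j} λ_m(-u + ħ c_m) · λ_j(u) · ∏_{m>j} λ_m(-u + ħ c_{m-1})`. -/
def beta {n L : ℕ} (p : Fin n → ZMod 2) (ħ : ℂ) (α : Fin L → ℂ) (ℓ : Fin L → Fin n → ℕ → ℂ)
    (j : Fin n) : LaurentSeries ℂ :=
  (∏ m ∈ Finset.Iio j, weight ħ α ℓ m (-u + const (ħ * csum p (m.val + 1)))) *
    weight ħ α ℓ j u *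
    ∏ m ∈ Finset.Ioi j, weight ħ α ℓ m (-u + const (ħ * csum p m.val))

/-- The scalar `∏_m λ_m(-u + ħ c_{m-1})` that clears the denominators of `𝒯⁻¹(-u)` on the
pseudovacuum. -/
def inverseNorm {n L : ℕ} (p : Fin n → ZMod 2) (ħ : ℂ) (α : Fin L → ℂ)
    (ℓ : Fin L → Fin n → ℕ → ℂ) : LaurentSeries ℂ :=
  ∏ m, weight ħ α ℓ m (-u + const (ħ * csum p m.val))

/-- `K̃_j(u) = K_j(u) + (ħ/2u) ∑_{m<j} (-1)^{[m]} (K_m(u) - K_j(u))`. -/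
def dressedK {n : ℕ} (p : Fin n → ZMod 2) (ħ : ℂ) (K : Fin n → LaurentSeries ℂ) (j : Fin n) :
    LaurentSeries ℂ :=
  K j + const ħ / (2 * u) * ∑ m ∈ Finset.Iio j, const (sgn (p m)) * (K m - K j)

/-- `K̃⁺_j(u) = K⁺_j(u) - (ħ/(2u - ħ(𝓜-𝓝))) ∑_{m>j} (-1)^{[m]} (K⁺_m(u) - K⁺_j(u))`. -/
def dressedKplus {n : ℕ} (p : Fin n → ZMod 2) (ħ : ℂ) (Kplus : Fin n → LaurentSeries ℂ)
    (j : Fin n) : LaurentSeries ℂ :=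
  Kplus j - const ħ / (2 * u - const (ħ * csum p n)) *
    ∑ m ∈ Finset.Ioi j, const (sgn (p m)) * (Kplus m - Kplus j)

/-- `2u (2u - ħ(𝓜-𝓝)) / ((2u - ħ c_{j-1}) (2u - ħ c_j))`. -/
def gPrefactor {n : ℕ} (p : Fin n → ZMod 2) (ħ : ℂ) (j : Fin n) : LaurentSeries ℂ :=
  2 * u * (2 * u - const (ħ * csum p n)) /
    ((2 * u - const (ħ * csum p j.val)) * (2 * u - const (ħ * csum p (j.val + 1))))

/-- The boundary function `g_j(u)`: it involves only `ħ`, the grading and the boundary matrices. -/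
def g {n : ℕ} (p : Fin n → ZMod 2) (ħ : ℂ) (K Kplus : Fin n → LaurentSeries ℂ) (j : Fin n) :
    LaurentSeries ℂ :=
  gPrefactor p ħ j * dressedK p ħ K j * dressedKplus p ħ Kplus j

/-- `Λ_0(u) = ∑_j (-1)^{[j]} g_j(u) β_j(u)`. -/
def pseudovacuumValue {n L : ℕ} (p : Fin n → ZMod 2) (ħ : ℂ) (α : Fin L → ℂ)
    (ℓ : Fin L → Fin n → ℕ → ℂ) (K Kplus : Fin n → LaurentSeries ℂ) : LaurentSeries ℂ :=
  ∑ j, const (sgn (p j)) * g p ħ K Kplus j * beta p ħ α ℓ j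

end SuperChain

end

open scoped TensorProduct

noncomputable section

namespace SuperChain

/-! ### Signs -/

/-! Let `X = 𝒯(w)`, `Y = 𝒯(w')`, `Y' = Y⁻¹` and `z = w - w'`, with the scalar factors `∏ (w - a_j)`
removed and indices counted from 0. The Yangian relations amount to `(z - ħP) X₁ Y₂ = Y₂ X₁ (z -
ħP)` with the graded permutation `P` (`ExchangeRel`), and conjugation by `Y₂⁻¹` expresses `z` times
the supercommutator of `X_{ab}` and `Y'_{cd}` through entries of `X Y'` and `Y' X`. On a vector
where `X` is upper triangular with diagonal `μ`, this becomes a linear recursion with denominators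
`Z_k = z - ħ c_k` (`shiftFactor`).

The main point is that `Y'` is also upper triangular on the pseudovacuum, with a computable diagonal
`θ`. The columns are treated by induction. If the columns before `c` are known and `X = Y + z D`,
then `μ_c Y'_{ac} v = Z_c (Y' D)_{ac} v` for `a > c`, and `μ_c Y'_{cc} v - μ_{c-1} θ_{c-1} v` is
also `Z_c` times an explicit vector, up to a nonzero constant (`ExchangeRel.lower_inverse_smul`,
`ExchangeRel.diag_inverse_smul`). Here `w` is free. At `w = w' + ħ c_c` the factor `Z_c` vanishes,
so the lower entries are zero and `θ_c λ_c = θ_{c-1} λ_{c-1}`, both weights taken at `-u + ħ c_c`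
for `w' = -u`. This is the origin of the shifted arguments in `beta`. At that point `z` and other
`Z_k` may vanish too, since the `c_k` can repeat. Hence `w` is moved off by `u^{-(N+1)}`; the
required vectors are then divisible by `u^{-(N+1)}` for every `N`, so they are zero
(`columnsBelow_inverse`).

With `θ` known, put `w = u` and `w' = -u`, so `z = 2u`. The recursion gives the action of the
diagonal of `X K Y'` (`ExchangeRel.boundary_diag_smul`), and interchanging a triangular double sum
in the supertrace factors the coefficient of each `θ_j μ_j` into a left and a right boundary term
(`sum_boundary`), whose product is `g_j` (`g_eq`).

Coefficientwise identities on `v` are treated as linear algebra over the field of Laurent series in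
`CyclicModule`, where division by nonzero series is allowed. Power series in `u⁻¹` span a lattice
there, which makes divisibility by powers of `u⁻¹` meaningful. -/

/-- The sign `(-1)^z` as an integer. -/
def intSgn (z : ZMod 2) : ℤ := (-1) ^ z.val

/-- Integer signs make sense and are central in every ring, so the exchange relation can be stated
over any `A`; this is the link with the complex signs. -/
lemma sgn_eq_intSgn (z : ZMod 2) : sgn z = (intSgn z : ℂ) := by simp [sgn, intSgn]

lemma intSgn_add (y z : ZMod 2) : intSgn (y + z) = intSgn y * intSgn z := by
  revert y z; decide

lemma intSgn_mul_self (z : ZMod 2) : intSgn z * intSgn z = 1 := by revert z; decide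

/-! ### Matrices with entries on two auxiliary spaces -/

section Aux

variable {n : ℕ} (p : Fin n → ZMod 2) {A : Type*} [Ring A]

/-- The graded permutation of two auxiliary spaces. -/
def gradedSwap : Matrix (Fin n × Fin n) (Fin n × Fin n) A :=
  Matrix.of fun x y => if x.1 = y.2 ∧ x.2 = y.1 then (intSgn (p x.1 * p x.2) : A) else 0

/-- A matrix on the second auxiliary space. An index pair lists the index of the second auxiliary
space first. -/
def onSecond : Matrix (Fin n) (Fin n) A →+* Matrix (Fin n × Fin n) (Fin n × Fin n) A :=
  (Matrix.blockDiagonalRingHom (Fin n) (Fin n) A).comp (Pi.constRingHom (Fin n) _)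

lemma onSecond_apply (X : Matrix (Fin n) (Fin n) A) (x y : Fin n × Fin n) :
    onSecond X x y = if x.2 = y.2 then X x.1 y.1 else 0 := rfl

lemma gradedSwap_mul_apply (Y : Matrix (Fin n × Fin n) (Fin n × Fin n) A) (c a : Fin n)
    (y : Fin n × Fin n) :
    (gradedSwap p * Y : Matrix (Fin n × Fin n) (Fin n × Fin n) A) (c, a) y =
      intSgn (p a * p c) * Y (a, c) y := by
  rw [Matrix.mul_apply, Finset.sum_eq_single (a, c)]
  · simp [gradedSwap, mul_comm]
  · rintro ⟨e, f⟩ - h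
    have : ¬ (c = f ∧ a = e) := by rintro ⟨rfl, rfl⟩; exact h rfl
    simp [gradedSwap, this]
  · simp

lemma mul_gradedSwap_apply (Y : Matrix (Fin n × Fin n) (Fin n × Fin n) A) (x : Fin n × Fin n)
    (d b : Fin n) :
    (Y * gradedSwap p : Matrix (Fin n × Fin n) (Fin n × Fin n) A) x (d, b) =
      intSgn (p b * p d) * Y x (b, d) := by
  rw [Matrix.mul_apply, Finset.sum_eq_single (b, d)]
  · simp [gradedSwap, Int.cast_comm]
  · rintro ⟨e, f⟩ - h
    have : ¬ (e = b ∧ f = d) := by rintro ⟨rfl, rfl⟩; exact h rfl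
    simp [gradedSwap, this]
  · simp

lemma gradedSwap_mul_self : (gradedSwap p * gradedSwap p :
    Matrix (Fin n × Fin n) (Fin n × Fin n) A) = 1 := by
  ext ⟨c, a⟩ ⟨d, b⟩
  rw [gradedSwap_mul_apply]
  have := congrArg (Int.cast : ℤ → A) (intSgn_mul_self (p a * p c))
  push_cast at this
  by_cases h : a = b ∧ c = d
  · obtain ⟨rfl, rfl⟩ := h
    simp [gradedSwap, this]
  · have h' : (c, a) ≠ (d, b) := by rintro ⟨⟩; exact h ⟨rfl, rfl⟩
    simp [gradedSwap, h, Matrix.one_apply_ne h']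

/-- A matrix on the first auxiliary space, with the signs of the graded tensor product. -/
def onFirst : Matrix (Fin n) (Fin n) A →+* Matrix (Fin n × Fin n) (Fin n × Fin n) A where
  toFun X := gradedSwap p * onSecond X * gradedSwap p
  map_one' := by rw [map_one, mul_one, gradedSwap_mul_self]
  map_mul' X Y := by
    rw [map_mul]
    calc _ = gradedSwap p * onSecond X * 1 * onSecond Y * gradedSwap p := by noncomm_ring
      _ = _ := by rw [← gradedSwap_mul_self p]; noncomm_ring
  map_zero' := by simp
  map_add' X Y := by rw [map_add]; noncomm_ring

lemma onFirst_def (X : Matrix (Fin n) (Fin n) A) :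
    onFirst p X = gradedSwap p * onSecond X * gradedSwap p := rfl

lemma gradedSwap_mul_onFirst (X : Matrix (Fin n) (Fin n) A) :
    gradedSwap p * onFirst p X = onSecond X * gradedSwap p := by
  rw [onFirst_def, ← mul_assoc, ← mul_assoc, gradedSwap_mul_self, one_mul]

lemma onFirst_mul_gradedSwap (X : Matrix (Fin n) (Fin n) A) :
    onFirst p X * gradedSwap p = gradedSwap p * onSecond X := by
  rw [onFirst_def, mul_assoc, gradedSwap_mul_self, mul_one]

lemma onFirst_apply (X : Matrix (Fin n) (Fin n) A) (c a d b : Fin n) :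
    onFirst p X (c, a) (d, b) =
      if c = d then (intSgn ((p a + p b) * p c) : A) * X a b else 0 := by
  rw [onFirst_def, mul_gradedSwap_apply, gradedSwap_mul_apply, onSecond_apply]
  split_ifs with h
  · simp only at h
    subst h
    rw [← mul_assoc, ← Int.cast_mul, ← intSgn_add, add_mul, add_comm]
  · simp

lemma onFirst_mul_onSecond_apply (X Y : Matrix (Fin n) (Fin n) A) (c a d b : Fin n) :
    (onFirst p X * onSecond Y) (c, a) (d, b) =
      (intSgn ((p a + p b) * p c) : A) * (X a b * Y c d) := by
  rw [Matrix.mul_apply, Finset.sum_eq_single (c, b)]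
  · simp [onFirst_apply, onSecond_apply, mul_assoc]
  · rintro ⟨e, f⟩ - h
    rw [onFirst_apply, onSecond_apply]
    by_cases h1 : c = e
    · have : f ≠ b := by rintro rfl; exact h (by rw [h1])
      simp [this]
    · simp [h1]
  · simp

lemma onSecond_mul_onFirst_apply (X Y : Matrix (Fin n) (Fin n) A) (c a d b : Fin n) :
    (onSecond Y * onFirst p X) (c, a) (d, b) =
      (intSgn ((p a + p b) * p d) : A) * (Y c d * X a b) := by
  rw [Matrix.mul_apply, Finset.sum_eq_single (d, a)]
  · rw [onFirst_apply, onSecond_apply]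
    simp only [if_true]
    rw [← mul_assoc, ← mul_assoc, Int.cast_comm]
  · rintro ⟨e, f⟩ - h
    rw [onFirst_apply, onSecond_apply]
    by_cases h1 : a = f
    · have : e ≠ d := by rintro rfl; exact h (by rw [h1])
      simp [this]
    · simp [h1]
  · simp

/-- Matrices on different auxiliary spaces commute if their entries supercommute. -/
lemma commute_onFirst_onSecond {X Y : Matrix (Fin n) (Fin n) A}
    (h : ∀ a b c d, X a b * Y c d =
      (intSgn ((p a + p b) * (p c + p d)) : A) * (Y c d * X a b)) :
    Commute (onFirst p X) (onSecond Y) := by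
  ext ⟨c, a⟩ ⟨d, b⟩
  rw [onFirst_mul_onSecond_apply, onSecond_mul_onFirst_apply, h, ← mul_assoc, ← Int.cast_mul,
    ← intSgn_add]
  congr 3
  generalize p a = x; generalize p b = y; generalize p c = z; generalize p d = w
  revert x y z w; decide

/-! ### The exchange relation -/

variable {F : Type*} [CommRing F] [Algebra F A]

/-- The exchange relation `κ (X₁ Y₂ - Y₂ X₁) = η (P X₁ Y₂ - Y₂ X₁ P)`, where `X₁` and `Y₂` act on
the first and on the second auxiliary space. -/
def ExchangeRel (κ η : F) (X Y : Matrix (Fin n) (Fin n) A) : Prop :=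
  κ • (onFirst p X * onSecond Y - onSecond Y * onFirst p X) =
    η • (gradedSwap p * (onFirst p X * onSecond Y) - onSecond Y * onFirst p X * gradedSwap p)

variable {p} {κ η : F}

lemma ExchangeRel.of_apply {X Y : Matrix (Fin n) (Fin n) A}
    (h : ∀ a b c d, κ • (X a b * Y c d -
        (intSgn ((p a + p b) * (p c + p d)) : A) * (Y c d * X a b)) =
      η • ((intSgn (p a * (p b + p c) + p b * p c) : A) *
        (X c b * Y a d - Y c b * X a d))) : ExchangeRel p κ η X Y := by
  unfold ExchangeRel
  ext ⟨c, a⟩ ⟨d, b⟩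
  -- This is the sign that `onFirst` puts on the entry `(c, a), (d, b)` of `X₁ Y₂`; with it the
  -- remaining signs agree by a check over `ZMod 2`.
  have := congrArg (fun t => (intSgn ((p a + p b) * p c) : A) * t) (h a b c d)
  simp only [Algebra.mul_smul_comm, mul_sub, ← mul_assoc, ← Int.cast_mul, ← intSgn_add] at this
  simp only [Matrix.smul_apply, Matrix.sub_apply, gradedSwap_mul_apply, mul_gradedSwap_apply,
    onFirst_mul_onSecond_apply, onSecond_mul_onFirst_apply]
  simp only [← mul_assoc, ← Int.cast_mul, ← intSgn_add]
  convert this using 6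
  all_goals
    generalize p a = x; generalize p b = y; generalize p c = z; generalize p d = w
    revert x y z w; decide

lemma ExchangeRel.one : ExchangeRel p κ η (1 : Matrix (Fin n) (Fin n) A) 1 := by
  simp [ExchangeRel]

/-- The exchange relation is compatible with products over mutually supercommuting factors. -/
lemma ExchangeRel.mul {X X' Y Y' : Matrix (Fin n) (Fin n) A} (h : ExchangeRel p κ η X X')
    (h' : ExchangeRel p κ η Y Y') (c₁ : Commute (onFirst p X) (onSecond Y'))
    (c₂ : Commute (onFirst p Y) (onSecond X')) : ExchangeRel p κ η (X * Y) (X' * Y') := by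
  unfold ExchangeRel at *
  simp only [map_mul]
  have e₁ : onFirst p X * onFirst p Y * (onSecond X' * onSecond Y') =
      (onFirst p X * onSecond X') * (onFirst p Y * onSecond Y') := by
    rw [mul_assoc, ← mul_assoc (onFirst p Y), c₂.eq]; noncomm_ring
  have e₂ : onSecond X' * onSecond Y' * (onFirst p X * onFirst p Y) =
      (onSecond X' * onFirst p X) * (onSecond Y' * onFirst p Y) := by
    rw [mul_assoc, ← mul_assoc (onSecond Y'), ← c₁.eq]; noncomm_ring
  rw [e₁, e₂]
  -- Telescoping: after both hypotheses are inserted, the two middle terms `X'₂ X₁ P Y₁ Y'₂` cancel.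
  calc _ = (κ • (onFirst p X * onSecond X' - onSecond X' * onFirst p X)) *
          (onFirst p Y * onSecond Y') + onSecond X' * onFirst p X *
          (κ • (onFirst p Y * onSecond Y' - onSecond Y' * onFirst p Y)) := by
        rw [smul_mul_assoc, mul_smul_comm, ← smul_add]; congr 1; noncomm_ring
    _ = _ := by
        rw [h, h', smul_mul_assoc, mul_smul_comm, ← smul_add]; congr 1; noncomm_ring

/-- The exchange relation of `X` with the inverse of `Y`. -/
lemma ExchangeRel.inverse {X Y Y' : Matrix (Fin n) (Fin n) A} (h : ExchangeRel p κ η X Y)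
    (h₁ : Y * Y' = 1) (h₂ : Y' * Y = 1) :
    κ • (onFirst p X * onSecond Y' - onSecond Y' * onFirst p X) =
      η • (onFirst p (X * Y') * gradedSwap p - gradedSwap p * onFirst p (Y' * X)) := by
  unfold ExchangeRel at h
  have h₁' : onSecond Y * onSecond Y' = 1 := by rw [← map_mul, h₁, map_one]
  have h₂' : onSecond Y' * onSecond Y = 1 := by rw [← map_mul, h₂, map_one]
  have := congrArg (fun t => onSecond Y' * t * onSecond Y') h
  simp only [mul_smul_comm, smul_mul_assoc] at this
  have e₁ : onSecond Y' * (onFirst p X * onSecond Y - onSecond Y * onFirst p X) * onSecond Y' =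
      onSecond Y' * onFirst p X * (onSecond Y * onSecond Y') -
        (onSecond Y' * onSecond Y) * onFirst p X * onSecond Y' := by noncomm_ring
  have e₂ : onSecond Y' * (gradedSwap p * (onFirst p X * onSecond Y) -
        onSecond Y * onFirst p X * gradedSwap p) * onSecond Y' =
      onSecond Y' * gradedSwap p * onFirst p X * (onSecond Y * onSecond Y') -
        (onSecond Y' * onSecond Y) * onFirst p X * (gradedSwap p * onSecond Y') := by noncomm_ring
  -- Passing through `P` moves `Y'` to the first auxiliary space, so only the products `X Y'` and
  -- `Y' X` on that space remain.
  rw [e₁, e₂, h₁', h₂', ← gradedSwap_mul_onFirst, ← onFirst_mul_gradedSwap] at this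
  rw [← neg_sub, smul_neg, ← neg_sub (gradedSwap p * _), smul_neg, map_mul, map_mul]
  simpa [mul_assoc] using congrArg Neg.neg this

/-- The entries of the exchange relation of `X` with the inverse of `Y`. -/
lemma ExchangeRel.inverse_apply {X Y Y' : Matrix (Fin n) (Fin n) A} (h : ExchangeRel p κ η X Y)
    (h₁ : Y * Y' = 1) (h₂ : Y' * Y = 1) (a b c d : Fin n) :
    κ • (X a b * Y' c d - (intSgn ((p a + p b) * (p c + p d)) : A) * (Y' c d * X a b)) =
      η • ((if b = c then (intSgn (p b) : A) * (X * Y') a d else 0) -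
        if a = d then (intSgn (p a * (p b + p c) + p b * p c) : A) * (Y' * X) c b else 0) := by
  have := congrFun (congrFun (h.inverse h₁ h₂) (c, a)) (d, b)
  simp only [Matrix.smul_apply, Matrix.sub_apply, gradedSwap_mul_apply, mul_gradedSwap_apply,
    onFirst_mul_onSecond_apply, onSecond_mul_onFirst_apply, onFirst_apply] at this
  have := congrArg (fun t => (intSgn ((p a + p b) * p c) : A) * t) this
  simp only [Algebra.mul_smul_comm, mul_sub, ← mul_assoc, ← Int.cast_mul, ← intSgn_add, mul_ite,
    mul_zero] at this
  convert this using 3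
  · rw [show (p a + p b) * p c + (p a + p b) * p c = 0 by
      generalize p a = x; generalize p b = y; generalize p c = z; revert x y z; decide]
    simp [intSgn]
  · rw [← mul_assoc]
    congr 3
    generalize p a = x; generalize p b = y; generalize p c = z; generalize p d = w
    revert x y z w; decide
  · by_cases hb : c = b
    · subst hb
      simp only [if_true]
      congr 2
      generalize p a = x; generalize p c = z; generalize p d = w
      revert x z w; decide
    · simp [hb, Ne.symm hb]
  · split_ifs with hb
    · congr 3
      generalize p a = x; generalize p b = y; generalize p c = z; generalize p d = w
      revert x y z w; decide
    · rfl

end Aux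

/-! ### Partial sums over `Fin n` -/

/-- The sum of the first `k` values of `h`. -/
def partialSum {n : ℕ} {F : Type*} [AddCommMonoid F] (h : Fin n → F) (k : ℕ) : F :=
  ∑ m : Fin n, if m.val < k then h m else 0

section PartialSum

variable {n : ℕ} {F : Type*} [AddCommMonoid F]

lemma partialSum_zero (h : Fin n → F) : partialSum h 0 = 0 := by simp [partialSum]

lemma partialSum_succ (h : Fin n → F) (k : Fin n) :
    partialSum h (k.val + 1) = partialSum h k.val + h k := by
  have : h k = ∑ m : Fin n, if m = k then h m else 0 := by simp
  rw [this, partialSum, partialSum, ← Finset.sum_add_distrib]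
  refine Finset.sum_congr rfl fun m _ => ?_
  rcases lt_trichotomy m k with h | h | h
  · simp [h.ne, Fin.lt_def.1 h, (Fin.lt_def.1 h).trans (Nat.lt_succ_self _)]
  · simp [h]
  · simp [h.ne', (Fin.lt_def.1 h).not_gt, (Nat.succ_le_of_lt (Fin.lt_def.1 h)).not_gt]

lemma sum_Iio_eq_partialSum (h : Fin n → F) (k : Fin n) :
    ∑ m ∈ Finset.Iio k, h m = partialSum h k.val := by
  rw [partialSum, ← Finset.sum_filter]
  congr 1
  ext m
  simp

end PartialSum

/-! ### Action on a highest weight vector -/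

section Triangular

variable {n : ℕ} {p : Fin n → ZMod 2} {A : Type*} [Ring A] {F : Type*} [Field F] [Algebra F A]
  {M : Type*} [AddCommGroup M] [Module A M] [Module F M] [IsScalarTower F A M]

/-- `X` is upper triangular on the vector `v`, with diagonal `μ`. -/
structure IsTriangularOn (X : Matrix (Fin n) (Fin n) A) (v : M) (μ : Fin n → F) : Prop where
  lower : ∀ a b, b < a → X a b • v = 0
  diag : ∀ a, X a a • v = μ a • v

lemma smul_smul_comm_tower (s : F) (x : A) (m : M) : x • s • m = s • x • m := by
  rw [← algebraMap_smul A s m, ← algebraMap_smul A s (x • m), smul_smul, smul_smul,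
    Algebra.commutes]

lemma intCast_smul_tower (k : ℤ) (m : M) : (k : A) • m = (k : F) • m := by
  rw [← map_intCast (algebraMap F A), algebraMap_smul]

/-- The shifts `z - ħ c_k`. -/
def shiftFactor (p : Fin n → ZMod 2) (z η : F) (k : ℕ) : F :=
  z - η * partialSum (fun m => (intSgn (p m) : F)) k

lemma shiftFactor_succ (z η : F) (k : Fin n) :
    shiftFactor p z η (k.val + 1) = shiftFactor p z η k.val - η * intSgn (p k) := by
  simp only [shiftFactor, partialSum_succ]; ring

/-- The accumulated contribution of the first `k` indices to the diagonal of `X Y⁻¹`. -/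
def diagShift (p : Fin n → ZMod 2) (z η : F) (ψ : Fin n → F) (k : ℕ) : F :=
  partialSum (fun m => η * intSgn (p m) * ψ m /
    (shiftFactor p z η m.val * shiftFactor p z η (m.val + 1))) k

/-- The eigenvalue of a diagonal entry of `X Y⁻¹`. -/
def diagValue (p : Fin n → ZMod 2) (z η : F) (ψ : Fin n → F) (b : Fin n) : F :=
  z * (ψ b / shiftFactor p z η b.val - diagShift p z η ψ b.val)

/-- Since `Z_{k+1} = Z_k - η(-1)^{[k]}` and `diagShift` grows by `η(-1)^{[k]} ψ_k / (Z_k Z_{k+1})`,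
the increment of `Z_k · diagShift k` is `η(-1)^{[k]} (ψ_k / Z_k - diagShift k)`. -/
lemma partialSum_diagValue {z η : F} (ψ : Fin n → F) (hZ : ∀ k, shiftFactor p z η k ≠ 0)
    {k : ℕ} (hk : k ≤ n) :
    η * partialSum (fun m => intSgn (p m) * diagValue p z η ψ m) k =
      z * shiftFactor p z η k * diagShift p z η ψ k := by
  induction k with
  | zero => simp [partialSum_zero, diagShift]
  | succ k ih =>
    have h := partialSum_succ (fun m => (intSgn (p m) : F) * diagValue p z η ψ m) ⟨k, hk⟩
    have h' := partialSum_succ (fun m => η * intSgn (p m) * ψ m /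
      (shiftFactor p z η m.val * shiftFactor p z η (m.val + 1))) ⟨k, hk⟩
    have h'' := shiftFactor_succ (p := p) z η ⟨k, hk⟩
    have hk0 := hZ k
    have hk1 := hZ (k + 1)
    simp only at h h' h''
    have h₃ : diagShift p z η ψ (k + 1) = diagShift p z η ψ k + _ := h'
    rw [h, mul_add, ih (by omega), h₃]
    change _ + η * (_ * (z * (_ / shiftFactor p z η k - diagShift p z η ψ k))) = _
    field_simp
    rw [h'']
    ring

variable {z η : F} {X Y Y' : Matrix (Fin n) (Fin n) A} {v : M} {μ θ : Fin n → F}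

/-- In the relation of `X_{bi}` with `Y'_{ib}`, the product ending in `X_{bi}` drops out on `v`, and
both Kronecker deltas survive. -/
lemma ExchangeRel.smul_entry_mul_inverse (h : ExchangeRel p z η X Y) (h₁ : Y * Y' = 1)
    (h₂ : Y' * Y = 1) (hX : IsTriangularOn X v μ) {i b : Fin n} (hib : i < b) :
    z • (X b i * Y' i b) • v =
      (η * intSgn (p i)) • ((X * Y') b b • v - (Y' * X) i i • v) := by
  have := congrArg (fun t => t • v) (h.inverse_apply h₁ h₂ b i i b)
  have e : p b * (p i + p i) + p i * p i = p i := by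
    generalize p i = x; generalize p b = y; revert x y; decide
  simp only [if_true, e, smul_assoc, sub_smul, mul_smul, hX.lower b i hib, smul_zero,
    sub_zero, intCast_smul_tower (F := F)] at this
  rw [mul_smul, this, mul_smul, smul_sub (intSgn _ : F)]

/-- The mirror case: the product ending in `Y'_{ai}` drops out, and the delta with `X Y'` needs `a =
c`. -/
lemma ExchangeRel.smul_inverse_mul_entry (h : ExchangeRel p z η X Y) (h₁ : Y * Y' = 1)
    (h₂ : Y' * Y = 1) {i a c : Fin n} (hv : Y' a i • v = 0) :
    z • (Y' a i * X i c) • v =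
      (η * intSgn (p i)) • ((Y' * X) a c • v - if a = c then (X * Y') i i • v else 0) := by
  have := congrArg (fun t => (intSgn ((p i + p c) * (p a + p i)) : F) • t • v)
    (h.inverse_apply h₁ h₂ i c a i)
  simp only [if_true, smul_assoc, sub_smul, mul_smul, hv, smul_zero, zero_sub, ite_smul, zero_smul,
    intCast_smul_tower (F := F), smul_neg, smul_sub, smul_ite] at this
  rw [smul_comm _ z, smul_smul (intSgn _ : F), ← Int.cast_mul, intSgn_mul_self, Int.cast_one,
    one_smul] at this
  rw [mul_smul, ← neg_inj, this, smul_sub, neg_sub]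
  congr 1
  · by_cases hac : a = c
    · subst hac
      simp only [if_true]
      rw [mul_smul, smul_comm _ η, smul_smul (intSgn _ : F), ← Int.cast_mul, ← intSgn_add]
      congr 3
      rw [show (p i + p a) * (p a + p i) + p a = p i from ?_]
      generalize p i = x; generalize p a = y; revert x y; decide
    · simp [hac, Ne.symm hac]
  · rw [mul_smul, smul_comm _ η, smul_smul (intSgn _ : F), ← Int.cast_mul, ← intSgn_add]
    rw [show (p i + p c) * (p a + p i) + (p i * (p c + p a) + p c * p a) = p i from ?_]
    generalize p i = x; generalize p a = y; generalize p c = w; revert x y w; decide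

/-- The columns `b < c` of `Y'` are upper triangular on `v`, with diagonal `θ`. -/
def ColumnsBelow (Y' : Matrix (Fin n) (Fin n) A) (v : M) (θ : Fin n → F) (c : ℕ) : Prop :=
  ∀ b : Fin n, b.val < c → (∀ a, b < a → Y' a b • v = 0) ∧ Y' b b • v = θ b • v

lemma sum_eq_sum_Iio_add {f : Fin n → M} (b : Fin n) (h : ∀ i, b < i → f i = 0) :
    ∑ i, f i = ∑ i ∈ Finset.Iio b, f i + f b := by
  rw [add_comm, ← Finset.sum_insert (by simp)]
  symm
  apply Finset.sum_subset (Finset.subset_univ _)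
  intro i _ hi
  simp only [Finset.mem_insert, Finset.mem_Iio, not_or, not_lt] at hi
  exact h i (lt_of_le_of_ne hi.2 (Ne.symm hi.1))

/-- Expand over the middle index `i`: triangularity of `X` kills `i > c`, `i = c` gives `μ_c`, and
the known columns `i < c` of `Y'` allow the exchange relation. Nothing is assumed on column `c`, so
this constrains it. -/
lemma ExchangeRel.inverse_mul_smul (h : ExchangeRel p z η X Y) (h₁ : Y * Y' = 1)
    (h₂ : Y' * Y = 1) (hX : IsTriangularOn X v μ) {a c : Fin n} (hac : c ≤ a)
    (hθ : ColumnsBelow Y' v θ c.val) :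
    z • (Y' * X) a c • v = (z * μ c) • Y' a c • v + ∑ i ∈ Finset.Iio c, (η * intSgn (p i)) •
      ((Y' * X) a c • v - if a = c then (X * Y') i i • v else 0) := by
  have e : (Y' * X) a c • v = ∑ i, (Y' a i * X i c) • v := by
    rw [Matrix.mul_apply, Finset.sum_smul]
  conv_lhs => rw [e]
  rw [sum_eq_sum_Iio_add c, smul_add, add_comm, Finset.smul_sum]
  · congr 1
    · rw [mul_smul, hX.diag, smul_smul_comm_tower, mul_smul]
    · refine Finset.sum_congr rfl fun i hi => h.smul_inverse_mul_entry h₁ h₂ ?_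
      have hi' := Finset.mem_Iio.1 hi
      exact (hθ i hi').1 a (hi'.trans_le hac)
  · intro i hi
    rw [mul_smul, hX.lower i c hi, smul_zero]

/-- The same expansion for `X Y'`, where column `b` of `Y'` must be known. The terms `i < b` involve
`Y' X`, which couples the two recursions. -/
lemma ExchangeRel.mul_inverse_smul (h : ExchangeRel p z η X Y) (h₁ : Y * Y' = 1)
    (h₂ : Y' * Y = 1) (hX : IsTriangularOn X v μ) {b : Fin n}
    (hθ : ColumnsBelow Y' v θ (b.val + 1)) :
    z • (X * Y') b b • v = (z * (θ b * μ b)) • v + ∑ i ∈ Finset.Iio b, (η * intSgn (p i)) •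
      ((X * Y') b b • v - (Y' * X) i i • v) := by
  have e : (X * Y') b b • v = ∑ i, (X b i * Y' i b) • v := by
    rw [Matrix.mul_apply, Finset.sum_smul]
  have hb := hθ b (Nat.lt_succ_self _)
  conv_lhs => rw [e]
  rw [sum_eq_sum_Iio_add b, smul_add, add_comm, Finset.smul_sum]
  · congr 1
    · rw [mul_smul, hb.2, smul_smul_comm_tower, hX.diag, smul_smul, smul_smul, mul_assoc]
    · exact Finset.sum_congr rfl fun i hi =>
        h.smul_entry_mul_inverse h₁ h₂ hX (Finset.mem_Iio.1 hi)
  · intro i hi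
    rw [mul_smul, hb.1 i hi, smul_zero]

/-- Collecting the multiples of `w` on the left produces the factor `Z_b`; `partialSum_diagValue`
sums the earlier values on the right. -/
lemma smul_eq_diagValue (hZ : ∀ k, shiftFactor p z η k ≠ 0) (ψ : Fin n → F) {b : Fin n} {w : M}
    {f : Fin n → M} (hf : ∀ i < b, f i = diagValue p z η ψ i • v)
    (hw : z • w = (z * ψ b) • v + ∑ i ∈ Finset.Iio b, (η * intSgn (p i)) • (w - f i)) :
    w = diagValue p z η ψ b • v := by
  have e : ∑ i ∈ Finset.Iio b, (η * intSgn (p i)) • (w - f i) =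
      (η * partialSum (fun m => (intSgn (p m) : F)) b.val) • w -
        (z * shiftFactor p z η b.val * diagShift p z η ψ b.val) • v := by
    rw [← partialSum_diagValue ψ hZ b.isLt.le, ← sum_Iio_eq_partialSum, ← sum_Iio_eq_partialSum,
      Finset.mul_sum, Finset.mul_sum, Finset.sum_smul, Finset.sum_smul, ← Finset.sum_sub_distrib]
    refine Finset.sum_congr rfl fun i hi => ?_
    rw [hf i (Finset.mem_Iio.1 hi), smul_sub, smul_smul, mul_assoc]
  rw [e] at hw
  have hw' : shiftFactor p z η b.val • w =
      (z * ψ b - z * shiftFactor p z η b.val * diagShift p z η ψ b.val) • v := by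
    rw [shiftFactor, sub_smul, hw, ← shiftFactor]; module
  have hb := hZ b.val
  rw [← inv_smul_smul₀ hb w, hw', smul_smul, diagValue]
  congr 1
  field_simp

/-- The diagonal entries of `X Y⁻¹` and of `Y⁻¹ X` act on `v` by the same scalars. -/
lemma ExchangeRel.diag_smul_eq (h : ExchangeRel p z η X Y) (h₁ : Y * Y' = 1)
    (h₂ : Y' * Y = 1) (hX : IsTriangularOn X v μ) (hZ : ∀ k, shiftFactor p z η k ≠ 0) {c : ℕ}
    (hθ : ColumnsBelow Y' v θ c) (b : Fin n) (hb : b.val < c) :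
    (X * Y') b b • v = diagValue p z η (fun j => θ j * μ j) b • v ∧
      (Y' * X) b b • v = diagValue p z η (fun j => θ j * μ j) b • v := by
  -- The recursion of each product uses the values of the other at smaller indices, so both are
  -- proved together.
  induction b using WellFoundedLT.induction with
  | ind b ih =>
    have ih' : ∀ i < b, _ := fun i hi => ih i hi ((Fin.lt_def.1 hi).trans hb)
    constructor
    · exact smul_eq_diagValue hZ (fun j => θ j * μ j) (fun i hi => (ih' i hi).2)
        (h.mul_inverse_smul h₁ h₂ hX fun d hd => hθ d (by omega))
    · refine smul_eq_diagValue hZ (fun j => θ j * μ j) (fun i hi => (ih' i hi).1) ?_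
      have := h.inverse_mul_smul h₁ h₂ hX le_rfl fun d hd => hθ d (hd.trans hb)
      simp only [if_true] at this
      rw [this, (hθ b hb).2, smul_smul]
      congr 2; ring

variable {D : Matrix (Fin n) (Fin n) A}

/-- Off the diagonal, `Y' X = 1 + z Y' D` has a factor `z`, which cancels. What remains has no
denominators, so it shows that `Y'_{ac} v` is small when `Z_c` is small. -/
lemma ExchangeRel.lower_inverse_smul (h : ExchangeRel p z η X Y) (h₁ : Y * Y' = 1)
    (h₂ : Y' * Y = 1) (hX : IsTriangularOn X v μ) (hz : z ≠ 0) (hD : X = Y + z • D)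
    {a c : Fin n} (hac : c < a) (hθ : ColumnsBelow Y' v θ c.val) :
    μ c • Y' a c • v = shiftFactor p z η c.val • (Y' * D) a c • v := by
  have e := h.inverse_mul_smul h₁ h₂ hX hac.le hθ
  have e' : (Y' * X) a c • v = z • (Y' * D) a c • v := by
    rw [hD, mul_add, h₂, Matrix.add_apply, Matrix.one_apply_ne hac.ne', zero_add,
      Matrix.mul_smul, Matrix.smul_apply, smul_assoc]
  simp only [hac.ne', if_false, sub_zero, ← Finset.sum_smul, ← Finset.mul_sum,
    sum_Iio_eq_partialSum, e'] at e
  have : z • μ c • Y' a c • v = z • shiftFactor p z η c.val • (Y' * D) a c • v := by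
    rw [shiftFactor, smul_smul, eq_sub_of_add_eq e.symm]
    generalize (Y' * D) a c • v = y
    module
  rw [← inv_smul_smul₀ hz (μ c • _), this, inv_smul_smul₀ hz]

/-- The bracket on the right is free of division by `z` and by shift factors, and it is multiplied
by `Z_c`. When `Z_c` tends to zero, this forces `μ_c Y'_{cc} v = θ_d μ_d v` for the preceding index
`d`. -/
lemma ExchangeRel.diag_inverse_smul (h : ExchangeRel p z η X Y) (h₁ : Y * Y' = 1)
    (h₂ : Y' * Y = 1) (hX : IsTriangularOn X v μ) (hz : z ≠ 0) (hD : X = Y + z • D)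
    (hZ : ∀ k, shiftFactor p z η k ≠ 0) {c d : Fin n} (hdc : d.val + 1 = c.val)
    (hθ : ColumnsBelow Y' v θ c.val) :
    (η * intSgn (p d)) • (μ c • Y' c c • v - (θ d * μ d) • v) =
      shiftFactor p z η c.val • (v + shiftFactor p z η d.val • (Y' * D) c c • v +
        ∑ i ∈ Finset.Iio d, (η * intSgn (p i)) • (D * Y') i i • v - μ c • Y' c c • v) := by
  set ψ : Fin n → F := fun j => θ j * μ j with hψ
  have e := h.inverse_mul_smul h₁ h₂ hX le_rfl hθ
  have e' : (Y' * X) c c • v = v + z • (Y' * D) c c • v := by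
    rw [hD, mul_add, h₂, Matrix.add_apply, Matrix.one_apply_eq, add_smul, one_smul,
      Matrix.mul_smul, Matrix.smul_apply, smul_assoc]
  have hq : ∀ i, (X * Y') i i • v = v + z • (D * Y') i i • v := fun i => by
    rw [hD, add_mul, h₁, Matrix.add_apply, Matrix.one_apply_eq, add_smul, one_smul,
      Matrix.smul_mul, Matrix.smul_apply, smul_assoc]
  have hα : ∀ i : Fin n, i < c → (X * Y') i i • v = diagValue p z η ψ i • v := fun i hi =>
    (h.diag_smul_eq h₁ h₂ hX hZ hθ i hi).1
  have s₁ : ∑ i ∈ Finset.Iio c, (η * intSgn (p i)) • (X * Y') i i • v =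
      (z * shiftFactor p z η c.val * diagShift p z η ψ c.val) • v := by
    rw [← partialSum_diagValue ψ hZ c.isLt.le, ← sum_Iio_eq_partialSum, Finset.mul_sum,
      Finset.sum_smul]
    refine Finset.sum_congr rfl fun i hi => ?_
    rw [hα i (Finset.mem_Iio.1 hi), smul_smul, mul_assoc]
  have s₂ : ∑ i ∈ Finset.Iio d, (η * intSgn (p i)) • (X * Y') i i • v =
      (z * shiftFactor p z η d.val * diagShift p z η ψ d.val) • v := by
    rw [← partialSum_diagValue ψ hZ d.isLt.le, ← sum_Iio_eq_partialSum, Finset.mul_sum,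
      Finset.sum_smul]
    refine Finset.sum_congr rfl fun i hi => ?_
    rw [hα i (lt_trans (Finset.mem_Iio.1 hi) (Fin.lt_def.2 (by omega))), smul_smul, mul_assoc]
  -- The sum in `s₂` computed a second time through `X = Y + z D`; comparing the two removes
  -- `diagShift` and its denominators.
  have s₃ : ∑ i ∈ Finset.Iio d, (η * intSgn (p i)) • (X * Y') i i • v =
      (η * partialSum (fun m => (intSgn (p m) : F)) d.val) • v +
        z • ∑ i ∈ Finset.Iio d, (η * intSgn (p i)) • (D * Y') i i • v := by
    rw [← sum_Iio_eq_partialSum, Finset.mul_sum, Finset.sum_smul, Finset.smul_sum,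
      ← Finset.sum_add_distrib]
    refine Finset.sum_congr rfl fun i _ => ?_
    rw [hq]
    generalize (D * Y') i i • v = y
    module
  -- The increment of `diagShift` from `d` to `c`, cleared of denominators; its last term is the
  -- source of `θ_d μ_d`.
  have hG : z * shiftFactor p z η c.val * diagShift p z η ψ c.val * shiftFactor p z η d.val =
      shiftFactor p z η c.val * (z * shiftFactor p z η d.val * diagShift p z η ψ d.val) +
        z * (η * intSgn (p d) * ψ d) := by
    have hc := hZ c.val
    have hd := hZ d.val
    unfold diagShift
    rw [← hdc, partialSum_succ, hdc]
    field_simp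
  simp only [if_true, smul_sub, Finset.sum_sub_distrib, ← Finset.sum_smul, ← Finset.mul_sum,
    sum_Iio_eq_partialSum] at e
  rw [sum_Iio_eq_partialSum] at s₁
  rw [s₁] at e
  have e₂ : shiftFactor p z η c.val • (Y' * X) c c • v +
      (z * shiftFactor p z η c.val * diagShift p z η ψ c.val) • v = (z * μ c) • Y' c c • v := by
    rw [shiftFactor, sub_smul, e, ← shiftFactor]
    generalize (Y' * X) c c • v = y, Y' c c • v = w
    module
  have e₃ := congrArg (fun t => shiftFactor p z η d.val • t) e₂
  simp only [smul_add, smul_smul] at e₃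
  rw [mul_comm (shiftFactor p z η d.val) (z * _ * _), hG, add_smul, mul_smul _ (z * _ * _) v,
    ← s₂, s₃, ← smul_smul _ _ ((Y' * X) c c • v), e'] at e₃
  -- By this identity the multiples of `v` without `z` add up to `z Z_c v`, so `z` divides the whole
  -- relation.
  have hdz : z = shiftFactor p z η d.val + η * partialSum (fun m => (intSgn (p m) : F)) d.val := by
    rw [shiftFactor]; ring
  have hcd : shiftFactor p z η c.val = shiftFactor p z η d.val - η * intSgn (p d) := by
    rw [← hdc, shiftFactor_succ]
  generalize ∑ i ∈ Finset.Iio d, (η * intSgn (p i)) • (D * Y') i i • v = S at e₃ ⊢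
  generalize η * partialSum (fun m => (intSgn (p m) : F)) d.val = P at e₃ hdz
  generalize Y' c c • v = y at e₃ ⊢
  generalize (Y' * D) c c • v = q at e₃ ⊢
  generalize shiftFactor p z η c.val = Zc at e₃ hcd ⊢
  generalize shiftFactor p z η d.val = Zd at e₃ hcd hdz ⊢
  have hσ : η * (intSgn (p d) : F) = Zd - Zc := by rw [hcd]; ring
  have e₄ : z • ((η * intSgn (p d)) • (μ c • y - ψ d • v)) =
      z • (Zc • (v + Zd • q + S - μ c • y)) := by
    have : (Zd * (z * μ c)) • y = z • (Zc • (v + Zd • q + S) + (η * intSgn (p d) * ψ d) • v) := by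
      rw [← e₃]
      have : z • Zc • v = (Zc * Zd + Zc * P) • v := by rw [smul_smul]; congr 1; rw [hdz]; ring
      simp only [smul_add, this]
      module
    have t : (Zd * (z * μ c)) • y = z • Zd • μ c • y := by module
    rw [t, ← sub_eq_zero, ← smul_sub] at this
    rw [← sub_eq_zero, ← smul_sub, ← this, hσ]
    congr 1
    module
  rw [← inv_smul_smul₀ hz ((η * _) • _), e₄, inv_smul_smul₀ hz]

end Triangular

/-! ### Boundary matrices: the diagonal of `X K Y⁻¹` and its supertrace. -/

section Triangular

variable {n : ℕ} {p : Fin n → ZMod 2} {A : Type*} [Ring A] {F : Type*} [Field F] [Algebra F A]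
  {M : Type*} [AddCommGroup M] [Module A M] [Module F M] [IsScalarTower F A M]

/-- The left boundary matrix in the eigenvalue. -/
def boundaryLeft (p : Fin n → ZMod 2) (z η : F) (K : Fin n → F) (j : Fin n) : F :=
  K j + η / shiftFactor p z η j.val * partialSum (fun m => intSgn (p m) * K m) j.val

/-- The right boundary matrix in the eigenvalue. -/
def boundaryRight (p : Fin n → ZMod 2) (z η : F) (Kplus : Fin n → F) (j : Fin n) : F :=
  Kplus j - η / shiftFactor p z η (j.val + 1) * ∑ m ∈ Finset.Ioi j, intSgn (p m) * Kplus m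

variable {z η : F}

/-- Summation by parts: each `K_m` multiplies a tail of `diagShift`, and collecting by `ψ_m` instead
gives `K_m` plus the sum of the preceding `K`, which is `boundaryLeft`. -/
lemma partialSum_boundaryLeft (K ψ : Fin n → F) (hZ : ∀ k, shiftFactor p z η k ≠ 0) {k : ℕ}
    (hk : k ≤ n) :
    partialSum (fun m => intSgn (p m) * K m) k * diagShift p z η ψ k +
        partialSum (fun m => intSgn (p m) * K m *
          (ψ m / shiftFactor p z η m.val - diagShift p z η ψ m.val)) k =
      partialSum (fun m => intSgn (p m) * ψ m * boundaryLeft p z η K m /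
        shiftFactor p z η (m.val + 1)) k := by
  induction k with
  | zero => simp [partialSum_zero]
  | succ k ih =>
    have h₀ := partialSum_succ (fun m => (intSgn (p m) : F) * K m) ⟨k, hk⟩
    have h₁ := partialSum_succ (fun m => η * intSgn (p m) * ψ m /
      (shiftFactor p z η m.val * shiftFactor p z η (m.val + 1))) ⟨k, hk⟩
    have h₂ := partialSum_succ (fun m => (intSgn (p m) : F) * K m *
      (ψ m / shiftFactor p z η m.val - diagShift p z η ψ m.val)) ⟨k, hk⟩
    have h₃ := partialSum_succ (fun m => (intSgn (p m) : F) * ψ m * boundaryLeft p z η K m /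
        shiftFactor p z η (m.val + 1)) ⟨k, hk⟩
    have h₄ := shiftFactor_succ (p := p) z η ⟨k, hk⟩
    have hk0 := hZ k
    have hk1 := hZ (k + 1)
    simp only at h₀ h₁ h₂ h₃ h₄
    have h₁' : diagShift p z η ψ (k + 1) = diagShift p z η ψ k + _ := h₁
    rw [h₃, ← ih (by omega), h₀, h₁', h₂, boundaryLeft]
    simp only
    field_simp
    rw [h₄]
    ring

variable {X Y Y' : Matrix (Fin n) (Fin n) A} {v : M} {μ θ : Fin n → F}

/-- Middle indices `i > k` vanish by triangularity of `Y'`, and `i = k` gives `K_k θ_k μ_k`. For `i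
< k` the term is a difference of two values `diagValue`, weighted by `K_i`;
`partialSum_boundaryLeft` regroups these. -/
lemma ExchangeRel.boundary_diag_smul (h : ExchangeRel p z η X Y) (h₁ : Y * Y' = 1)
    (h₂ : Y' * Y = 1) (hX : IsTriangularOn X v μ) (hz : z ≠ 0)
    (hZ : ∀ k, shiftFactor p z η k ≠ 0) (hθ : ColumnsBelow Y' v θ n) (K : Fin n → F)
    (k : Fin n) :
    (X * Matrix.diagonal (fun i => algebraMap F A (K i)) * Y') k k • v =
      (θ k * μ k * boundaryLeft p z η K k - η * ∑ j ∈ Finset.Iio k, intSgn (p j) * (θ j * μ j) *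
        boundaryLeft p z η K j / shiftFactor p z η (j.val + 1)) • v := by
  set ψ : Fin n → F := fun j => θ j * μ j with hψ
  have hα := fun b => h.diag_smul_eq h₁ h₂ hX hZ hθ b b.isLt
  have e : (X * Matrix.diagonal (fun i => algebraMap F A (K i)) * Y') k k • v =
      ∑ i, K i • (X k i * Y' i k) • v := by
    rw [Matrix.mul_apply, Finset.sum_smul]
    refine Finset.sum_congr rfl fun i _ => ?_
    rw [Matrix.mul_diagonal, ← Algebra.commutes, mul_assoc, mul_smul, algebraMap_smul]
  rw [e, sum_eq_sum_Iio_add k]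
  · have hs : ∀ i ∈ Finset.Iio k, K i • (X k i * Y' i k) • v = (η * (intSgn (p i) * K i *
        ((ψ k / shiftFactor p z η k.val - diagShift p z η ψ k.val) -
        (ψ i / shiftFactor p z η i.val - diagShift p z η ψ i.val)))) • v := fun i hi => by
      have := h.smul_entry_mul_inverse h₁ h₂ hX (Finset.mem_Iio.1 hi)
      rw [(hα k).1, (hα i).2, ← sub_smul, smul_smul] at this
      rw [← inv_smul_smul₀ hz ((X k i * Y' i k) • v), this, smul_smul, smul_smul, diagValue,
        diagValue]
      congr 1
      simp only [hψ]
      field_simp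
    rw [Finset.sum_congr rfl hs, ← Finset.sum_smul, mul_smul, (hθ k k.isLt).2,
      smul_smul_comm_tower, hX.diag, smul_smul, smul_smul, ← add_smul, ← Finset.mul_sum]
    congr 1
    have hp := partialSum_boundaryLeft K ψ hZ k.isLt.le
    simp only [← sum_Iio_eq_partialSum] at hp
    change _ = ψ k * _ - η * ∑ j ∈ Finset.Iio k, intSgn (p j) * ψ j * _ / _
    rw [← hp, boundaryLeft, ← sum_Iio_eq_partialSum,
      Finset.sum_congr rfl fun i _ => mul_sub _ (_ - _) (_ - _), Finset.sum_sub_distrib,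
      ← Finset.sum_mul]
    have hk := hZ k.val
    rw [mul_assoc (K k), show θ k * μ k = ψ k from rfl]
    field_simp
    ring
  · intro i hi
    rw [mul_smul, (hθ k k.isLt).1 i hi, smul_zero, smul_zero]

/-- Interchanging the triangular double sum attaches the tail of the `K⁺_k`, `k > j`, to the index
`j`; this tail is the correction term of `boundaryRight`. -/
lemma sum_boundary (K Kplus ψ : Fin n → F) :
    ∑ k, intSgn (p k) * Kplus k * (ψ k * boundaryLeft p z η K k -
        η * ∑ j ∈ Finset.Iio k, intSgn (p j) * ψ j *
        boundaryLeft p z η K j / shiftFactor p z η (j.val + 1)) =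
      ∑ j, intSgn (p j) * (boundaryLeft p z η K j * boundaryRight p z η Kplus j) * ψ j := by
  have e : ∑ k, (intSgn (p k) : F) * Kplus k * (η * ∑ j ∈ Finset.Iio k, intSgn (p j) * ψ j *
        boundaryLeft p z η K j / shiftFactor p z η (j.val + 1)) =
      ∑ j, intSgn (p j) * ψ j * boundaryLeft p z η K j *
        (η / shiftFactor p z η (j.val + 1) * ∑ k ∈ Finset.Ioi j, intSgn (p k) * Kplus k) := by
    simp only [Finset.mul_sum]
    rw [Finset.sum_comm' (t' := Finset.univ) (s' := fun j => Finset.Ioi j) (by simp)]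
    exact Finset.sum_congr rfl fun j _ => Finset.sum_congr rfl fun k _ => by ring
  simp only [mul_sub, Finset.sum_sub_distrib]
  simp only [e, ← Finset.sum_sub_distrib]
  exact Finset.sum_congr rfl fun k _ => by rw [boundaryRight]; ring

end Triangular

/-! ### Substitution into power series with noncommuting coefficients -/

section Substitution

open PowerSeries

variable {k : Type*} [CommRing k] {R : Type*} [Ring R] [Algebra k R]

/-- A power series with scalar coefficients as a power series with coefficients in `R`. -/
abbrev scalarSeries : k⟦X⟧ →+* R⟦X⟧ := PowerSeries.map (algebraMap k R)

/-- The substituted argument is central, which makes the substitution multiplicative although `R` is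
not commutative. -/
lemma scalarSeries_commute (f : k⟦X⟧) (G : R⟦X⟧) : Commute (scalarSeries f) G := by
  ext m
  rw [coeff_mul, coeff_mul, ← Finset.Nat.sum_antidiagonal_swap]
  exact Finset.sum_congr rfl fun x _ => by simp [Algebra.commutes]

lemma X_pow_dvd_substVar_pow (σ : k⟦X⟧) (r : ℕ) :
    (scalarSeries (X * σ) : R⟦X⟧) ^ r = X ^ r * scalarSeries σ ^ r := by
  rw [map_mul, PowerSeries.map_X, (commute_X _).symm.mul_pow]

lemma coeff_substVar_pow_mul (σ : k⟦X⟧) {r m : ℕ} (h : m < r) (G : R⟦X⟧) :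
    coeff m ((scalarSeries (X * σ) : R⟦X⟧) ^ r * G) = 0 := by
  rw [X_pow_dvd_substVar_pow, mul_assoc, coeff_X_pow_mul', if_neg (by omega)]

/-- The partial sums of `G(t)` at `t = q σ(q)`. -/
def substTrunc (σ : k⟦X⟧) (G : R⟦X⟧⟦X⟧) (N : ℕ) : R⟦X⟧ :=
  ∑ r ∈ Finset.range N, scalarSeries (X * σ) ^ r * coeff r G

lemma coeff_substTrunc (σ : k⟦X⟧) (G : R⟦X⟧⟦X⟧) {m N N' : ℕ} (h : m < N) (h' : m < N') :
    coeff m (substTrunc σ G N) = coeff m (substTrunc σ G N') := by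
  have key : ∀ N, m < N → coeff m (substTrunc σ G N) = coeff m (substTrunc σ G (m + 1)) := by
    intro N hN
    simp only [substTrunc, map_sum]
    symm
    apply Finset.sum_subset (by simpa using Nat.succ_le_of_lt hN)
    intro r _ hr
    exact coeff_substVar_pow_mul σ (by simpa using hr) _
  rw [key N h, key N' h']

/-- The truncated product runs over the triangle `i + j < N`, the product of truncations over a
square. The extra terms are divisible by `q^N` and do not reach the coefficient `m < N`. -/
lemma substTrunc_mul_coeff (σ : k⟦X⟧) (G H : R⟦X⟧⟦X⟧) {m N : ℕ} (h : m < N) :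
    coeff m (substTrunc σ (G * H) N) = coeff m (substTrunc σ G N * substTrunc σ H N) := by
  set T : R⟦X⟧ := scalarSeries (X * σ) with hT
  have hc : ∀ i j, T ^ i * coeff i G * (T ^ j * coeff j H) =
      T ^ (i + j) * (coeff i G * coeff j H) := fun i j => by
    rw [mul_assoc, ← mul_assoc (coeff i G), ← ((scalarSeries_commute _ _).pow_left j).eq, pow_add]
    simp only [mul_assoc]
  have e₁ : substTrunc σ (G * H) N = ∑ i ∈ Finset.range N, ∑ j ∈ Finset.range (N - i),
      T ^ (i + j) * (coeff i G * coeff j H) := by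
    rw [← Finset.sum_range_diag_flip N fun i j => T ^ (i + j) * (coeff i G * coeff j H)]
    refine Finset.sum_congr rfl fun r _ => ?_
    rw [coeff_mul, Finset.mul_sum,
      ← Finset.Nat.sum_antidiagonal_eq_sum_range_succ
        (fun i j => T ^ (i + j) * (coeff i G * coeff j H))]
    refine Finset.sum_congr rfl fun x hx => ?_
    rw [Finset.HasAntidiagonal.mem_antidiagonal.1 hx]
  have e₂ : substTrunc σ G N * substTrunc σ H N = ∑ i ∈ Finset.range N, ∑ j ∈ Finset.range N,
      T ^ (i + j) * (coeff i G * coeff j H) := by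
    simp only [substTrunc, Finset.sum_mul_sum, ← hT, hc]
  rw [e₁, e₂]
  simp only [map_sum]
  refine Finset.sum_congr rfl fun i _ => ?_
  apply Finset.sum_subset (by simp)
  intro j _ hj
  exact coeff_substVar_pow_mul σ (by simp at hj; omega) _

/-- The substitution `G(t) ↦ G(q σ(q))`. -/
def seriesSubst (σ : k⟦X⟧) : R⟦X⟧⟦X⟧ →+* R⟦X⟧ where
  toFun G := PowerSeries.mk fun m => coeff m (substTrunc σ G (m + 1))
  map_one' := by
    ext m
    rw [coeff_mk, substTrunc, Finset.sum_range_succ', Finset.sum_eq_zero]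
    · simp
    · intro r _
      simp [coeff_one]
  map_zero' := by ext m; simp [substTrunc]
  map_add' G H := by ext m; simp [substTrunc, mul_add, Finset.sum_add_distrib]
  map_mul' G H := by
    ext m
    rw [coeff_mk, substTrunc_mul_coeff σ G H (Nat.lt_succ_self m), coeff_mul, coeff_mul]
    refine Finset.sum_congr rfl fun x hx => ?_
    have := Finset.HasAntidiagonal.mem_antidiagonal.1 hx
    rw [coeff_mk, coeff_mk, coeff_substTrunc σ G (N' := x.1 + 1) (by omega) (by omega),
      coeff_substTrunc σ H (N' := x.2 + 1) (by omega) (by omega)]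

lemma coeff_seriesSubst (σ : k⟦X⟧) (G : R⟦X⟧⟦X⟧) {m N : ℕ} (h : m < N) :
    coeff m (seriesSubst σ G) = coeff m (substTrunc σ G N) := by
  rw [← coeff_substTrunc σ G (Nat.lt_succ_self m) h]
  exact coeff_mk (R := R) m fun m => coeff m (substTrunc σ G (m + 1))

lemma seriesSubst_C (σ : k⟦X⟧) (G : R⟦X⟧) : seriesSubst σ (PowerSeries.C G) = G := by
  ext m
  rw [coeff_seriesSubst σ _ (Nat.lt_succ_self m), substTrunc, Finset.sum_range_succ',
    Finset.sum_eq_zero]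
  · simp
  · intro r _
    simp

lemma seriesSubst_X (σ : k⟦X⟧) : seriesSubst σ (X : R⟦X⟧⟦X⟧) = scalarSeries (X * σ) := by
  ext m
  rw [coeff_seriesSubst σ _ (show m < m + 2 by omega), substTrunc, Finset.sum_eq_single 1]
  · simp
  · intro r _ hr
    simp [coeff_X, hr]
  · simp

/-- The substitution `f(t) ↦ f(q σ(q))` in power series with coefficients in `R`. -/
def coeffSubst (σ : k⟦X⟧) : R⟦X⟧ →+* R⟦X⟧ :=
  (seriesSubst σ).comp (PowerSeries.map (PowerSeries.C (R := R)))

lemma coeff_coeffSubst (σ : k⟦X⟧) (f : R⟦X⟧) {m N : ℕ} (h : m < N) :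
    coeff m (coeffSubst σ f) =
      ∑ r ∈ Finset.range N, coeff m ((X * σ) ^ r) • coeff r f := by
  rw [coeffSubst, RingHom.comp_apply, coeff_seriesSubst σ _ h, substTrunc, map_sum]
  refine Finset.sum_congr rfl fun r _ => ?_
  rw [PowerSeries.coeff_map, coeff_mul_C, ← map_pow, PowerSeries.coeff_map, Algebra.smul_def]

lemma coeffSubst_X (σ : k⟦X⟧) : coeffSubst σ (X : R⟦X⟧) = scalarSeries (X * σ) := by
  rw [coeffSubst, RingHom.comp_apply, PowerSeries.map_X, seriesSubst_X]

lemma coeffSubst_C (σ : k⟦X⟧) (r : R) : coeffSubst σ (PowerSeries.C r) = PowerSeries.C r := by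
  rw [coeffSubst, RingHom.comp_apply, PowerSeries.map_C, seriesSubst_C]

/-- The substitution `G(t, s) ↦ G(q σ(q), q τ(q))`, where `t` is the inner and `s` the outer
variable. -/
def doubleSubst (σ τ : k⟦X⟧) : R⟦X⟧⟦X⟧ →+* R⟦X⟧ :=
  (seriesSubst τ).comp (PowerSeries.map (coeffSubst σ))

lemma doubleSubst_C (σ τ : k⟦X⟧) (f : R⟦X⟧) :
    doubleSubst σ τ (PowerSeries.C f) = coeffSubst σ f := by
  rw [doubleSubst, RingHom.comp_apply, PowerSeries.map_C, seriesSubst_C]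

lemma doubleSubst_map_C (σ τ : k⟦X⟧) (f : R⟦X⟧) :
    doubleSubst σ τ (PowerSeries.map PowerSeries.C f) = coeffSubst τ f := by
  change seriesSubst τ _ = seriesSubst τ _
  congr 1
  ext1 m
  simp [coeffSubst_C]

lemma doubleSubst_X (σ τ : k⟦X⟧) :
    doubleSubst σ τ (X : R⟦X⟧⟦X⟧) = scalarSeries (X * τ) := by
  rw [doubleSubst, RingHom.comp_apply, PowerSeries.map_X, seriesSubst_X]

lemma coeff_coeff_C_mul_map_C (f g : R⟦X⟧) (i j : ℕ) :
    coeff i (coeff j (PowerSeries.C f * PowerSeries.map PowerSeries.C g)) =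
      coeff i f * coeff j g := by
  rw [coeff_C_mul, PowerSeries.coeff_map, coeff_mul_C]

lemma coeff_coeff_map_C_mul_C (f g : R⟦X⟧) (i j : ℕ) :
    coeff i (coeff j (PowerSeries.map PowerSeries.C g * PowerSeries.C f)) =
      coeff j g * coeff i f := by
  rw [coeff_mul_C, PowerSeries.coeff_map, coeff_C_mul]

/-- Two substitutions differ by a multiple of the difference of the arguments. -/
lemma exists_coeffSubst_sub (σ τ : k⟦X⟧) (f : R⟦X⟧) : ∃ d : R⟦X⟧,
    coeffSubst σ f - coeffSubst τ f = scalarSeries (X * σ - X * τ) * d := by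
  -- The divided difference `(f(t) - f(s)) / (t - s) = ∑ f_{i+j+1} t^i s^j`, before substitution.
  have key : PowerSeries.C f - PowerSeries.map PowerSeries.C f =
      (PowerSeries.C X - X) * (PowerSeries.mk fun j => PowerSeries.mk fun i =>
        coeff (i + j + 1) f : R⟦X⟧⟦X⟧) := by
    ext j i
    rw [sub_mul, map_sub, map_sub, map_sub, map_sub, coeff_C_mul, PowerSeries.coeff_map, coeff_mk]
    rcases i with _ | i <;> rcases j with _ | j
    · simp
    · rw [coeff_succ_X_mul]
      simp [PowerSeries.coeff_C]
    · rw [coeff_succ_X_mul]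
      simp [PowerSeries.coeff_C]
    · rw [coeff_succ_X_mul, coeff_succ_X_mul]
      simp [add_assoc, add_comm 1 (j + 1)]
  refine ⟨doubleSubst σ τ (PowerSeries.mk fun j => PowerSeries.mk fun i => coeff (i + j + 1) f), ?_⟩
  have := congrArg (doubleSubst σ τ) key
  rwa [map_sub, map_mul, map_sub, doubleSubst_C, doubleSubst_map_C, doubleSubst_C, doubleSubst_X,
    coeffSubst_X, ← map_sub] at this

lemma coeff_coeff_intCast_mul (e : ℤ) (G : R⟦X⟧⟦X⟧) (i j : ℕ) :
    coeff i (coeff j ((e : R⟦X⟧⟦X⟧) * G)) = (e : R) * coeff i (coeff j G) := by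
  rw [← zsmul_eq_mul, ← zsmul_eq_mul, map_zsmul, map_zsmul]

/-- A relation between coefficients as a relation between series in two variables. -/
lemma series_exchange {f g f₁ g₁ f₂ g₂ : R⟦X⟧} (ε ε' : ℤ)
    (h₀ : ∀ i, coeff 0 f * coeff i g = ε * (coeff i g * coeff 0 f))
    (h₀' : ∀ i, coeff i f * coeff 0 g = ε * (coeff 0 g * coeff i f))
    (h : ∀ i j, (coeff (i + 1) f * coeff j g - ε * (coeff j g * coeff (i + 1) f)) -
        (coeff i f * coeff (j + 1) g - ε * (coeff (j + 1) g * coeff i f)) =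
      ε' * (coeff i f₁ * coeff j g₁ - coeff j g₂ * coeff i f₂)) :
    (X - PowerSeries.C X) * (PowerSeries.C f * PowerSeries.map PowerSeries.C g -
        (ε : R⟦X⟧⟦X⟧) * (PowerSeries.map PowerSeries.C g * PowerSeries.C f)) =
      X * (PowerSeries.C X * ((ε' : R⟦X⟧⟦X⟧) *
        (PowerSeries.C f₁ * PowerSeries.map PowerSeries.C g₁ -
        PowerSeries.map PowerSeries.C g₂ * PowerSeries.C f₂)) : R⟦X⟧⟦X⟧) := by
  have hG : ∀ i j, coeff i (coeff j (PowerSeries.C f * PowerSeries.map PowerSeries.C g -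
      (ε : R⟦X⟧⟦X⟧) * (PowerSeries.map PowerSeries.C g * PowerSeries.C f))) =
      coeff i f * coeff j g - ε * (coeff j g * coeff i f) := by
    intro i j
    rw [map_sub, map_sub, coeff_coeff_intCast_mul, coeff_coeff_C_mul_map_C,
      coeff_coeff_map_C_mul_C]
  have hH : ∀ i j, coeff i (coeff j ((ε' : R⟦X⟧⟦X⟧) *
        (PowerSeries.C f₁ * PowerSeries.map PowerSeries.C g₁ -
        PowerSeries.map PowerSeries.C g₂ * PowerSeries.C f₂))) =
      ε' * (coeff i f₁ * coeff j g₁ - coeff j g₂ * coeff i f₂) := by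
    intro i j
    rw [coeff_coeff_intCast_mul, map_sub, map_sub, coeff_coeff_C_mul_map_C,
      coeff_coeff_map_C_mul_C]
  generalize PowerSeries.C f * PowerSeries.map PowerSeries.C g -
      (ε : R⟦X⟧⟦X⟧) * (PowerSeries.map PowerSeries.C g * PowerSeries.C f) = G at hG ⊢
  generalize (ε' : R⟦X⟧⟦X⟧) * (PowerSeries.C f₁ * PowerSeries.map PowerSeries.C g₁ -
        PowerSeries.map PowerSeries.C g₂ * PowerSeries.C f₂) = H at hH ⊢
  ext j i
  rw [sub_mul, map_sub, map_sub, coeff_C_mul]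
  -- `h` covers positive exponents of both variables; on the two axes only `h₀` and `h₀'` are used.
  rcases j with _ | j
  · rw [coeff_zero_X_mul, coeff_zero_X_mul, map_zero, zero_sub]
    rcases i with _ | i
    · rw [coeff_zero_X_mul, neg_zero]
    · rw [coeff_succ_X_mul, hG, h₀', sub_self, neg_zero]
  · rw [coeff_succ_X_mul, coeff_succ_X_mul, coeff_C_mul]
    rcases i with _ | i
    · rw [coeff_zero_X_mul, coeff_zero_X_mul, hG, h₀, sub_self, sub_zero]
    · rw [coeff_succ_X_mul, coeff_succ_X_mul, hG, hG, hH, h]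

/-- A relation between coefficients as a relation between substituted series. -/
lemma coeffSubst_exchange (σ τ : k⟦X⟧) {f g f₁ g₁ f₂ g₂ : R⟦X⟧} (ε ε' : ℤ)
    (h₀ : ∀ i, coeff 0 f * coeff i g = ε * (coeff i g * coeff 0 f))
    (h₀' : ∀ i, coeff i f * coeff 0 g = ε * (coeff 0 g * coeff i f))
    (h : ∀ i j, (coeff (i + 1) f * coeff j g - ε * (coeff j g * coeff (i + 1) f)) -
        (coeff i f * coeff (j + 1) g - ε * (coeff (j + 1) g * coeff i f)) =
      ε' * (coeff i f₁ * coeff j g₁ - coeff j g₂ * coeff i f₂)) :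
    scalarSeries (X * τ - X * σ) * (coeffSubst σ f * coeffSubst τ g -
        (ε : R⟦X⟧) * (coeffSubst τ g * coeffSubst σ f)) =
      scalarSeries (X * τ * (X * σ)) * ((ε' : R⟦X⟧) *
        (coeffSubst σ f₁ * coeffSubst τ g₁ - coeffSubst τ g₂ * coeffSubst σ f₂)) := by
  have := congrArg (doubleSubst σ τ) (series_exchange ε ε' h₀ h₀' h)
  rw [map_mul, map_mul, map_mul, map_mul, map_sub, map_sub, map_sub, map_mul, map_mul, map_mul,
    map_mul, map_mul, map_intCast, map_intCast] at this
  simp only [doubleSubst_C, doubleSubst_map_C, doubleSubst_X, coeffSubst_X] at this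
  rw [map_sub, map_mul _ (X * τ), this, mul_assoc]

end Substitution

/-! ### The parity operator -/

section Parity

variable {V : Type*} [AddCommGroup V] [Module ℂ V] (𝒱 : ZMod 2 → Submodule ℂ V)
  [DirectSum.Decomposition 𝒱]

lemma sgn_add (y z : ZMod 2) : sgn (y + z) = sgn y * sgn z := by
  simp only [sgn_eq_intSgn, intSgn_add, Int.cast_mul]

lemma sgn_mul_self (z : ZMod 2) : sgn z * sgn z = 1 := by
  rw [sgn_eq_intSgn, ← Int.cast_mul, intSgn_mul_self, Int.cast_one]

lemma parityOp_apply {z : ZMod 2} {v : V} (hv : v ∈ 𝒱 z) : parityOp 𝒱 v = sgn z • v := by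
  simp only [parityOp, LinearMap.sum_apply, LinearMap.smul_apply, LinearMap.comp_apply]
  rw [Finset.sum_eq_single z]
  · congr 1
    change ((DirectSum.decompose 𝒱 v z : 𝒱 z) : V) = v
    rw [DirectSum.decompose_of_mem_same _ hv]
  · intro y _ hy
    change sgn y • ((DirectSum.decompose 𝒱 v y : 𝒱 y) : V) = 0
    rw [DirectSum.decompose_of_mem_ne _ hv hy.symm, smul_zero]
  · simp

lemma end_ext_of_decomposition {f g : Module.End ℂ V} (h : ∀ z, ∀ v ∈ 𝒱 z, f v = g v) :
    f = g := by
  ext v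
  induction v using DirectSum.Decomposition.inductionOn 𝒱 with
  | zero => simp
  | homogeneous m => exact h _ _ m.2
  | add m m' hm hm' => rw [map_add, map_add, hm, hm']

lemma parityOp_mul_self : parityOp 𝒱 * parityOp 𝒱 = 1 := by
  refine end_ext_of_decomposition 𝒱 fun z v hv => ?_
  rw [Module.End.mul_apply, parityOp_apply 𝒱 hv, map_smul, parityOp_apply 𝒱 hv, smul_smul,
    sgn_mul_self, one_smul, Module.End.one_apply]

/-- The operator `v ↦ (-1)^{z [v]} v`. -/
def parityPow (z : ZMod 2) : Module.End ℂ V := parityOp 𝒱 ^ z.val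

lemma parityPow_zero : parityPow 𝒱 0 = 1 := by simp [parityPow]

lemma parityPow_add (y z : ZMod 2) :
    parityPow 𝒱 (y + z) = parityPow 𝒱 y * parityPow 𝒱 z := by
  have h := parityOp_mul_self 𝒱
  have e : ∀ z : ZMod 2, z = 0 ∨ z = 1 := by decide
  have h1 : parityPow 𝒱 1 = parityOp 𝒱 := by simp [parityPow, ZMod.val_one]
  rcases e y with rfl | rfl
  · rw [zero_add, parityPow_zero, one_mul]
  · rcases e z with rfl | rfl
    · rw [add_zero, parityPow_zero, mul_one]
    · rw [show (1 : ZMod 2) + 1 = 0 by decide, h1, h, parityPow_zero]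

lemma parityPow_commute (y z : ZMod 2) : Commute (parityPow 𝒱 y) (parityPow 𝒱 z) :=
  (Commute.refl _).pow_pow _ _

variable {n : ℕ} {p : Fin n → ZMod 2} {𝒱} {π : SuperYangian p →ₐ[ℂ] Module.End ℂ V}

lemma IsGradedRep.parityPow_mul (hπ : IsGradedRep p 𝒱 π) (z : ZMod 2) (r : ℕ) (a b : Fin n) :
    parityPow 𝒱 z * π (genT p r a b) =
      sgn ((p a + p b) * z) • (π (genT p r a b) * parityPow 𝒱 z) := by
  have e : ∀ z : ZMod 2, z = 0 ∨ z = 1 := by decide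
  rcases e z with rfl | rfl
  · simp [parityPow_zero, sgn]
  · simp only [parityPow, ZMod.val_one, pow_one, mul_one]
    refine end_ext_of_decomposition 𝒱 fun y v hv => ?_
    rw [Module.End.mul_apply, LinearMap.smul_apply, Module.End.mul_apply, parityOp_apply 𝒱 hv,
      parityOp_apply 𝒱 (hπ r a b y v hv), map_smul, smul_smul, sgn_add, mul_comm]

end Parity

/-! ### Relations of the super-Yangian -/

section Yangian

variable {n : ℕ} (p : Fin n → ZMod 2)

variable {p} {B : Type*} [Ring B] [Algebra ℂ B] (π : SuperYangian p →ₐ[ℂ] B)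

lemma map_genT_zero (a b : Fin n) : π (genT p 0 a b) = if a = b then 1 else 0 := by
  rw [genT, RingQuot.mkAlgHom_rel ℂ (YangianRel.zero a b)]
  split_ifs <;> simp

lemma map_genT_supercomm (r s : ℕ) (a b c d : Fin n) :
    π (genT p r a b) * π (genT p s c d) -
        sgn ((p a + p b) * (p c + p d)) • (π (genT p s c d) * π (genT p r a b)) =
      sgn (p a * (p b + p c) + p b * p c) • ∑ q ∈ Finset.range (min r s),
        (π (genT p q c b) * π (genT p (r + s - 1 - q) a d) -
          π (genT p (r + s - 1 - q) c b) * π (genT p q a d)) := by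
  have h : ∀ x, π (RingQuot.mkAlgHom ℂ (YangianRel p) x) =
      π.comp (RingQuot.mkAlgHom ℂ (YangianRel p)) x := fun _ => rfl
  have := congrArg π (RingQuot.mkAlgHom_rel ℂ (YangianRel.comm (p := p) r s a b c d))
  simp only [genT, h] at this ⊢
  simpa only [map_sub, map_mul, map_smul, map_sum] using this

/-- The defining relations in the form of the coefficients of the exchange relation. -/
lemma map_genT_exchange (r s : ℕ) (a b c d : Fin n) :
    (π (genT p (r + 1) a b) * π (genT p s c d) -
        sgn ((p a + p b) * (p c + p d)) • (π (genT p s c d) * π (genT p (r + 1) a b))) -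
      (π (genT p r a b) * π (genT p (s + 1) c d) -
        sgn ((p a + p b) * (p c + p d)) • (π (genT p (s + 1) c d) * π (genT p r a b))) =
      sgn (p a * (p b + p c) + p b * p c) •
        (π (genT p r c b) * π (genT p s a d) - π (genT p s c b) * π (genT p r a d)) := by
  rw [map_genT_supercomm, map_genT_supercomm, ← smul_sub]
  congr 1
  simp only [show r + 1 + s - 1 = r + s by omega, show r + (s + 1) - 1 = r + s by omega]
  -- The two sums differ by the single term `q = min r s`. For `r = s` they coincide and the right
  -- side is zero.
  rcases lt_trichotomy r s with h | rfl | h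
  · rw [show min (r + 1) s = r + 1 by omega, show min r (s + 1) = r by omega,
      Finset.sum_range_succ, add_sub_cancel_left, show r + s - r = s by omega]
  · rw [show min (r + 1) r = r by omega, show min r (r + 1) = r by omega, sub_self, sub_self]
  · rw [show min (r + 1) s = s by omega, show min r (s + 1) = s + 1 by omega,
      Finset.sum_range_succ, show r + s - s = r by omega]
    abel

end Yangian

/-! ### Site operators -/

section Site

variable {n L : ℕ} {p : Fin n → ZMod 2} {V : Fin L → Type*} [∀ i, AddCommGroup (V i)]
  [∀ i, Module ℂ (V i)] (𝒱 : ∀ i, ZMod 2 → Submodule ℂ (V i))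
  [∀ i, DirectSum.Decomposition (𝒱 i)]

/-- The operator at site `j` given by an operator of parity `z` on `V j`. -/
def siteMap (j : Fin L) (z : ZMod 2) : Module.End ℂ (V j) →ₗ[ℂ] Module.End ℂ (⨂[ℂ] i, V i) :=
  (PiTensorProduct.mapMultilinear ℂ V V).toLinearMap
    (fun i => if i < j then parityPow (𝒱 i) z else 1) j

lemma siteMap_apply (j : Fin L) (z : ZMod 2) (x : Module.End ℂ (V j)) :
    siteMap 𝒱 j z x = PiTensorProduct.map
      (Function.update (fun i => if i < j then parityPow (𝒱 i) z else 1) j x) := rfl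

lemma siteMap_mul (j : Fin L) (y z : ZMod 2) (x x' : Module.End ℂ (V j)) :
    siteMap 𝒱 j (y + z) (x * x') = siteMap 𝒱 j y x * siteMap 𝒱 j z x' := by
  simp only [siteMap_apply]
  rw [← PiTensorProduct.map_mul]
  congr 1
  ext1 i
  by_cases hi : i = j
  · subst hi; simp
  · by_cases h : i < j <;> simp [hi, h, parityPow_add]

lemma siteMap_one (j : Fin L) : siteMap 𝒱 j 0 1 = 1 := by
  rw [siteMap_apply, ← PiTensorProduct.map_one]
  congr 1
  ext1 i
  by_cases hi : i = j
  · subst hi; simp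
  · simp [hi, parityPow_zero]

-- Away from site `i` the factors commute: both are parity operators, or one is the identity. Only
-- at `i` does the parity string of site `j` meet `x`, producing `c`.
variable {𝒱} in
lemma siteMap_mul_siteMap_of_lt {i j : Fin L} (hij : i < j) {y z : ZMod 2}
    {x : Module.End ℂ (V i)} (x' : Module.End ℂ (V j)) {c : ℂ}
    (h : parityPow (𝒱 i) z * x = c • (x * parityPow (𝒱 i) z)) :
    siteMap 𝒱 j z x' * siteMap 𝒱 i y x = c • (siteMap 𝒱 i y x * siteMap 𝒱 j z x') := by
  simp only [siteMap_apply]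
  rw [← PiTensorProduct.map_mul, ← PiTensorProduct.map_mul]
  set f : ∀ k, Module.End ℂ (V k) := fun k =>
    Function.update (fun k => if k < i then parityPow (𝒱 k) y else 1) i x k *
      Function.update (fun k => if k < j then parityPow (𝒱 k) z else 1) j x' k with hf
  have e := PiTensorProduct.map_update_smul f i c (f i)
  rw [Function.update_eq_self] at e
  rw [← e]
  congr 1
  ext1 k
  by_cases hi : k = i
  · subst hi
    simp [hf, hij.ne, hij, h]
  · rw [Function.update_of_ne hi]
    by_cases hj : k = j
    · subst hj
      simp [hf, hi, hij.not_gt]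
    · by_cases hki : k < i <;> by_cases hkj : k < j <;>
        simp [hf, hi, hj, hki, hkj, (parityPow_commute (𝒱 k) z y).eq]

variable (p) (π : ∀ i, SuperYangian p →ₐ[ℂ] Module.End ℂ (V i))

lemma siteOp_eq_siteMap (j : Fin L) (r : ℕ) (a b : Fin n) :
    siteOp p 𝒱 π j r a b = siteMap 𝒱 j (p a + p b) (π j (genT p r a b)) := by
  rw [siteMap_apply, siteOp]
  congr 1
  ext1 i
  by_cases hi : i = j
  · subst hi; simp
  · by_cases h : i < j <;> simp [hi, h, parityPow]

lemma siteOp_zero (j : Fin L) (a b : Fin n) :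
    siteOp p 𝒱 π j 0 a b = if a = b then 1 else 0 := by
  rw [siteOp_eq_siteMap, map_genT_zero]
  split_ifs with h
  · subst h
    rw [show p a + p a = 0 by generalize p a = x; revert x; decide, siteMap_one]
  · rw [map_zero]

/-- Every product in the relation has total parity `[a]+[b]+[c]+[d]`, so one linear map `siteMap`
transports the relation from `V j` to the chain. -/
lemma siteOp_exchange (j : Fin L) (r s : ℕ) (a b c d : Fin n) :
    (siteOp p 𝒱 π j (r + 1) a b * siteOp p 𝒱 π j s c d -
        sgn ((p a + p b) * (p c + p d)) •
          (siteOp p 𝒱 π j s c d * siteOp p 𝒱 π j (r + 1) a b)) -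
      (siteOp p 𝒱 π j r a b * siteOp p 𝒱 π j (s + 1) c d -
        sgn ((p a + p b) * (p c + p d)) •
          (siteOp p 𝒱 π j (s + 1) c d * siteOp p 𝒱 π j r a b)) =
      sgn (p a * (p b + p c) + p b * p c) •
        (siteOp p 𝒱 π j r c b * siteOp p 𝒱 π j s a d -
          siteOp p 𝒱 π j s c b * siteOp p 𝒱 π j r a d) := by
  have := congrArg (fun t => siteMap 𝒱 j (p a + p b + (p c + p d)) t)
    (map_genT_exchange (π j) r s a b c d)
  simp only [map_sub, map_smul] at this
  simp only [siteOp_eq_siteMap, ← siteMap_mul]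
  rw [add_comm (p c + p d) (p a + p b), show p c + p b + (p a + p d) = p a + p b + (p c + p d) by
    ring]
  exact this

variable {p π 𝒱}

lemma siteOp_supercomm (hπ : ∀ i, IsGradedRep p (𝒱 i) (π i)) {i j : Fin L} (hij : i ≠ j)
    (r s : ℕ) (a b c d : Fin n) :
    siteOp p 𝒱 π i r a b * siteOp p 𝒱 π j s c d = sgn ((p a + p b) * (p c + p d)) •
      (siteOp p 𝒱 π j s c d * siteOp p 𝒱 π i r a b) := by
  simp only [siteOp_eq_siteMap]
  rcases hij.lt_or_gt with h | h
  · rw [siteMap_mul_siteMap_of_lt h _ ((hπ i).parityPow_mul (p c + p d) r a b), smul_smul,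
      sgn_mul_self, one_smul]
  · rw [siteMap_mul_siteMap_of_lt h _ ((hπ j).parityPow_mul (p a + p b) s c d), mul_comm (_ + _)]

/-- `w` is annihilated by `T_{ab}` for `b < a` and is an eigenvector of the `T_{aa}`. -/
structure IsWeightVector {V : Type*} [AddCommGroup V] [Module ℂ V]
    (π : SuperYangian p →ₐ[ℂ] Module.End ℂ V) (w : V) (ℓ : Fin n → ℕ → ℂ) : Prop where
  lower : ∀ (r : ℕ) (a b : Fin n), b < a → π (genT p r a b) w = 0
  diag : ∀ (r : ℕ) (a : Fin n), π (genT p r a a) w = ℓ a r • w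

/-- Parity operators commute with `T_{ab}` up to a sign, trivial for `a = b`. They appear on the
earlier sites whenever an odd operator acts at a later one. -/
lemma IsWeightVector.parityPow {V : Type*} [AddCommGroup V] [Module ℂ V]
    {𝒱 : ZMod 2 → Submodule ℂ V} [DirectSum.Decomposition 𝒱]
    {π : SuperYangian p →ₐ[ℂ] Module.End ℂ V} (hπ : IsGradedRep p 𝒱 π) {w : V}
    {ℓ : Fin n → ℕ → ℂ} (hw : IsWeightVector π w ℓ) (z : ZMod 2) :
    IsWeightVector π (parityPow 𝒱 z w) ℓ := by
  have key : ∀ r a b, π (genT p r a b) (SuperChain.parityPow 𝒱 z w) =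
      sgn ((p a + p b) * z) • SuperChain.parityPow 𝒱 z (π (genT p r a b) w) := fun r a b => by
    have := LinearMap.congr_fun (hπ.parityPow_mul z r a b) w
    rw [Module.End.mul_apply, LinearMap.smul_apply, Module.End.mul_apply] at this
    rw [this, smul_smul, sgn_mul_self, one_smul]
  refine ⟨fun r a b hab => ?_, fun r a => ?_⟩
  · rw [key, hw.lower r a b hab, map_zero, smul_zero]
  · rw [key, hw.diag, show p a + p a = 0 by generalize p a = x; revert x; decide, map_smul]
    simp [sgn]

lemma siteOp_tprod_of_lt {j : Fin L} {w : ∀ i, V i} {ℓ : Fin n → ℕ → ℂ}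
    (hw : IsWeightVector (π j) (w j) ℓ) (r : ℕ) {a b : Fin n} (hab : b < a) :
    siteOp p 𝒱 π j r a b (PiTensorProduct.tprod ℂ w) = 0 := by
  rw [siteOp, PiTensorProduct.map_tprod]
  exact MultilinearMap.map_coord_zero _ j (by simp [hw.lower r a b hab])

lemma siteOp_tprod_self {j : Fin L} {w : ∀ i, V i} {ℓ : Fin n → ℕ → ℂ}
    (hw : IsWeightVector (π j) (w j) ℓ) (r : ℕ) (a : Fin n) :
    siteOp p 𝒱 π j r a a (PiTensorProduct.tprod ℂ w) =
      ℓ a r • PiTensorProduct.tprod ℂ w := by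
  rw [siteOp_eq_siteMap, show p a + p a = 0 by generalize p a = x; revert x; decide,
    siteMap_apply, PiTensorProduct.map_tprod]
  have e := (PiTensorProduct.tprod ℂ).map_update_smul w j (ℓ a r) (w j)
  rw [Function.update_eq_self] at e
  rw [← e]
  congr 1
  ext1 i
  by_cases hi : i = j
  · subst hi; simp [hw.diag]
  · simp [hi, parityPow_zero]

lemma siteOp_tprod (j : Fin L) (w : ∀ i, V i) (r : ℕ) (a b : Fin n) : ∃ w' : ∀ i, V i,
    siteOp p 𝒱 π j r a b (PiTensorProduct.tprod ℂ w) = PiTensorProduct.tprod ℂ w' ∧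
      ∀ i < j, w' i = parityPow (𝒱 i) (p a + p b) (w i) := by
  refine ⟨_, PiTensorProduct.map_tprod _ _, fun i hi => ?_⟩
  simp [hi, parityPow]

end Site

/-- A product of functionals `f_i` with `f_i(v_i) = 1` takes the value `1` on the tensor. -/
lemma tprod_ne_zero {ι : Type*} [Fintype ι] {V : ι → Type*} [∀ i, AddCommGroup (V i)]
    [∀ i, Module ℂ (V i)] {v : ∀ i, V i} (hv : ∀ i, v i ≠ 0) : PiTensorProduct.tprod ℂ v ≠ 0 := by
  choose f hf using fun i => Module.Projective.exists_dual_eq_one ℂ (hv i)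
  intro h
  have := congrArg
    (PiTensorProduct.lift ((MultilinearMap.mkPiAlgebra ℂ ι ℂ).compLinearMap f)) h
  simp [hf] at this

/-! ### Laurent series of operators -/

/-- Laurent series with coefficients in a ring `R` of operators. -/
def OperatorSeries (R : Type*) [Ring R] : Type _ := LaurentSeries R

namespace OperatorSeries

variable {F : Type*} [Field F] {R : Type*} [Ring R]

instance : Ring (OperatorSeries R) := inferInstanceAs (Ring (LaurentSeries R))

/-- The coefficient of `u^{-k}`. -/
def coeff (b : OperatorSeries R) (k : ℤ) : R := HahnSeries.coeff b k

@[ext] lemma ext {b c : OperatorSeries R} (h : ∀ k, b.coeff k = c.coeff k) : b = c :=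
  HahnSeries.ext (funext h)

/-- A power series in `u⁻¹` as a Laurent series. -/
def ofSeries (R : Type*) [Ring R] : PowerSeries R →+* OperatorSeries R :=
  HahnSeries.ofPowerSeries ℤ R

lemma coeff_ofSeries (f : PowerSeries R) (k : ℤ) :
    (ofSeries R f).coeff k = if k < 0 then 0 else PowerSeries.coeff k.natAbs f :=
  PowerSeries.coeff_coe f k

lemma coeff_sub (b c : OperatorSeries R) (k : ℤ) : (b - c).coeff k = b.coeff k - c.coeff k :=
  HahnSeries.coeff_sub (R := R)

variable [Algebra F R]

/-- A scalar Laurent series as a Laurent series of operators. -/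
def scalar (F R : Type*) [Field F] [Ring R] [Algebra F R] :
    LaurentSeries F →+* OperatorSeries R where
  toFun f := HahnSeries.map f (algebraMap F R)
  map_one' := by
    apply HahnSeries.ext
    funext k
    change algebraMap F R (HahnSeries.coeff 1 k) = HahnSeries.coeff (1 : LaurentSeries R) k
    by_cases h : k = 0 <;> simp [HahnSeries.coeff_one, h]
  map_mul' f g := HahnSeries.map_mul ((algebraMap F R) : F →ₙ+* R)
  map_zero' := HahnSeries.map_zero (algebraMap F R : ZeroHom F R)
  map_add' f g := HahnSeries.map_add ((algebraMap F R) : F →+ R)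

lemma coeff_scalar (f : LaurentSeries F) (k : ℤ) :
    (scalar F R f).coeff k = algebraMap F R (f.coeff k) := rfl

lemma scalar_ofPowerSeries (f : PowerSeries F) :
    scalar F R (HahnSeries.ofPowerSeries ℤ F f) = ofSeries R (scalarSeries f) := by
  ext k
  rw [coeff_scalar, coeff_ofSeries, PowerSeries.coeff_coe]
  split_ifs <;> simp

lemma scalar_mul_comm (f : LaurentSeries F) (b : OperatorSeries R) :
    scalar F R f * b = b * scalar F R f := by
  ext k
  refine (HahnSeries.coeff_mul (R := R)).trans
    (Eq.trans ?_ (HahnSeries.coeff_mul (R := R)).symm)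
  refine Finset.sum_bij (fun x _ => x.swap) ?_ ?_ ?_ ?_
  · intro x hx
    simpa [and_comm, and_left_comm, and_assoc, add_comm] using hx
  · intro x _ y _ h
    exact Prod.swap_injective h
  · intro y hy
    exact ⟨y.swap, by simpa [and_comm, and_left_comm, and_assoc, add_comm] using hy,
      Prod.swap_swap y⟩
  · intro x _
    exact Algebra.commutes (A := R) _ _

instance : Algebra (LaurentSeries F) (OperatorSeries R) :=
  (scalar F R).toAlgebra' scalar_mul_comm

lemma smul_eq (f : LaurentSeries F) (b : OperatorSeries R) : f • b = scalar F R f * b := rfl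

end OperatorSeries

/-! ### Action on a vector -/

section Cyclic

open OperatorSeries

variable {F : Type*} [Field F] {R : Type*} [Ring R] [Algebra F R] {W : Type*}
  [AddCommGroup W] [Module R W]

/-- The left ideal of the series of operators whose coefficients annihilate `v`. -/
def annihilatorOf (R : Type*) [Ring R] {W : Type*} [AddCommGroup W] [Module R W] (v : W) :
    Submodule (OperatorSeries R) (OperatorSeries R) where
  carrier := {b | ∀ k, b.coeff k • v = 0}
  zero_mem' k := zero_smul R v
  add_mem' {a b} ha hb k := by
    refine (add_smul (a.coeff k) (b.coeff k) v).trans ?_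
    rw [ha k, hb k, add_zero]
  smul_mem' x b hb k := by
    refine (congrArg (· • v) (HahnSeries.coeff_mul (R := R))).trans ?_
    refine (Finset.sum_smul).trans (Finset.sum_eq_zero fun y _ => ?_)
    exact (mul_smul _ _ v).trans ((congrArg _ (hb _)).trans (smul_zero _))

/-- Series of operators modulo those whose coefficients annihilate `v`. -/
def CyclicModule (R : Type*) [Ring R] {W : Type*} [AddCommGroup W] [Module R W] (v : W) :
    Type _ := OperatorSeries R ⧸ annihilatorOf R v

instance (v : W) : AddCommGroup (CyclicModule R v) :=
  inferInstanceAs (AddCommGroup (OperatorSeries R ⧸ annihilatorOf R v))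

instance (v : W) : Module (OperatorSeries R) (CyclicModule R v) :=
  inferInstanceAs (Module (OperatorSeries R) (OperatorSeries R ⧸ annihilatorOf R v))

instance (v : W) : Module (LaurentSeries F) (CyclicModule R v) :=
  Module.compHom (CyclicModule R v) (scalar F R)

instance (v : W) : IsScalarTower (LaurentSeries F) (OperatorSeries R) (CyclicModule R v) where
  smul_assoc f b m := by
    change (scalar F R f * b) • m = scalar F R f • b • m
    exact mul_smul _ _ _

variable (R) in
/-- The generator of the module of series of operators acting on `v`. -/
def cyclicVector (v : W) : CyclicModule R v :=
  Submodule.Quotient.mk (p := annihilatorOf R v) (1 : OperatorSeries R)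

lemma smul_cyclicVector_eq_zero {v : W} {b : OperatorSeries R} :
    b • cyclicVector R v = 0 ↔ ∀ k, b.coeff k • v = 0 := by
  change (Submodule.Quotient.mk (b * 1) : OperatorSeries R ⧸ annihilatorOf R v) = 0 ↔ _
  rw [mul_one, Submodule.Quotient.mk_eq_zero]
  rfl

lemma scalar_smul_cyclicVector {v : W} (f : LaurentSeries F) :
    f • cyclicVector R v = scalar F R f • cyclicVector R v := rfl

/-- The dictionary between coefficientwise eigenvalue equations on `v` and equations over the field
of Laurent series. -/
lemma smul_cyclicVector_eq [Module F W] [IsScalarTower F R W] {v : W} {b : OperatorSeries R}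
    {f : LaurentSeries F} :
    b • cyclicVector R v = f • cyclicVector R v ↔ ∀ k, b.coeff k • v = f.coeff k • v := by
  rw [scalar_smul_cyclicVector, ← sub_eq_zero, ← sub_smul, smul_cyclicVector_eq_zero]
  refine forall_congr' fun k => ?_
  rw [OperatorSeries.coeff_sub, sub_smul, sub_eq_zero, coeff_scalar, algebraMap_smul]

/-- An element which is divisible by every power of `u⁻¹` on `v` vanishes on `v`. -/
lemma smul_cyclicVector_eq_zero_of_forall {v : W} {b : OperatorSeries R}
    (h : ∀ N : ℕ, ∃ f : PowerSeries R, b • cyclicVector R v =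
      (HahnSeries.ofPowerSeries ℤ F (PowerSeries.X ^ (N + 1))) • ofSeries R f • cyclicVector R v) :
    b • cyclicVector R v = 0 := by
  rw [smul_cyclicVector_eq_zero]
  intro k
  obtain ⟨f, hf⟩ := h k.toNat
  rw [← smul_assoc, ← sub_eq_zero, ← sub_smul, smul_cyclicVector_eq_zero] at hf
  have := hf k
  rw [OperatorSeries.coeff_sub, sub_smul, sub_eq_zero] at this
  rw [this, smul_eq, scalar_ofPowerSeries, ← map_mul, coeff_ofSeries]
  split_ifs with hk
  · exact zero_smul R v
  · rw [map_pow, PowerSeries.map_X, PowerSeries.coeff_X_pow_mul', if_neg (by omega), zero_smul]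

end Cyclic

/-! ### Spectral parameters -/

section Spectral

variable {F : Type*} [Field F]

/-- The inverse of the variable of Laurent series. -/
def invVar (F : Type*) [Field F] : LaurentSeries F := HahnSeries.single (-1) 1

/-- The spectral parameter `u g(u⁻¹)`. -/
def spectral (g : PowerSeries F) : LaurentSeries F := invVar F * HahnSeries.ofPowerSeries ℤ F g

/-- The substitution of `ħ/w` for `w = u g(u⁻¹)` in power series. -/
def atSpectral (ħ : F) (g : PowerSeries F) : PowerSeries F →+* LaurentSeries F :=
  (HahnSeries.ofPowerSeries ℤ F).comp (coeffSubst (PowerSeries.C ħ * g⁻¹))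

/-- The substitution of `ħ/w` for `w = u g(u⁻¹)` in power series of operators. -/
def operatorAtSpectral {R : Type*} [Ring R] [Algebra F R] (ħ : F) (g : PowerSeries F) :
    PowerSeries R →+* OperatorSeries R :=
  (OperatorSeries.ofSeries R).comp (coeffSubst (PowerSeries.C ħ * g⁻¹))

lemma invVar_mul_X : invVar F * HahnSeries.ofPowerSeries ℤ F PowerSeries.X = 1 := by
  rw [invVar, HahnSeries.ofPowerSeries_X, HahnSeries.single_mul_single]
  simp

variable {g : PowerSeries F}

/-- For `w = u g(q)` with `q = u⁻¹`, the series `ħ/w` is `q · ħ g(q)⁻¹`. -/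
lemma spectral_mul (hg : PowerSeries.constantCoeff g ≠ 0) (ħ : F) :
    spectral g * HahnSeries.ofPowerSeries ℤ F (PowerSeries.X * (PowerSeries.C ħ * g⁻¹)) =
      HahnSeries.C ħ := by
  have h : g * (PowerSeries.X * (PowerSeries.C ħ * g⁻¹)) =
      PowerSeries.X * PowerSeries.C ħ * (g * g⁻¹) := by ring
  rw [spectral, mul_assoc, ← map_mul, h, PowerSeries.mul_inv_cancel _ hg, mul_one, map_mul,
    ← mul_assoc, invVar_mul_X, one_mul, HahnSeries.ofPowerSeries_C]

lemma spectral_ne_zero (hg : PowerSeries.constantCoeff g ≠ 0) : spectral g ≠ 0 := by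
  have := spectral_mul hg 1
  intro h
  rw [h, zero_mul] at this
  simp at this

lemma div_spectral (hg : PowerSeries.constantCoeff g ≠ 0) (ħ : F) :
    HahnSeries.C ħ * (spectral g)⁻¹ =
      HahnSeries.ofPowerSeries ℤ F (PowerSeries.X * (PowerSeries.C ħ * g⁻¹)) := by
  rw [← spectral_mul hg ħ, mul_comm (spectral g), mul_inv_cancel_right₀ (spectral_ne_zero hg)]

/-- The argument has positive order, so evaluation is a summable family with finitely many terms per
coefficient. This identifies the evaluation used in `weight` with `coeffSubst`. -/
lemma heval_ofPowerSeries (σ : PowerSeries F) (f : PowerSeries F) :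
    PowerSeries.heval (HahnSeries.ofPowerSeries ℤ F (PowerSeries.X * σ)) f =
      HahnSeries.ofPowerSeries ℤ F (coeffSubst σ f) := by
  have hx : 0 < (HahnSeries.ofPowerSeries ℤ F (PowerSeries.X * σ)).orderTop := by
    refine lt_of_lt_of_le (b := ((1 : ℤ) : WithTop ℤ)) (by norm_num) ?_
    rw [HahnSeries.le_orderTop_iff_forall]
    intro m hm
    have hm' : m < 1 := by exact_mod_cast hm
    rw [PowerSeries.coeff_coe]
    split_ifs with h
    · rfl
    · rw [show m = 0 by omega]
      simp
  ext1; funext m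
  rw [PowerSeries.coeff_heval]
  simp only [HahnSeries.SummableFamily.coeff_apply,
    HahnSeries.SummableFamily.powerSeriesFamily_of_orderTop_pos hx, HahnSeries.coeff_smul,
    ← map_pow, PowerSeries.coeff_coe]
  split_ifs with h
  · simp
  · rw [coeff_coeffSubst σ f (Nat.lt_succ_self m.natAbs), finsum_eq_sum_of_support_subset]
    · exact Finset.sum_congr rfl fun r _ => by rw [smul_eq_mul, smul_eq_mul, mul_comm]
    · intro r hr
      by_contra hr'
      apply hr
      dsimp only
      rw [mul_pow, PowerSeries.coeff_X_pow_mul', if_neg, smul_zero]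
      simpa using hr'

lemma heval_eq_atSpectral (hg : PowerSeries.constantCoeff g ≠ 0) (ħ : F) (f : PowerSeries F) :
    PowerSeries.heval (HahnSeries.C ħ * (spectral g)⁻¹) f = atSpectral ħ g f := by
  rw [div_spectral hg, heval_ofPowerSeries]
  rfl

end Spectral

/-! ### Invertible matrices of power series -/

section MatrixSeries

variable {m : Type*} [Fintype m] [DecidableEq m] {R : Type*} [Ring R]

/-- A power series of matrices as a matrix of power series. -/
def matrixOfSeries : PowerSeries (Matrix m m R) →+* Matrix m m (PowerSeries R) where
  toFun F := Matrix.of fun i j => PowerSeries.mk fun k => PowerSeries.coeff k F i j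
  map_one' := by
    ext i j k
    by_cases h : i = j
    · subst h
      by_cases hk : k = 0 <;> simp [PowerSeries.coeff_one, hk, Matrix.one_apply_eq]
    · by_cases hk : k = 0 <;>
        simp [PowerSeries.coeff_one, hk, Matrix.one_apply_ne h]
  map_mul' F G := by
    ext i j k
    simp only [Matrix.of_apply, PowerSeries.coeff_mk, PowerSeries.coeff_mul, Matrix.mul_apply,
      map_sum, Matrix.sum_apply]
    exact Finset.sum_comm
  map_zero' := by ext; simp
  map_add' F G := by ext; simp

/-- Seen as a power series over the matrix ring, `U` has constant term `1` and is inverted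
recursively; no determinant is needed over noncommuting entries. -/
lemma exists_inverse_of_constantCoeff {U : Matrix m m (PowerSeries R)}
    (hU : (PowerSeries.constantCoeff (R := R)).mapMatrix U = 1) :
    ∃ U' : Matrix m m (PowerSeries R), U * U' = 1 ∧ U' * U = 1 := by
  set F : PowerSeries (Matrix m m R) :=
    PowerSeries.mk fun k => Matrix.of fun i j => PowerSeries.coeff k (U i j) with hF
  have e : matrixOfSeries F = U := by ext i j k; simp [matrixOfSeries, hF]
  have h1 : PowerSeries.constantCoeff F = ((1 : (Matrix m m R)ˣ) : Matrix m m R) := by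
    rw [Units.val_one, ← hU]
    ext i j
    rw [← PowerSeries.coeff_zero_eq_constantCoeff_apply, hF, PowerSeries.coeff_mk]
    simp
  refine ⟨matrixOfSeries (F.invOfUnit 1), ?_, ?_⟩
  · conv_lhs => rw [← e]
    rw [← map_mul, PowerSeries.mul_invOfUnit F 1 h1, map_one]
  · conv_lhs => rw [← e]
    rw [← map_mul, PowerSeries.invOfUnit_mul F 1 h1, map_one]

end MatrixSeries

/-! ### The formal monodromy matrix -/

section Formal

variable {n L : ℕ} {R : Type*} [Ring R] (S : Fin L → ℕ → Fin n → Fin n → R)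

/-- The generating series `∑_r T^{(r)} t^r` of the site `j`. -/
def siteSeries (j : Fin L) : Matrix (Fin n) (Fin n) (PowerSeries R) :=
  Matrix.of fun a b => PowerSeries.mk fun r => S j r a b

/-- The product of the generating series of the sites in a list. -/
def seriesMonodromy (l : List (Fin L)) : Matrix (Fin n) (Fin n) (PowerSeries R) :=
  (l.map (siteSeries S)).prod

variable {S}

lemma constantCoeff_seriesMonodromy (h : ∀ j a b, S j 0 a b = if a = b then 1 else 0)
    (l : List (Fin L)) :
    (PowerSeries.constantCoeff (R := R)).mapMatrix (seriesMonodromy S l) = 1 := by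
  rw [seriesMonodromy, map_list_prod, List.map_map]
  apply List.prod_eq_one
  intro x hx
  obtain ⟨j, -, rfl⟩ := List.mem_map.1 hx
  ext1 a b
  simp [siteSeries, ← PowerSeries.coeff_zero_eq_constantCoeff_apply, h, Matrix.one_apply]

/-- The monodromy matrix is triangular on `v`, with eigenvalues given by `f`. -/
structure IsTriangularSeries {F : Type*} [Field F] {W : Type*} [AddCommGroup W] [Module R W]
    [Module F W]
    (U : Matrix (Fin n) (Fin n) (PowerSeries R)) (v : W) (f : Fin n → PowerSeries F) : Prop where
  lower : ∀ (r : ℕ) (a b : Fin n), b < a → PowerSeries.coeff r (U a b) • v = 0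
  diag : ∀ (r : ℕ) (a : Fin n),
    PowerSeries.coeff r (U a a) • v = PowerSeries.coeff r (f a) • v

end Formal

/-! ### Triangularity of the monodromy matrix on the pseudovacuum. -/

section FormalChain

variable {n L : ℕ} {p : Fin n → ZMod 2} {V : Fin L → Type*} [∀ i, AddCommGroup (V i)]
  [∀ i, Module ℂ (V i)] {𝒱 : ∀ i, ZMod 2 → Submodule ℂ (V i)}
  [∀ i, DirectSum.Decomposition (𝒱 i)] {π : ∀ i, SuperYangian p →ₐ[ℂ] Module.End ℂ (V i)}

/-- The monodromy matrix is upper triangular on a product of highest weight vectors. -/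
lemma seriesMonodromy_tprod {ℓ : Fin L → Fin n → ℕ → ℂ} (hπ : ∀ i, IsGradedRep p (𝒱 i) (π i))
    (l : List (Fin L)) (hl : l.Pairwise (· < ·)) (w : ∀ i, V i)
    (hw : ∀ i ∈ l, IsWeightVector (π i) (w i) (ℓ i)) :
    (∀ (r : ℕ) (a b : Fin n), b < a →
      PowerSeries.coeff r (seriesMonodromy (siteOp p 𝒱 π) l a b) (PiTensorProduct.tprod ℂ w) = 0) ∧
    ∀ (r : ℕ) (a : Fin n),
      PowerSeries.coeff r (seriesMonodromy (siteOp p 𝒱 π) l a a) (PiTensorProduct.tprod ℂ w) =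
        PowerSeries.coeff r ((l.map fun j => PowerSeries.mk (ℓ j a)).prod) •
          PiTensorProduct.tprod ℂ w := by
  -- The last site acts first and changes the earlier tensor factors only by parity operators, so
  -- the induction must allow any weight vectors `w`.
  induction l using List.reverseRecOn generalizing w with
  | nil =>
    refine ⟨fun r a b hab => ?_, fun r a => ?_⟩
    · simp [seriesMonodromy, Matrix.one_apply_ne hab.ne']
    · by_cases hr : r = 0 <;> simp [seriesMonodromy, PowerSeries.coeff_one, hr]
  | append_singleton l j ih =>
    rw [List.pairwise_append] at hl
    have hlj : ∀ i ∈ l, i < j := fun i hi => hl.2.2 i hi j (by simp)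
    have hwj : IsWeightVector (π j) (w j) (ℓ j) := hw j (by simp)
    have hwl : ∀ i ∈ l, IsWeightVector (π i) (w i) (ℓ i) := fun i hi => hw i (by simp [hi])
    have ihw := ih hl.1 w hwl
    have e : ∀ (r : ℕ) (a b : Fin n), PowerSeries.coeff r
        (seriesMonodromy (siteOp p 𝒱 π) (l ++ [j]) a b) (PiTensorProduct.tprod ℂ w) =
        ∑ i, ∑ x ∈ Finset.HasAntidiagonal.antidiagonal r,
          PowerSeries.coeff x.1 (seriesMonodromy (siteOp p 𝒱 π) l a i)
            (siteOp p 𝒱 π j x.2 i b (PiTensorProduct.tprod ℂ w)) := by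
      intro r a b
      have : seriesMonodromy (siteOp p 𝒱 π) (l ++ [j]) =
          seriesMonodromy (siteOp p 𝒱 π) l * siteSeries (siteOp p 𝒱 π) j := by
        simp [seriesMonodromy]
      rw [this, Matrix.mul_apply, map_sum, LinearMap.sum_apply]
      refine Finset.sum_congr rfl fun i _ => ?_
      rw [PowerSeries.coeff_mul, LinearMap.sum_apply]
      refine Finset.sum_congr rfl fun x _ => ?_
      simp [siteSeries]
    have hlt : ∀ (s t : ℕ) (a i b : Fin n), i < a →
        PowerSeries.coeff s (seriesMonodromy (siteOp p 𝒱 π) l a i)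
            (siteOp p 𝒱 π j t i b (PiTensorProduct.tprod ℂ w)) = 0 := by
      intro s t a i b hia
      obtain ⟨w', hw', hw''⟩ := siteOp_tprod (p := p) (𝒱 := 𝒱) (π := π) j w t i b
      rw [hw']
      refine (ih hl.1 w' fun k hk => ?_).1 s a i hia
      rw [hw'' k (hlj k hk)]
      exact (hwl k hk).parityPow (hπ k) _
    have hgt : ∀ (t : ℕ) (i b : Fin n), b < i →
        siteOp p 𝒱 π j t i b (PiTensorProduct.tprod ℂ w) = 0 := fun t i b hbi =>
      siteOp_tprod_of_lt hwj t hbi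
    constructor
    · intro r a b hab
      rw [e]
      refine Finset.sum_eq_zero fun i _ => Finset.sum_eq_zero fun x _ => ?_
      rcases lt_or_ge i a with hi | hi
      · exact hlt _ _ _ _ _ hi
      · rw [hgt _ _ _ (hab.trans_le hi), map_zero]
    · intro r a
      rw [e, Finset.sum_eq_single a]
      · rw [List.map_append, List.prod_append, PowerSeries.coeff_mul, Finset.sum_smul]
        refine Finset.sum_congr rfl fun x _ => ?_
        rw [siteOp_tprod_self hwj, map_smul, ihw.2, smul_smul]
        simp [mul_comm]
      · intro i _ hi
        refine Finset.sum_eq_zero fun x _ => ?_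
        rcases lt_or_gt_of_ne hi with h | h
        · exact hlt _ _ _ _ _ h
        · rw [hgt _ _ _ h, map_zero]
      · simp

end FormalChain

/-! ### Exchange relation for the monodromy matrices of the chain. -/

section Exchange

open PowerSeries in
lemma coeffSubst_supercomm {k : Type*} [CommRing k] {R : Type*} [Ring R] [Algebra k R]
    (σ τ : PowerSeries k) {f g : PowerSeries R} (ε : ℤ)
    (h : ∀ i j, coeff i f * coeff j g = ε * (coeff j g * coeff i f)) :
    coeffSubst σ f * coeffSubst τ g =
      (ε : PowerSeries R) * (coeffSubst τ g * coeffSubst σ f) := by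
  have key : PowerSeries.C f * PowerSeries.map PowerSeries.C g =
      (ε : PowerSeries (PowerSeries R)) *
        (PowerSeries.map PowerSeries.C g * PowerSeries.C f) := by
    ext j i
    rw [coeff_coeff_intCast_mul, coeff_coeff_C_mul_map_C, coeff_coeff_map_C_mul_C, h]
  have := congrArg (doubleSubst σ τ) key
  rwa [map_mul, map_mul, map_mul, map_intCast, doubleSubst_C, doubleSubst_map_C] at this

lemma sgn_smul_eq {R : Type*} [Ring R] [Algebra ℂ R] (z : ZMod 2) (x : R) :
    sgn z • x = (intSgn z : R) * x := by
  rw [sgn_eq_intSgn, Int.cast_smul_eq_zsmul, zsmul_eq_mul]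

/-- The relations of the site operators of a graded tensor product of Yangian modules. -/
structure IsSiteFamily {n L : ℕ} (p : Fin n → ZMod 2) {R : Type*} [Ring R]
    (S : Fin L → ℕ → Fin n → Fin n → R) : Prop where
  zero : ∀ j a b, S j 0 a b = if a = b then 1 else 0
  exchange : ∀ j r s a b c d,
    (S j (r + 1) a b * S j s c d -
        (intSgn ((p a + p b) * (p c + p d)) : R) * (S j s c d * S j (r + 1) a b)) -
      (S j r a b * S j (s + 1) c d -
        (intSgn ((p a + p b) * (p c + p d)) : R) * (S j (s + 1) c d * S j r a b)) =
      (intSgn (p a * (p b + p c) + p b * p c) : R) *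
        (S j r c b * S j s a d - S j s c b * S j r a d)
  supercomm : ∀ i j, i ≠ j → ∀ r s a b c d, S i r a b * S j s c d =
    (intSgn ((p a + p b) * (p c + p d)) : R) * (S j s c d * S i r a b)

variable {n L : ℕ} {p : Fin n → ZMod 2} {F : Type*} [Field F] {R : Type*} [Ring R] [Algebra F R]
  {S : Fin L → ℕ → Fin n → Fin n → R} {ħ : F} {g g' : PowerSeries F}

variable (S) in
/-- The normalized monodromy matrix of the sites in a list, at the spectral parameter given by
`g`. -/
def monodromyAt (ħ : F) (g : PowerSeries F) (l : List (Fin L)) :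
    Matrix (Fin n) (Fin n) (OperatorSeries R) :=
  (operatorAtSpectral ħ g).mapMatrix (seriesMonodromy S l)

lemma monodromyAt_nil (ħ : F) (g : PowerSeries F) : monodromyAt S ħ g [] = 1 := by
  simp [monodromyAt, seriesMonodromy]

lemma monodromyAt_append (ħ : F) (g : PowerSeries F) (l : List (Fin L)) (j : Fin L) :
    monodromyAt S ħ g (l ++ [j]) = monodromyAt S ħ g l * monodromyAt S ħ g [j] := by
  simp [monodromyAt, seriesMonodromy]

lemma monodromyAt_singleton_apply (ħ : F) (g : PowerSeries F) (j : Fin L) (a b : Fin n) :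
    monodromyAt S ħ g [j] a b =
      operatorAtSpectral ħ g (PowerSeries.mk fun r => S j r a b) := by
  simp [monodromyAt, seriesMonodromy, siteSeries]

lemma commute_monodromyAt_singleton (hS : IsSiteFamily p S) {i j : Fin L}
    (hij : i ≠ j) : Commute (onFirst p (monodromyAt S ħ g [i]))
      (onSecond (monodromyAt S ħ g' [j])) := by
  refine commute_onFirst_onSecond p fun a b c d => ?_
  rw [monodromyAt_singleton_apply, monodromyAt_singleton_apply]
  have := congrArg (OperatorSeries.ofSeries R)
    (coeffSubst_supercomm (PowerSeries.C ħ * g⁻¹) (PowerSeries.C ħ * g'⁻¹)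
    (f := PowerSeries.mk fun r => S i r a b)
    (g := PowerSeries.mk fun r => S j r c d) (intSgn ((p a + p b) * (p c + p d)))
    fun r s => by
      simp only [PowerSeries.coeff_mk]
      exact hS.supercomm i j hij r s a b c d)
  simpa only [map_mul, map_intCast, operatorAtSpectral, RingHom.comp_apply] using this

lemma commute_monodromyAt_left (hS : IsSiteFamily p S) {l : List (Fin L)}
    {j : Fin L} (hj : j ∉ l) : Commute (onFirst p (monodromyAt S ħ g l))
      (onSecond (monodromyAt S ħ g' [j])) := by
  induction l using List.reverseRecOn with
  | nil => simp [monodromyAt_nil]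
  | append_singleton l i ih =>
    simp only [List.mem_append, List.mem_singleton, not_or] at hj
    rw [monodromyAt_append, map_mul]
    exact (ih hj.1).mul_left (commute_monodromyAt_singleton hS (Ne.symm hj.2))

lemma commute_monodromyAt_right (hS : IsSiteFamily p S) {l : List (Fin L)}
    {j : Fin L} (hj : j ∉ l) : Commute (onFirst p (monodromyAt S ħ g [j]))
      (onSecond (monodromyAt S ħ g' l)) := by
  induction l using List.reverseRecOn with
  | nil => simp [monodromyAt_nil]
  | append_singleton l i ih =>
    simp only [List.mem_append, List.mem_singleton, not_or] at hj
    rw [monodromyAt_append, map_mul]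
    exact (ih hj.1).mul_right (commute_monodromyAt_singleton hS hj.2)

/-- With `t = ħ/w` and `t' = ħ/w'`, the coefficient relations read `(t' - t)[X, Y} = t t' (…)`.
Multiplication by `w w'` and division by `ħ` give the factors `w - w'` and `ħ`. -/
lemma exchangeRel_singleton (hS : IsSiteFamily p S) (hħ : ħ ≠ 0)
    (hg : PowerSeries.constantCoeff g ≠ 0) (hg' : PowerSeries.constantCoeff g' ≠ 0) (j : Fin L) :
    ExchangeRel p (spectral g - spectral g') (HahnSeries.C ħ)
      (monodromyAt S ħ g [j]) (monodromyAt S ħ g' [j]) := by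
  have h₀ : ∀ (a b c d : Fin n) (x : R),
      (if a = b then 1 else 0) * x = (intSgn ((p a + p b) * (p c + p d)) :
        R) * (x * if a = b then 1 else 0) := by
    intro a b c d x
    by_cases hab : a = b
    · subst hab
      rw [show p a + p a = 0 by generalize p a = x; revert x; decide]
      simp [intSgn]
    · simp [hab]
  have h₀' : ∀ (a b c d : Fin n) (x : R),
      x * (if c = d then 1 else 0) = (intSgn ((p a + p b) * (p c + p d)) :
        R) * ((if c = d then 1 else 0) * x) := by
    intro a b c d x
    by_cases hab : c = d
    · subst hab
      rw [show p c + p c = 0 by generalize p c = x; revert x; decide]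
      simp [intSgn]
    · simp [hab]
  refine ExchangeRel.of_apply fun a b c d => ?_
  simp only [monodromyAt_singleton_apply]
  have key := congrArg (OperatorSeries.ofSeries R)
    (coeffSubst_exchange (PowerSeries.C ħ * g⁻¹) (PowerSeries.C ħ * g'⁻¹)
    (f := PowerSeries.mk fun r => S j r a b)
    (g := PowerSeries.mk fun r => S j r c d)
    (f₁ := PowerSeries.mk fun r => S j r c b)
    (g₁ := PowerSeries.mk fun r => S j r a d)
    (f₂ := PowerSeries.mk fun r => S j r a d)
    (g₂ := PowerSeries.mk fun r => S j r c b)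
    (intSgn ((p a + p b) * (p c + p d))) (intSgn (p a * (p b + p c) + p b * p c))
    (fun i => by simp only [PowerSeries.coeff_mk, hS.zero]; exact h₀ a b c d _)
    (fun i => by simp only [PowerSeries.coeff_mk, hS.zero]; exact h₀' a b c d _)
    fun r s => by
      simp only [PowerSeries.coeff_mk]
      exact hS.exchange j r s a b c d)
  rw [map_mul, map_mul, ← OperatorSeries.scalar_ofPowerSeries,
    ← OperatorSeries.scalar_ofPowerSeries,
    ← OperatorSeries.smul_eq, ← OperatorSeries.smul_eq] at key
  simp only [map_mul, map_sub, map_intCast] at key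
  have e := spectral_mul hg ħ
  have e' := spectral_mul hg' ħ
  simp only [map_mul] at e e'
  simp only [operatorAtSpectral, RingHom.comp_apply]
  generalize HahnSeries.ofPowerSeries ℤ F PowerSeries.X *
    (HahnSeries.ofPowerSeries ℤ F (PowerSeries.C ħ) * HahnSeries.ofPowerSeries ℤ F g⁻¹) = t
    at key e
  generalize HahnSeries.ofPowerSeries ℤ F PowerSeries.X *
    (HahnSeries.ofPowerSeries ℤ F (PowerSeries.C ħ) * HahnSeries.ofPowerSeries ℤ F g'⁻¹) = t'
    at key e'
  have hc : (HahnSeries.C ħ : LaurentSeries F) ≠ 0 := by simpa using hħ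
  have key' := congrArg (fun s => (spectral g * spectral g') • s) key
  simp only [smul_smul] at key'
  rw [show spectral g * spectral g' * (t' - t) = HahnSeries.C ħ * (spectral g - spectral g') by
      linear_combination spectral g * e' - spectral g' * e,
    show spectral g * spectral g' * (t' * t) = HahnSeries.C ħ * HahnSeries.C ħ by
      linear_combination spectral g * t * e' + HahnSeries.C ħ * e, ← smul_smul, ← smul_smul] at key'
  have := congrArg (fun s => (HahnSeries.C ħ : LaurentSeries F)⁻¹ • s) key'
  simpa only [inv_smul_smul₀ hc] using this

/-- The exchange relation of the monodromy matrices at two spectral parameters. -/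
lemma exchangeRel_monodromyAt (hS : IsSiteFamily p S) (hħ : ħ ≠ 0)
    (hg : PowerSeries.constantCoeff g ≠ 0) (hg' : PowerSeries.constantCoeff g' ≠ 0)
    {l : List (Fin L)} (hl : l.Nodup) :
    ExchangeRel p (spectral g - spectral g') (HahnSeries.C ħ)
      (monodromyAt S ħ g l) (monodromyAt S ħ g' l) := by
  induction l using List.reverseRecOn with
  | nil =>
    rw [monodromyAt_nil, monodromyAt_nil]
    exact ExchangeRel.one
  | append_singleton l j ih =>
    rw [List.nodup_append] at hl
    have hj : j ∉ l := fun hj => hl.2.2 j hj j (by simp) rfl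
    rw [monodromyAt_append, monodromyAt_append]
    exact (ih hl.1).mul (exchangeRel_singleton hS hħ hg hg' j) (commute_monodromyAt_left hS hj)
      (commute_monodromyAt_right hS hj)

/-! ### Action on the generating vector -/

section Action

variable {W : Type*} [AddCommGroup W] [Module R W] [Module F W] [IsScalarTower F R W] {v : W}

lemma operatorAtSpectral_smul_cyclicVector {f : PowerSeries R} {l : PowerSeries F}
    (h : ∀ r, PowerSeries.coeff r f • v = PowerSeries.coeff r l • v) :
    operatorAtSpectral ħ g f • cyclicVector R v = atSpectral ħ g l • cyclicVector R v := by
  rw [smul_cyclicVector_eq]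
  intro k
  simp only [atSpectral, operatorAtSpectral, RingHom.comp_apply, PowerSeries.coeff_coe,
    OperatorSeries.coeff_ofSeries]
  split_ifs with hk
  · rw [zero_smul, zero_smul]
  · rw [coeff_coeffSubst _ _ (Nat.lt_succ_self _), coeff_coeffSubst _ _ (Nat.lt_succ_self _),
      Finset.sum_smul, Finset.sum_smul]
    refine Finset.sum_congr rfl fun r _ => ?_
    rw [smul_assoc, h, smul_smul, smul_eq_mul]

lemma isTriangularOn_monodromyAt {l : List (Fin L)} {f : Fin n → PowerSeries F}
    (h : IsTriangularSeries (seriesMonodromy S l) v f) :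
    IsTriangularOn (monodromyAt S ħ g l) (cyclicVector R v) fun a => atSpectral ħ g (f a) where
  lower a b hab := by
    have := operatorAtSpectral_smul_cyclicVector (ħ := ħ) (g := g)
      (f := seriesMonodromy S l a b) (l := 0) (v := v)
      fun r => by rw [h.lower r a b hab, map_zero, zero_smul]
    rwa [map_zero, zero_smul] at this
  diag a := operatorAtSpectral_smul_cyclicVector fun r => h.diag r a

end Action

/-- Monodromy matrices at two spectral parameters differ by a multiple of the difference of the
parameters. -/
lemma exists_monodromyAt_sub (hg : PowerSeries.constantCoeff g ≠ 0)
    (hg' : PowerSeries.constantCoeff g' ≠ 0) (l : List (Fin L)) :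
    ∃ D : Matrix (Fin n) (Fin n) (PowerSeries (R)),
      monodromyAt S ħ g l = monodromyAt S ħ g' l +
        (spectral g - spectral g') • (OperatorSeries.ofSeries R).mapMatrix D := by
  choose d hd using fun a b : Fin n => exists_coeffSubst_sub (PowerSeries.C ħ * g⁻¹)
    (PowerSeries.C ħ * g'⁻¹) (seriesMonodromy S l a b)
  -- The factor comes from `ħ/w - ħ/w' = -(w - w') (ħ/w) (1/w')`.
  refine ⟨Matrix.of fun a b => scalarSeries
    (-(PowerSeries.X * (PowerSeries.C ħ * g⁻¹)) * (PowerSeries.X * (PowerSeries.C 1 * g'⁻¹))) *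
      d a b, ?_⟩
  ext1 a b
  have := congrArg (OperatorSeries.ofSeries R) (hd a b)
  rw [map_sub, map_mul, ← OperatorSeries.scalar_ofPowerSeries, ← OperatorSeries.smul_eq,
    map_sub] at this
  rw [Matrix.add_apply, Matrix.smul_apply, RingHom.mapMatrix_apply, Matrix.map_apply,
    Matrix.of_apply, map_mul, ← OperatorSeries.scalar_ofPowerSeries, ← OperatorSeries.smul_eq,
    smul_smul]
  change operatorAtSpectral ħ g _ = operatorAtSpectral ħ g' _ + _
  rw [← sub_eq_iff_eq_add']
  refine Eq.trans this ?_
  congr 1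
  rw [map_mul (HahnSeries.ofPowerSeries ℤ F) (-_), map_neg]
  have e := spectral_mul hg ħ
  have e' := spectral_mul hg' ħ
  have e₁ := spectral_mul hg' 1
  have h2 : HahnSeries.ofPowerSeries ℤ F (PowerSeries.X * (PowerSeries.C ħ * g'⁻¹)) =
      HahnSeries.C ħ * HahnSeries.ofPowerSeries ℤ F (PowerSeries.X * (PowerSeries.C 1 * g'⁻¹)) := by
    simp only [map_mul, HahnSeries.ofPowerSeries_C, map_one]
    ring
  rw [h2] at e' ⊢
  rw [map_one (HahnSeries.C (Γ := ℤ) (R := F))] at e₁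
  linear_combination HahnSeries.ofPowerSeries ℤ F (PowerSeries.X * (PowerSeries.C 1 * g'⁻¹)) * e -
    HahnSeries.ofPowerSeries ℤ F (PowerSeries.X * (PowerSeries.C ħ * g⁻¹)) * e₁

end Exchange

/-! ### The lattice generated by power series -/

section Lattice

variable {F : Type*} [Field F] {R : Type*} [Ring R] [Algebra F R] {W : Type*} [AddCommGroup W]
  [Module R W] {v : W}

variable (R) in
/-- The elements of the cyclic module given by power series in `u⁻¹`. -/
def seriesLattice (v : W) : AddSubgroup (CyclicModule R v) where
  carrier := {m | ∃ P : PowerSeries R, m = OperatorSeries.ofSeries R P • cyclicVector R v}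
  zero_mem' := ⟨0, by rw [map_zero, zero_smul]⟩
  add_mem' := by
    rintro _ _ ⟨P, rfl⟩ ⟨Q, rfl⟩
    exact ⟨P + Q, by rw [map_add, add_smul]⟩
  neg_mem' := by
    rintro _ ⟨P, rfl⟩
    exact ⟨-P, by rw [map_neg, neg_smul]⟩

lemma ofSeries_smul_mem (P : PowerSeries R) :
    OperatorSeries.ofSeries R P • cyclicVector R v ∈ seriesLattice R v := ⟨P, rfl⟩

lemma cyclicVector_mem : cyclicVector R v ∈ seriesLattice R v :=
  ⟨1, by rw [map_one, one_smul]⟩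

lemma ofPowerSeries_smul_mem (q : PowerSeries F) {m : CyclicModule R v}
    (hm : m ∈ seriesLattice R v) :
    HahnSeries.ofPowerSeries ℤ F q • m ∈ seriesLattice R v := by
  obtain ⟨P, rfl⟩ := hm
  exact ⟨scalarSeries q * P, by
    rw [← smul_assoc, OperatorSeries.smul_eq, OperatorSeries.scalar_ofPowerSeries, ← map_mul]⟩

lemma smul_cyclicVector_eq_zero_of_lattice {b : OperatorSeries R}
    (h : ∀ N : ℕ, ∃ m ∈ seriesLattice R v, b • cyclicVector R v =
      HahnSeries.ofPowerSeries ℤ F (PowerSeries.X ^ (N + 1)) • m) :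
    b • cyclicVector R v = 0 :=
  smul_cyclicVector_eq_zero_of_forall (F := F) fun N => by
    obtain ⟨_, ⟨P, rfl⟩, hP⟩ := h N
    exact ⟨P, hP⟩

end Lattice

/-! ### Scalar functions -/

section Scalar

variable {F : Type*} [Field F] {ħ : F} {g g' : PowerSeries F} {f : PowerSeries F}

lemma constantCoeff_coeffSubst {R : Type*} [Ring R] [Algebra F R] (σ : PowerSeries F)
    (f : PowerSeries R) :
    PowerSeries.constantCoeff (coeffSubst σ f) = PowerSeries.constantCoeff f := by
  rw [← PowerSeries.coeff_zero_eq_constantCoeff_apply, coeff_coeffSubst σ f Nat.zero_lt_one]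
  simp

lemma coeffSubst_zero {R : Type*} [Ring R] [Algebra F R] (f : PowerSeries R) :
    coeffSubst (0 : PowerSeries F) f = PowerSeries.C (PowerSeries.constantCoeff f) := by
  ext m
  rw [coeff_coeffSubst _ f (Nat.lt_succ_self m), Finset.sum_range_succ', Finset.sum_eq_zero]
  · by_cases h : m = 0 <;> simp [PowerSeries.coeff_C, PowerSeries.coeff_one, h]
  · intro r _
    rw [mul_zero, zero_pow (Nat.succ_ne_zero r), map_zero, zero_smul]

lemma exists_mul_atSpectral_eq_one (hf : PowerSeries.constantCoeff f = 1) :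
    ∃ q, HahnSeries.ofPowerSeries ℤ F q * atSpectral ħ g f = 1 :=
  ⟨(coeffSubst (PowerSeries.C ħ * g⁻¹) f)⁻¹, by
    rw [atSpectral, RingHom.comp_apply, ← map_mul, PowerSeries.inv_mul_cancel, map_one]
    rw [constantCoeff_coeffSubst, hf]
    exact one_ne_zero⟩

lemma atSpectral_ne_zero (hf : PowerSeries.constantCoeff f = 1) : atSpectral ħ g f ≠ 0 := by
  obtain ⟨q, hq⟩ := exists_mul_atSpectral_eq_one (ħ := ħ) (g := g) hf
  exact right_ne_zero_of_mul_eq_one hq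

lemma atSpectral_zero (hf : PowerSeries.constantCoeff f = 1) : atSpectral 0 g f = 1 := by
  rw [atSpectral, RingHom.comp_apply, map_zero, zero_mul, coeffSubst_zero, hf, map_one, map_one]

/-- The divided difference of `f` bounds the change of an eigenvalue by the change `h` of the
parameter, up to a power series factor. -/
lemma exists_atSpectral_eq (hg : PowerSeries.constantCoeff g ≠ 0)
    (hg' : PowerSeries.constantCoeff g' ≠ 0) (ħ : F) (f h : PowerSeries F) (e : g = g' + h) :
    ∃ d, atSpectral ħ g f = atSpectral ħ g' f +
      HahnSeries.ofPowerSeries ℤ F h * HahnSeries.ofPowerSeries ℤ F d := by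
  obtain ⟨d, hd⟩ := exists_coeffSubst_sub (PowerSeries.C ħ * g⁻¹) (PowerSeries.C ħ * g'⁻¹) f
  refine ⟨-(PowerSeries.X * PowerSeries.C ħ * g⁻¹ * g'⁻¹) * d, ?_⟩
  rw [atSpectral, atSpectral, RingHom.comp_apply, RingHom.comp_apply, ← map_mul, ← map_add]
  congr 1
  rw [← sub_eq_iff_eq_add', hd]
  have h1 : scalarSeries (PowerSeries.X * (PowerSeries.C ħ * g⁻¹) -
      PowerSeries.X * (PowerSeries.C ħ * g'⁻¹)) = PowerSeries.X * (PowerSeries.C ħ * g⁻¹) -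
      PowerSeries.X * (PowerSeries.C ħ * g'⁻¹) := by
    ext m; exact PowerSeries.coeff_map _ m _
  rw [h1]
  have i₁ := PowerSeries.mul_inv_cancel g hg
  have i₂ := PowerSeries.mul_inv_cancel g' hg'
  rw [eq_sub_of_add_eq' e.symm]
  linear_combination (-(PowerSeries.X * PowerSeries.C ħ * g⁻¹ * d)) * i₂ +
    PowerSeries.X * PowerSeries.C ħ * g'⁻¹ * d * i₁

lemma C_add_X_pow_ne_zero (a : F) (N : ℕ) : (HahnSeries.C a : LaurentSeries F) +
    HahnSeries.ofPowerSeries ℤ F (PowerSeries.X ^ (N + 1)) ≠ 0 := by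
  rw [← HahnSeries.ofPowerSeries_C, ← map_add]
  intro h
  have := HahnSeries.ofPowerSeries_injective (h.trans (map_zero _).symm)
  have := congrArg (PowerSeries.coeff (N + 1)) this
  simp [PowerSeries.coeff_X_pow] at this

end Scalar

/-! ### The inverse monodromy matrix on the generating vector -/

section Inverse

variable {n L : ℕ} {p : Fin n → ZMod 2} {F : Type*} [Field F] {R : Type*} [Ring R] [Algebra F R]
  {S : Fin L → ℕ → Fin n → Fin n → R} {ħ : F}

lemma monodromyAt_zero (hS : IsSiteFamily p S) (g : PowerSeries F) (l : List (Fin L)) :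
    monodromyAt S 0 g l = 1 := by
  have e : ∀ f : PowerSeries R, operatorAtSpectral (0 : F) g f =
      OperatorSeries.ofSeries R (PowerSeries.C (PowerSeries.constantCoeff f)) := fun f => by
    rw [operatorAtSpectral, RingHom.comp_apply, map_zero, zero_mul, coeffSubst_zero]
  ext1 a b
  have := congrFun (congrFun (constantCoeff_seriesMonodromy hS.zero l) a) b
  rw [RingHom.mapMatrix_apply, Matrix.map_apply] at this
  rw [monodromyAt, RingHom.mapMatrix_apply, Matrix.map_apply, e, this]
  by_cases hab : a = b
  · subst hab; rw [Matrix.one_apply_eq, Matrix.one_apply_eq, map_one, map_one]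
  · rw [Matrix.one_apply_ne hab, Matrix.one_apply_ne hab, map_zero, map_zero]

/-- The division by `ħ` excludes `ħ = 0`, where the monodromy matrix is the identity. -/
lemma exchangeRel_monodromyAt' (hS : IsSiteFamily p S) (ħ : F) {g g' : PowerSeries F}
    (hg : PowerSeries.constantCoeff g ≠ 0) (hg' : PowerSeries.constantCoeff g' ≠ 0)
    {l : List (Fin L)} (hl : l.Nodup) :
    ExchangeRel p (spectral g - spectral g') (HahnSeries.C ħ)
      (monodromyAt S ħ g l) (monodromyAt S ħ g' l) := by
  by_cases hħ : ħ = 0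
  · subst hħ
    rw [monodromyAt_zero hS, monodromyAt_zero hS]
    exact ExchangeRel.one
  · exact exchangeRel_monodromyAt hS hħ hg hg' hl

/-- The spectral parameter `-u + ħ c_k`. -/
def pivotParam (p : Fin n → ZMod 2) (ħ : F) (k : ℕ) : PowerSeries F :=
  -1 + PowerSeries.C (ħ * partialSum (fun m => (intSgn (p m) : F)) k) * PowerSeries.X

lemma constantCoeff_pivotParam (k : ℕ) :
    PowerSeries.constantCoeff (pivotParam p ħ k) = -1 := by simp [pivotParam]

variable {W : Type*} [AddCommGroup W] [Module R W] [Module F W] [IsScalarTower F R W] {v : W}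
  {l : List (Fin L)} {f : Fin n → PowerSeries F} {U' : Matrix (Fin n) (Fin n) (PowerSeries R)}
  {θ : Fin n → LaurentSeries F}

/-- The diagonal entries of the inverse monodromy matrix on the generating vector. -/
structure IsPivot (p : Fin n → ZMod 2) (ħ : F) (f : Fin n → PowerSeries F)
    (θ : Fin n → LaurentSeries F) : Prop where
  first : ∀ c : Fin n, c.val = 0 → θ c * atSpectral ħ (-1) (f c) = 1
  step : ∀ d c : Fin n, d.val + 1 = c.val → θ c * atSpectral ħ (pivotParam p ħ c.val) (f c) =
    θ d * atSpectral ħ (pivotParam p ħ c.val) (f d)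

lemma IsPivot.eq_one (h : IsPivot p 0 f θ) (hf : ∀ a, PowerSeries.constantCoeff (f a) = 1)
    (c : Fin n) : θ c = 1 := by
  obtain ⟨k, hk⟩ := c
  induction k with
  | zero => simpa [atSpectral_zero (hf _)] using h.first ⟨0, hk⟩ rfl
  | succ k ih =>
    have := h.step ⟨k, by omega⟩ ⟨k + 1, hk⟩ rfl
    rw [atSpectral_zero (hf _), atSpectral_zero (hf _), ih, mul_one, mul_one] at this
    exact this

lemma columnsBelow_succ {A M : Type*} [Ring A] [AddCommGroup M] [Module A M] [Module F M]
    {Y' : Matrix (Fin n) (Fin n) A} {ω : M} {θ : Fin n → F} {k : ℕ} (hk : k < n)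
    (h : ColumnsBelow Y' ω θ k) (h₁ : ∀ a, ⟨k, hk⟩ < a → Y' a ⟨k, hk⟩ • ω = 0)
    (h₂ : Y' ⟨k, hk⟩ ⟨k, hk⟩ • ω = θ ⟨k, hk⟩ • ω) : ColumnsBelow Y' ω θ (k + 1) := by
  intro b hb
  rcases Nat.lt_succ_iff_lt_or_eq.1 hb with hb' | hb'
  · exact h b hb'
  · obtain rfl : b = ⟨k, hk⟩ := Fin.ext hb'
    exact ⟨h₁, h₂⟩

end Inverse

/-- The linear algebra of the limit: the weights `ν`, `ν'` at the approaching parameter are replaced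
by `μ`, `μ'` at the limit, modulo `y`. Then `θ μ = θ' μ'` removes the main term and `y` factors out.
-/
lemma solve_pivot {E M : Type*} [Field E] [AddCommGroup M] [Module E M] {t t' ω B : M}
    {q s x y μ μ' ν ν' e e' θ θ' : E} (hs : q * s = 1)
    (key : s • (ν • t - (θ' * ν') • ω) = y • B) (hν : ν = μ + y * x * e)
    (hν' : ν' = μ' + y * x * e') (hθ : θ * μ = θ' * μ') (ht' : t' = θ' • ω) :
    μ • t - (μ * θ) • ω = y • (q • B - (x * e) • t + (x * e') • t') := by
  have h := congrArg (fun m => q • m) key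
  rw [smul_smul, hs, one_smul, smul_comm] at h
  rw [smul_add, smul_sub, ← h, mul_comm μ, hθ, ht', hν, hν']
  module

/-! ### Columns of the inverse, by approaching the parameters `-u + ħ c_k`. -/

section Pivot

variable {n L : ℕ} {p : Fin n → ZMod 2} {F : Type*} [Field F] {R : Type*} [Ring R] [Algebra F R]
  {S : Fin L → ℕ → Fin n → Fin n → R} {ħ : F}
  {W : Type*} [AddCommGroup W] [Module R W] [Module F W] [IsScalarTower F R W] {v : W}
  {l : List (Fin L)} {f : Fin n → PowerSeries F} {U' : Matrix (Fin n) (Fin n) (PowerSeries R)}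
  {θ : Fin n → LaurentSeries F}

/-- A spectral parameter approaching `-u + ħ c_k`. -/
def approachParam (p : Fin n → ZMod 2) (ħ : F) (k N : ℕ) : PowerSeries F :=
  pivotParam p ħ k + PowerSeries.X ^ (N + 2)

lemma constantCoeff_approachParam (k N : ℕ) :
    PowerSeries.constantCoeff (approachParam p ħ k N) = -1 := by
  simp [approachParam, constantCoeff_pivotParam]

lemma spectral_approachParam_sub (k N : ℕ) :
    spectral (approachParam p ħ k N) - spectral (-1) =
      HahnSeries.C (ħ * partialSum (fun m => (intSgn (p m) : F)) k) +
        HahnSeries.ofPowerSeries ℤ F (PowerSeries.X ^ (N + 1)) := by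
  have h := invVar_mul_X (F := F)
  simp only [spectral, approachParam, pivotParam, map_add, map_neg, map_one, map_mul, map_pow,
    HahnSeries.ofPowerSeries_C]
  linear_combination ((HahnSeries.C ħ * HahnSeries.C (partialSum (fun m => (intSgn (p m) : F)) k) +
    HahnSeries.ofPowerSeries ℤ F PowerSeries.X ^ (N + 1) : LaurentSeries F)) * h

lemma partialSum_C (k : ℕ) : partialSum (fun m => (intSgn (p m) : LaurentSeries F)) k =
    HahnSeries.C (partialSum (fun m => (intSgn (p m) : F)) k) := by
  simp only [partialSum, map_sum]
  refine Finset.sum_congr rfl fun m _ => ?_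
  split_ifs
  · rw [map_intCast]
  · rw [map_zero]

lemma shiftFactor_approachParam (c N k : ℕ) :
    shiftFactor p (spectral (approachParam p ħ c N) - spectral (-1)) (HahnSeries.C ħ) k =
      HahnSeries.C (ħ * partialSum (fun m => (intSgn (p m) : F)) c -
        ħ * partialSum (fun m => (intSgn (p m) : F)) k) +
          HahnSeries.ofPowerSeries ℤ F (PowerSeries.X ^ (N + 1)) := by
  rw [shiftFactor, spectral_approachParam_sub, partialSum_C, map_sub,
    map_mul HahnSeries.C ħ (partialSum _ k)]
  ring

/-- The lower entries of a column of the inverse monodromy matrix vanish on the generating vector,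
given the preceding columns. -/
lemma inverse_lower_eq_zero (hS : IsSiteFamily p S) (hl : l.Nodup)
    (hU : IsTriangularSeries (seriesMonodromy S l) v f)
    (hf : ∀ a, PowerSeries.constantCoeff (f a) = 1) (h₁ : seriesMonodromy S l * U' = 1)
    (h₂ : U' * seriesMonodromy S l = 1) {c : Fin n}
    (hc : ColumnsBelow ((operatorAtSpectral ħ (-1)).mapMatrix U') (cyclicVector R v) θ c.val)
    {a : Fin n} (hca : c < a) :
    (operatorAtSpectral ħ (-1)).mapMatrix U' a c • cyclicVector R v = 0 := by
  have hg₁ : PowerSeries.constantCoeff (-1 : PowerSeries F) ≠ 0 := by simp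
  have e₁ : monodromyAt S ħ (-1) l * (operatorAtSpectral ħ (-1)).mapMatrix U' = 1 := by
    rw [monodromyAt, ← map_mul, h₁, map_one]
  have e₂ : (operatorAtSpectral ħ (-1)).mapMatrix U' * monodromyAt S ħ (-1) l = 1 := by
    rw [monodromyAt, ← map_mul, h₂, map_one]
  refine smul_cyclicVector_eq_zero_of_lattice (F := F) fun N => ?_
  have hg : PowerSeries.constantCoeff (approachParam p ħ c.val N) ≠ 0 := by
    simp [constantCoeff_approachParam]
  obtain ⟨D, hD⟩ := exists_monodromyAt_sub (S := S) (ħ := ħ) hg hg₁ l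
  have key := (exchangeRel_monodromyAt' hS ħ hg hg₁ hl).lower_inverse_smul e₁ e₂
    (isTriangularOn_monodromyAt hU)
    (by rw [spectral_approachParam_sub]; exact C_add_X_pow_ne_zero _ _) hD hca hc
  -- Here `Z_c` is exactly `u^{-(N+1)}`.
  rw [shiftFactor_approachParam, sub_self, map_zero, zero_add] at key
  obtain ⟨q, hq⟩ := exists_mul_atSpectral_eq_one (ħ := ħ) (g := approachParam p ħ c.val N) (hf c)
  have key' := congrArg (fun t => HahnSeries.ofPowerSeries ℤ F q • t) key
  rw [smul_smul, hq, one_smul, smul_comm] at key'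
  refine ⟨_, ?_, key'⟩
  refine ofPowerSeries_smul_mem q ?_
  rw [operatorAtSpectral, ← RingHom.mapMatrix_comp, RingHom.comp_apply, ← map_mul]
  exact ofSeries_smul_mem _

/-- The diagonal entry of a column of the inverse monodromy matrix on the generating vector, given
the preceding columns. -/
lemma inverse_diag_eq (hS : IsSiteFamily p S) (hħ : ħ ≠ 0) (hl : l.Nodup)
    (hU : IsTriangularSeries (seriesMonodromy S l) v f)
    (hf : ∀ a, PowerSeries.constantCoeff (f a) = 1) (h₁ : seriesMonodromy S l * U' = 1)
    (h₂ : U' * seriesMonodromy S l = 1) (hθ : IsPivot p ħ f θ) {d c : Fin n}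
    (hdc : d.val + 1 = c.val)
    (hc : ColumnsBelow ((operatorAtSpectral ħ (-1)).mapMatrix U') (cyclicVector R v) θ c.val) :
    (operatorAtSpectral ħ (-1)).mapMatrix U' c c • cyclicVector R v =
      θ c • cyclicVector R v := by
  have hg₁ : PowerSeries.constantCoeff (-1 : PowerSeries F) ≠ 0 := by simp
  have e₁ : monodromyAt S ħ (-1) l * (operatorAtSpectral ħ (-1)).mapMatrix U' = 1 := by
    rw [monodromyAt, ← map_mul, h₁, map_one]
  have e₂ : (operatorAtSpectral ħ (-1)).mapMatrix U' * monodromyAt S ħ (-1) l = 1 := by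
    rw [monodromyAt, ← map_mul, h₂, map_one]
  set T' := (operatorAtSpectral ħ (-1)).mapMatrix U' with hT'
  have memT' : ∀ a b, T' a b • cyclicVector R v ∈ seriesLattice R v := fun a b => by
    rw [hT', operatorAtSpectral, ← RingHom.mapMatrix_comp, RingHom.comp_apply]
    exact ofSeries_smul_mem _
  have hp : PowerSeries.constantCoeff (pivotParam p ħ c.val) ≠ 0 := by
    simp [constantCoeff_pivotParam]
  have hd : T' d d • cyclicVector R v = θ d • cyclicVector R v := (hc d (by omega)).2
  set κ : F := ħ * partialSum (fun m => (intSgn (p m) : F)) c.val with hκ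
  set μ : Fin n → LaurentSeries F := fun a => atSpectral ħ (pivotParam p ħ c.val) (f a) with hμ
  -- Divisibility by every power of `u⁻¹` is proved after multiplication by the limiting weight `μ
  -- c`, which is nonzero and cancelled afterwards.
  have main : (μ c • (T' c c - OperatorSeries.scalar F R (θ c))) • cyclicVector R v = 0 := by
    refine smul_cyclicVector_eq_zero_of_lattice (F := F) fun N => ?_
    have hg : PowerSeries.constantCoeff (approachParam p ħ c.val N) ≠ 0 := by
      simp [constantCoeff_approachParam]
    obtain ⟨D, hD⟩ := exists_monodromyAt_sub (S := S) (ħ := ħ) hg hg₁ l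
    have hDT : ∀ i, (((OperatorSeries.ofSeries R).mapMatrix D * T') i i) • cyclicVector R v ∈
        seriesLattice R v := fun i => by
      rw [hT', operatorAtSpectral, ← RingHom.mapMatrix_comp, RingHom.comp_apply, ← map_mul]
      exact ofSeries_smul_mem _
    have hTD : ((T' * (OperatorSeries.ofSeries R).mapMatrix D) c c) • cyclicVector R v ∈
        seriesLattice R v := by
      rw [hT', operatorAtSpectral, ← RingHom.mapMatrix_comp, RingHom.comp_apply, ← map_mul]
      exact ofSeries_smul_mem _
    have hsf := shiftFactor_approachParam (p := p) (ħ := ħ) c.val N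
    have key := (exchangeRel_monodromyAt' hS ħ hg hg₁ hl).diag_inverse_smul e₁ e₂
      (isTriangularOn_monodromyAt hU)
      (by rw [spectral_approachParam_sub]; exact C_add_X_pow_ne_zero _ _) hD
      (fun k => by rw [hsf]; exact C_add_X_pow_ne_zero _ _) hdc hc
    rw [hsf c.val, hsf d.val, sub_self, map_zero, zero_add] at key
    obtain ⟨ec, hec⟩ := exists_atSpectral_eq hg hp ħ (f c) _ rfl
    obtain ⟨ed, hed⟩ := exists_atSpectral_eq hg hp ħ (f d) _ rfl
    -- The bracket of `ExchangeRel.diag_inverse_smul` stays in the lattice for every `N`, so the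
    -- factor `Z_c = u^{-(N+1)}` alone gives the divisibility.
    have hB : cyclicVector R v +
        ((HahnSeries.C (ħ * partialSum (fun m => (intSgn (p m) : F)) c.val -
            ħ * partialSum (fun m => (intSgn (p m) : F)) d.val) : LaurentSeries F) +
          HahnSeries.ofPowerSeries ℤ F (PowerSeries.X ^ (N + 1))) •
            (T' * (OperatorSeries.ofSeries R).mapMatrix D) c c • cyclicVector R v +
        ∑ i ∈ Finset.Iio d,
            ((HahnSeries.C ħ : LaurentSeries F) * (intSgn (p i) : LaurentSeries F)) •
            ((OperatorSeries.ofSeries R).mapMatrix D * T') i i • cyclicVector R v -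
        atSpectral ħ (approachParam p ħ c.val N) (f c) • T' c c • cyclicVector R v ∈
          seriesLattice R v := by
      refine sub_mem (add_mem (add_mem cyclicVector_mem ?_) (sum_mem fun i _ => ?_)) ?_
      · rw [← HahnSeries.ofPowerSeries_C, ← map_add]
        exact ofPowerSeries_smul_mem _ hTD
      · rw [← HahnSeries.ofPowerSeries_C, ← map_intCast (HahnSeries.ofPowerSeries ℤ F), ← map_mul]
        exact ofPowerSeries_smul_mem _ (hDT i)
      · exact ofPowerSeries_smul_mem _ (memT' c c)
    generalize (cyclicVector R v + _ + _ - _ : CyclicModule R v) = B at hB key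
    have hs : HahnSeries.ofPowerSeries ℤ F (PowerSeries.C (ħ⁻¹ * (intSgn (p d) : F))) *
        (HahnSeries.C ħ * (intSgn (p d) : LaurentSeries F)) = 1 := by
      rw [HahnSeries.ofPowerSeries_C, ← map_intCast (HahnSeries.C (Γ := ℤ) (R := F)), ← map_mul,
        ← map_mul, ← map_one (HahnSeries.C (Γ := ℤ) (R := F))]
      congr 1
      have := congrArg (Int.cast : ℤ → F) (intSgn_mul_self (p d))
      push_cast at this
      field_simp
      linear_combination this
    -- Since `w = u g`, the perturbation of `g` is one order smaller than that of `w`; the spare `X`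
    -- is the `x` of `solve_pivot`.
    have hX : HahnSeries.ofPowerSeries ℤ F (PowerSeries.X ^ (N + 2)) =
        HahnSeries.ofPowerSeries ℤ F (PowerSeries.X ^ (N + 1)) *
          HahnSeries.ofPowerSeries ℤ F PowerSeries.X := by
      rw [← map_mul, ← pow_succ]
    rw [hX] at hec hed
    refine ⟨_, ?_, (?_ : _ = _).trans
      (solve_pivot hs key hec hed (hθ.step d c hdc) hd)⟩
    · refine add_mem (sub_mem (ofPowerSeries_smul_mem _ hB) ?_) ?_
      · rw [← map_mul]
        exact ofPowerSeries_smul_mem _ (memT' c c)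
      · rw [← map_mul]
        exact ofPowerSeries_smul_mem _ (memT' d d)
    · rw [smul_assoc, sub_smul, ← scalar_smul_cyclicVector, smul_sub, smul_smul]
  have hne : μ c ≠ 0 := atSpectral_ne_zero (hf c)
  rw [smul_assoc, sub_smul, ← scalar_smul_cyclicVector] at main
  have := congrArg (fun t => (μ c)⁻¹ • t) main
  simp only [inv_smul_smul₀ hne, smul_zero] at this
  exact sub_eq_zero.1 this

/-- The inverse monodromy matrix at `-u` is upper triangular on the generating vector. -/
theorem columnsBelow_inverse (hS : IsSiteFamily p S) (hl : l.Nodup)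
    (hU : IsTriangularSeries (seriesMonodromy S l) v f)
    (hf : ∀ a, PowerSeries.constantCoeff (f a) = 1) (h₁ : seriesMonodromy S l * U' = 1)
    (h₂ : U' * seriesMonodromy S l = 1) (hθ : IsPivot p ħ f θ) :
    ColumnsBelow ((operatorAtSpectral ħ (-1)).mapMatrix U') (cyclicVector R v) θ n := by
  have e₂ : (operatorAtSpectral ħ (-1)).mapMatrix U' * monodromyAt S ħ (-1) l = 1 := by
    rw [monodromyAt, ← map_mul, h₂, map_one]
  suffices h : ∀ k ≤ n,
      ColumnsBelow ((operatorAtSpectral ħ (-1)).mapMatrix U') (cyclicVector R v) θ k from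
    h n le_rfl
  intro k
  induction k with
  | zero => exact fun _ b hb => absurd hb (Nat.not_lt_zero _)
  | succ k ih =>
    intro hk
    have hc := ih (Nat.le_of_succ_le hk)
    refine columnsBelow_succ hk hc
      (fun a ha => inverse_lower_eq_zero hS hl hU hf h₁ h₂ (c := ⟨k, hk⟩) hc ha) ?_
    rcases k with _ | d
    -- In the first column, only `Y'_{00} Y_{00}` survives in the entry `(0, 0)` of `Y' Y = 1`.
    · have key := congrArg (fun t => t • cyclicVector R v)
        (congrFun (congrFun e₂ ⟨0, hk⟩) ⟨0, hk⟩)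
      have hT := isTriangularOn_monodromyAt (ħ := ħ) (g := -1) hU
      simp only [Matrix.mul_apply, Finset.sum_smul, Matrix.one_apply_eq, one_smul] at key
      rw [Finset.sum_eq_single ⟨0, hk⟩, mul_smul, hT.diag, smul_smul_comm_tower] at key
      · conv_rhs => rw [← key]
        rw [smul_smul, hθ.first _ rfl, one_smul]
      · intro i _ hi
        rw [mul_smul, hT.lower _ _ (lt_of_le_of_ne (Nat.zero_le _) hi.symm), smul_zero]
      · simp
    · by_cases hħ : ħ = 0
      · subst hħ
        rw [monodromyAt_zero hS, mul_one] at e₂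
        rw [e₂, Matrix.one_apply_eq, hθ.eq_one hf]
        rw [one_smul, one_smul]
      · exact inverse_diag_eq hS hħ hl hU hf h₁ h₂ hθ (d := ⟨d, by omega⟩) (c := ⟨d + 1, hk⟩) rfl hc

end Pivot

/-! ### The boundary eigenvalue -/

section Boundary

variable {n L : ℕ} {p : Fin n → ZMod 2} {F : Type*} [Field F] {R : Type*} [Ring R] [Algebra F R]
  {S : Fin L → ℕ → Fin n → Fin n → R} {ħ : F}

lemma coeffSubst_C_eq (c : F) (f : PowerSeries R) : coeffSubst (PowerSeries.C c) f =
    PowerSeries.mk fun r => c ^ r • PowerSeries.coeff r f := by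
  ext m
  rw [coeff_coeffSubst _ f (Nat.lt_succ_self m), PowerSeries.coeff_mk, Finset.sum_eq_single m]
  · rw [mul_pow, ← map_pow, mul_comm, PowerSeries.coeff_C_mul, PowerSeries.coeff_X_pow_self,
      mul_one]
  · intro r _ hr
    rw [mul_pow, ← map_pow, mul_comm, PowerSeries.coeff_C_mul, PowerSeries.coeff_X_pow,
      if_neg hr.symm, mul_zero, zero_smul]
  · simp

/-- The product of the site matrices at the spectral parameter `ε u`, normalized by factors `t`. -/
lemma prod_siteMatrix (S : Fin L → ℕ → Fin n → Fin n → R) (ħ : F) {ε : F} (hε : ε ≠ 0)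
    (t : Fin L → LaurentSeries F) :
    (List.ofFn fun j => (Matrix.of fun a b => OperatorSeries.scalar F R (t j) *
      OperatorSeries.ofSeries R (PowerSeries.mk fun r => (ħ / ε) ^ r • S j r a b) :
        Matrix (Fin n) (Fin n) (OperatorSeries R))).prod =
      (∏ j, t j) • monodromyAt S ħ (PowerSeries.C ε) (List.finRange L) := by
  have e : ∀ j, (Matrix.of fun a b => OperatorSeries.scalar F R (t j) *
      OperatorSeries.ofSeries R (PowerSeries.mk fun r => (ħ / ε) ^ r • S j r a b) :
        Matrix (Fin n) (Fin n) (OperatorSeries R)) =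
      t j • monodromyAt S ħ (PowerSeries.C ε) [j] := by
    intro j
    ext1 a b
    have hi : PowerSeries.C ħ * (PowerSeries.C ε)⁻¹ = PowerSeries.C (ħ / ε) := by
      rw [eq_comm, PowerSeries.eq_mul_inv_iff_mul_eq (by simpa using hε), ← map_mul,
        div_mul_cancel₀ _ hε]
    rw [Matrix.smul_apply, monodromyAt_singleton_apply, operatorAtSpectral, RingHom.comp_apply, hi,
      coeffSubst_C_eq, OperatorSeries.smul_eq, Matrix.of_apply]
    simp only [PowerSeries.coeff_mk]
  simp only [e]
  rw [List.ofFn_eq_map, Fin.prod_univ_def]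
  generalize List.finRange L = l
  induction l using List.reverseRecOn with
  | nil => simp [monodromyAt_nil]
  | append_singleton l j ih =>
    rw [List.map_append, List.prod_append, ih, List.map_append, List.prod_append,
      monodromyAt_append]
    simp only [List.map_cons, List.map_nil, List.prod_singleton]
    rw [Matrix.smul_mul, Matrix.mul_smul, smul_smul]

variable {W : Type*} [AddCommGroup W] [Module R W] [Module F W] [IsScalarTower F R W] {v : W}
  {l : List (Fin L)} {f : Fin n → PowerSeries F} {θ : Fin n → LaurentSeries F}

lemma spectral_one_sub : spectral (1 : PowerSeries F) - spectral (-1) = 2 * invVar F := by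
  simp only [spectral, map_neg, map_one]
  ring

/-- The coefficient of `u` is `2`, which is nonzero in characteristic zero. -/
lemma shiftFactor_two_mul_invVar_ne_zero [CharZero F] (k : ℕ) :
    shiftFactor p (2 * invVar F) (HahnSeries.C ħ) k ≠ 0 := by
  intro h
  have := congrArg (fun x => HahnSeries.coeff x (-1)) h
  rw [shiftFactor, partialSum_C, ← map_mul, two_mul] at this
  simp [invVar, HahnSeries.coeff_single_of_ne] at this

/-- The transfer matrix of the open chain acts diagonally on the generating vector. -/
theorem openTransfer_smul [CharZero F] (hS : IsSiteFamily p S) (hl : l.Nodup)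
    (hU : IsTriangularSeries (seriesMonodromy S l) v f)
    (hf : ∀ a, PowerSeries.constantCoeff (f a) = 1) (hθ : IsPivot p ħ f θ)
    {s s' : LaurentSeries F} (hs' : s' ≠ 0) (D : LaurentSeries F)
    (K Kplus : Fin n → LaurentSeries F) {T T₁ : Matrix (Fin n) (Fin n) (OperatorSeries R)}
    (hT : T = s • monodromyAt S ħ 1 l)
    (hT₁ : T₁ = s' • monodromyAt S ħ (-1) l) :
    IsUnit T₁ ∧
      (OperatorSeries.scalar F R D * ∑ k, OperatorSeries.scalar F R (intSgn (p k) * Kplus k) *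
        (T * Matrix.diagonal (fun j => OperatorSeries.scalar F R (K j)) * Ring.inverse T₁) k k) •
          cyclicVector R v =
        (∑ j, (intSgn (p j) : LaurentSeries F) *
          (boundaryLeft p (2 * invVar F) (HahnSeries.C ħ) K j *
          boundaryRight p (2 * invVar F) (HahnSeries.C ħ) Kplus j) *
            (D * (s'⁻¹ * θ j) * (s * atSpectral ħ 1 (f j)))) • cyclicVector R v := by
  have hg₁ : PowerSeries.constantCoeff (1 : PowerSeries F) ≠ 0 := by simp
  have hg₂ : PowerSeries.constantCoeff (-1 : PowerSeries F) ≠ 0 := by simp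
  obtain ⟨U', h₁, h₂⟩ := exists_inverse_of_constantCoeff (constantCoeff_seriesMonodromy hS.zero l)
  set T' := (operatorAtSpectral ħ (-1)).mapMatrix U' with hT'
  have e₁ : monodromyAt S ħ (-1) l * T' = 1 := by
    rw [monodromyAt, ← map_mul, h₁, map_one]
  have e₂ : T' * monodromyAt S ħ (-1) l = 1 := by
    rw [monodromyAt, ← map_mul, h₂, map_one]
  have i₁ : T₁ * (s'⁻¹ • T') = 1 := by
    rw [hT₁, Matrix.smul_mul, Matrix.mul_smul, e₁, smul_smul, mul_inv_cancel₀ hs', one_smul]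
  have i₂ : (s'⁻¹ • T') * T₁ = 1 := by
    rw [hT₁, Matrix.smul_mul, Matrix.mul_smul, e₂, smul_smul, inv_mul_cancel₀ hs', one_smul]
  have hinv : Ring.inverse T₁ = s'⁻¹ • T' := Ring.inverse_unit ⟨T₁, _, i₁, i₂⟩
  refine ⟨⟨⟨T₁, _, i₁, i₂⟩, rfl⟩, ?_⟩
  have hc := columnsBelow_inverse hS hl hU hf h₁ h₂ hθ
  have hZ := shiftFactor_two_mul_invVar_ne_zero (p := p) (ħ := ħ)
  have hz : 2 * invVar F ≠ 0 := by
    simpa only [shiftFactor, partialSum_zero, mul_zero, sub_zero] using hZ 0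
  have hex := exchangeRel_monodromyAt' hS ħ hg₁ hg₂ hl
  rw [spectral_one_sub] at hex
  have key := hex.boundary_diag_smul e₁ e₂ (isTriangularOn_monodromyAt hU) hz hZ hc K
  rw [hinv, hT]
  have e : ∀ k, (OperatorSeries.scalar F R (intSgn (p k) * Kplus k) *
      (s • monodromyAt S ħ 1 l * Matrix.diagonal (fun j => OperatorSeries.scalar F R (K j)) *
        s'⁻¹ • T') k k) • cyclicVector R v =
      (s * s'⁻¹) • ((intSgn (p k) : LaurentSeries F) * Kplus k *
          (θ k * atSpectral ħ 1 (f k) * boundaryLeft p (2 * invVar F) (HahnSeries.C ħ) K k -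
          HahnSeries.C ħ * ∑ j ∈ Finset.Iio k,
            (intSgn (p j) : LaurentSeries F) * (θ j * atSpectral ħ 1 (f j)) *
            boundaryLeft p (2 * invVar F) (HahnSeries.C ħ) K j /
              shiftFactor p (2 * invVar F) (HahnSeries.C ħ) (j.val + 1))) • cyclicVector R v := by
    intro k
    rw [Matrix.smul_mul, Matrix.smul_mul, Matrix.mul_smul, Matrix.smul_apply, Matrix.smul_apply,
      ← OperatorSeries.smul_eq, smul_assoc, smul_assoc, smul_assoc]
    refine (congrArg (fun t => _ • s • s'⁻¹ • t) (key k)).trans ?_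
    simp only [smul_smul]
    congr 1
    ring
  rw [← OperatorSeries.smul_eq, smul_assoc, Finset.sum_smul, Finset.sum_congr rfl fun k _ => e k,
    ← Finset.smul_sum, ← Finset.sum_smul, sum_boundary, smul_smul, smul_smul, Finset.mul_sum]
  congr 1
  exact Finset.sum_congr rfl fun j _ => by ring

end Boundary

/-! ### The weight functions -/

section Weight

variable {n L : ℕ} (p : Fin n → ZMod 2) (ħ : ℂ) (α : Fin L → ℂ) (ℓ : Fin L → Fin n → ℕ → ℂ)

/-- The eigenvalue series of the diagonal entries of the monodromy matrix. -/
def weightSeries (a : Fin n) : PowerSeries ℂ :=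
  ((List.finRange L).map fun j => PowerSeries.mk (ℓ j a)).prod

lemma csum_eq (k : ℕ) : csum p k = partialSum (fun m => (intSgn (p m) : ℂ)) k := by
  simp only [csum, partialSum, sgn_eq_intSgn]

/-- The factor `∏_j (w - a_j)`. -/
def siteFactor (w : LaurentSeries ℂ) : LaurentSeries ℂ := ∏ j, (w - const (α j))

variable {g : PowerSeries ℂ}

lemma weight_spectral (hg : PowerSeries.constantCoeff g ≠ 0) (a : Fin n) :
    weight ħ α ℓ a (spectral g) =
      siteFactor α (spectral g) * atSpectral ħ g (weightSeries ℓ a) := by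
  rw [weight, Finset.prod_mul_distrib, weightSeries, map_list_prod, List.map_map, siteFactor,
    Fin.prod_univ_def (fun j => PowerSeries.heval _ _)]
  congr 3
  funext j
  exact heval_eq_atSpectral hg ħ _

lemma siteFactor_spectral_ne_zero (hg : PowerSeries.constantCoeff g ≠ 0) :
    siteFactor α (spectral g) ≠ 0 := by
  refine Finset.prod_ne_zero_iff.2 fun j _ => ?_
  -- Subtracting a constant from `u g(u⁻¹)` does not change the constant term of `g`.
  have e : spectral g - const (α j) = spectral (g - PowerSeries.C (α j) * PowerSeries.X) := by
    have h := invVar_mul_X (F := ℂ)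
    simp only [spectral, map_sub, map_mul, HahnSeries.ofPowerSeries_C, const]
    linear_combination (HahnSeries.C (α j)) * h
  rw [e]
  exact spectral_ne_zero (by simpa using hg)

lemma spectral_pivotParam (k : ℕ) :
    spectral (pivotParam p ħ k) = -u + const (ħ * csum p k) := by
  have h := invVar_mul_X (F := ℂ)
  rw [csum_eq]
  simp only [spectral, pivotParam, map_add, map_neg, map_one, map_mul, HahnSeries.ofPowerSeries_C,
    const]
  change invVar ℂ * _ = -invVar ℂ + _
  linear_combination
    (HahnSeries.C ħ * HahnSeries.C (partialSum (fun m => (intSgn (p m) : ℂ)) k)) * h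

variable {ℓ}

lemma constantCoeff_weightSeries (h : ∀ j a, ℓ j a 0 = 1) (a : Fin n) :
    PowerSeries.constantCoeff (weightSeries ℓ a) = 1 := by
  rw [weightSeries, map_list_prod, List.map_map]
  refine List.prod_eq_one fun x hx => ?_
  obtain ⟨j, -, rfl⟩ := List.mem_map.1 hx
  simp [← PowerSeries.coeff_zero_eq_constantCoeff_apply, h]

lemma weight_spectral_ne_zero (hℓ : ∀ j a, ℓ j a 0 = 1) (hg : PowerSeries.constantCoeff g ≠ 0)
    (a : Fin n) : weight ħ α ℓ a (spectral g) ≠ 0 := by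
  rw [weight_spectral ħ α ℓ hg]
  exact mul_ne_zero (siteFactor_spectral_ne_zero α hg)
    (atSpectral_ne_zero (constantCoeff_weightSeries hℓ a))

lemma inverseNorm_ne_zero (hℓ : ∀ j a, ℓ j a 0 = 1) : inverseNorm p ħ α ℓ ≠ 0 := by
  refine Finset.prod_ne_zero_iff.2 fun m _ => ?_
  rw [← spectral_pivotParam]
  exact weight_spectral_ne_zero ħ α hℓ (by simp [constantCoeff_pivotParam]) m

variable (ℓ)

/-- The product `∏_{m<j} λ_m(-u + ħ c_m) ∏_{m>j} λ_m(-u + ħ c_{m-1})`. -/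
def pivotNumerator (j : Fin n) : LaurentSeries ℂ :=
  (∏ m ∈ Finset.Iio j, weight ħ α ℓ m (-u + const (ħ * csum p (m.val + 1)))) *
    ∏ m ∈ Finset.Ioi j, weight ħ α ℓ m (-u + const (ħ * csum p m.val))

lemma pivotNumerator_first {c : Fin n} (hc : c.val = 0) :
    pivotNumerator p ħ α ℓ c * weight ħ α ℓ c (-u + const (ħ * csum p c.val)) =
      inverseNorm p ħ α ℓ := by
  have h₁ : Finset.Iio c = ∅ := by
    ext m; simp [Fin.le_def, hc]
  have h₂ : (Finset.univ : Finset (Fin n)) = insert c (Finset.Ioi c) := by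
    ext m
    simp only [Finset.mem_univ, Finset.mem_insert, Finset.mem_Ioi, true_iff]
    rw [Fin.ext_iff, Fin.lt_def]
    omega
  rw [pivotNumerator, inverseNorm, h₁, h₂, Finset.prod_insert (by simp), Finset.prod_empty, one_mul,
    mul_comm]

/-- Passing from `d` to `c = d + 1` replaces the factor of index `c` by the factor of index `d`, and
both have the argument `-u + ħ c_{d+1}`. -/
lemma pivotNumerator_step {d c : Fin n} (hdc : d.val + 1 = c.val) :
    pivotNumerator p ħ α ℓ c * weight ħ α ℓ c (-u + const (ħ * csum p c.val)) =
      pivotNumerator p ħ α ℓ d * weight ħ α ℓ d (-u + const (ħ * csum p c.val)) := by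
  have h₁ : Finset.Iio c = insert d (Finset.Iio d) := by
    ext m
    simp only [Finset.mem_insert, Finset.mem_Iio, Fin.ext_iff, Fin.lt_def]
    omega
  have h₂ : Finset.Ioi d = insert c (Finset.Ioi c) := by
    ext m
    simp only [Finset.mem_insert, Finset.mem_Ioi, Fin.ext_iff, Fin.lt_def]
    omega
  rw [pivotNumerator, pivotNumerator, h₁, h₂, Finset.prod_insert (by simp),
    Finset.prod_insert (by simp), hdc]
  ring

variable {ℓ}

/-- The recursion for `θ` has the explicit solution `pivotNumerator / inverseNorm`. The factor
`siteFactor` at `-u` compensates for the normalization that `monodromyAt` omits. -/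
lemma isPivot_weight (hℓ : ∀ j a, ℓ j a 0 = 1) : IsPivot p ħ (weightSeries ℓ) fun j =>
    siteFactor α (spectral (-1)) * pivotNumerator p ħ α ℓ j / inverseNorm p ħ α ℓ where
  first c hc := by
    have h := pivotNumerator_first p ħ α ℓ hc
    have e : -u + const (ħ * csum p c.val) = spectral (-1) := by
      rw [← spectral_pivotParam, hc, pivotParam, partialSum_zero, mul_zero, map_zero, zero_mul,
        add_zero]
    rw [e, weight_spectral ħ α ℓ (by simp)] at h
    rw [div_mul_eq_mul_div, div_eq_one_iff_eq (inverseNorm_ne_zero p ħ α hℓ), ← h]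
    ring
  step d c hdc := by
    have h := pivotNumerator_step p ħ α ℓ hdc
    have hg : PowerSeries.constantCoeff (pivotParam p ħ c.val) ≠ 0 := by
      simp [constantCoeff_pivotParam]
    rw [← spectral_pivotParam, weight_spectral ħ α ℓ hg, weight_spectral ħ α ℓ hg] at h
    have h' : pivotNumerator p ħ α ℓ c * atSpectral ħ (pivotParam p ħ c.val) (weightSeries ℓ c) =
        pivotNumerator p ħ α ℓ d * atSpectral ħ (pivotParam p ħ c.val) (weightSeries ℓ d) := by
      refine mul_left_cancel₀ (siteFactor_spectral_ne_zero α hg) ?_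
      linear_combination h
    rw [div_mul_eq_mul_div, div_mul_eq_mul_div, mul_assoc, mul_assoc, h']

lemma beta_eq (j : Fin n) :
    beta p ħ α ℓ j = pivotNumerator p ħ α ℓ j * weight ħ α ℓ j u := by
  rw [beta, pivotNumerator]
  ring

end Weight

/-! ### The boundary functions -/

section BoundaryFunctions

variable {n : ℕ} (p : Fin n → ZMod 2) (ħ : ℂ)

lemma shiftFactor_eq (k : ℕ) : shiftFactor p (2 * invVar ℂ) (HahnSeries.C ħ) k =
    2 * u - const (ħ * csum p k) := by
  rw [shiftFactor, partialSum_C, ← map_mul, csum_eq]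
  rfl

lemma const_sgn (z : ZMod 2) : const (sgn z) = (intSgn z : LaurentSeries ℂ) := by
  rw [const, sgn_eq_intSgn, map_intCast]

lemma const_csum (k : ℕ) :
    const (csum p k) = partialSum (fun m => (intSgn (p m) : LaurentSeries ℂ)) k := by
  rw [partialSum_C, csum_eq]
  rfl

lemma partialSum_add_sum_Ioi {F : Type*} [AddCommMonoid F] (h : Fin n → F) (j : Fin n) :
    partialSum h (j.val + 1) + ∑ m ∈ Finset.Ioi j, h m = partialSum h n := by
  have e : ∑ m ∈ Finset.Ioi j, h m = ∑ m, if j < m then h m else 0 := by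
    rw [← Finset.sum_filter]
    congr 1
    ext m
    simp
  rw [e, partialSum, partialSum, ← Finset.sum_add_distrib]
  refine Finset.sum_congr rfl fun m _ => ?_
  rcases lt_or_ge j m with hm | hm
  · rw [if_neg (by rw [Fin.lt_def] at hm; omega), if_pos hm, if_pos m.isLt, zero_add]
  · rw [if_pos (by rw [Fin.le_def] at hm; omega), if_neg hm.not_gt, if_pos m.isLt, add_zero]

variable (K Kplus : Fin n → LaurentSeries ℂ) (j : Fin n)

/-- The terms `-K_j` in the dressing sum add up to `-c_j K_j`, which turns the factor `2u` of `K_j`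
into `2u - ħ c_j`. -/
lemma dressedK_eq : 2 * u * dressedK p ħ K j = (2 * u - const (ħ * csum p j.val)) *
    boundaryLeft p (2 * invVar ℂ) (HahnSeries.C ħ) K j := by
  have hZ := shiftFactor_two_mul_invVar_ne_zero (p := p) (ħ := ħ) j.val
  have hu := shiftFactor_two_mul_invVar_ne_zero (p := p) (ħ := ħ) 0
  simp only [shiftFactor, partialSum_zero, mul_zero, sub_zero] at hu
  have hs : ∑ m ∈ Finset.Iio j, const (sgn (p m)) * (K m - K j) =
      partialSum (fun m => intSgn (p m) * K m) j.val - const (csum p j.val) * K j := by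
    simp only [mul_sub, Finset.sum_sub_distrib, const_sgn, ← Finset.sum_mul, sum_Iio_eq_partialSum,
      const_csum]
  rw [shiftFactor_eq] at hZ
  rw [dressedK, boundaryLeft, shiftFactor_eq, hs]
  have e : const (ħ * csum p j.val) = const ħ * const (csum p j.val) := map_mul HahnSeries.C _ _
  change _ = _ * (K j + const ħ / _ * _)
  change 2 * u ≠ 0 at hu
  rw [e] at hZ ⊢
  generalize 2 * u = w at *
  field_simp
  ring

/-- As for `K`, with the signs of the indices after `j` adding up to `c_n - c_{j+1}`. -/
lemma dressedKplus_eq : (2 * u - const (ħ * csum p n)) * dressedKplus p ħ Kplus j =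
    (2 * u - const (ħ * csum p (j.val + 1))) *
      boundaryRight p (2 * invVar ℂ) (HahnSeries.C ħ) Kplus j := by
  have hZ := shiftFactor_two_mul_invVar_ne_zero (p := p) (ħ := ħ) (j.val + 1)
  have hn := shiftFactor_two_mul_invVar_ne_zero (p := p) (ħ := ħ) n
  rw [shiftFactor_eq] at hn
  rw [shiftFactor_eq] at hZ
  have hs : ∑ m ∈ Finset.Ioi j, const (sgn (p m)) * (Kplus m - Kplus j) =
      ∑ m ∈ Finset.Ioi j, intSgn (p m) * Kplus m -
        (const (csum p n) - const (csum p (j.val + 1))) * Kplus j := by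
    simp only [mul_sub, Finset.sum_sub_distrib, const_sgn, ← Finset.sum_mul]
    rw [eq_sub_of_add_eq' (partialSum_add_sum_Ioi
      (fun m => (intSgn (p m) : LaurentSeries ℂ)) j), ← const_csum, ← const_csum]
  rw [dressedKplus, boundaryRight, shiftFactor_eq, hs]
  have e : ∀ k, const (ħ * csum p k) = const ħ * const (csum p k) :=
    fun k => map_mul HahnSeries.C _ _
  change _ = _ * (Kplus j - const ħ / _ * _)
  simp only [e] at hZ hn ⊢
  generalize 2 * u = w at *
  field_simp
  ring

lemma g_eq : g p ħ K Kplus j = boundaryLeft p (2 * invVar ℂ) (HahnSeries.C ħ) K j *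
    boundaryRight p (2 * invVar ℂ) (HahnSeries.C ħ) Kplus j := by
  have h₁ := shiftFactor_two_mul_invVar_ne_zero (p := p) (ħ := ħ) j.val
  have h₂ := shiftFactor_two_mul_invVar_ne_zero (p := p) (ħ := ħ) (j.val + 1)
  rw [shiftFactor_eq] at h₁ h₂
  rw [g, gPrefactor, div_mul_eq_mul_div, div_mul_eq_mul_div, div_eq_iff (mul_ne_zero h₁ h₂)]
  linear_combination (2 * u - const (ħ * csum p n)) * dressedKplus p ħ Kplus j *
    dressedK_eq p ħ K j + (2 * u - const (ħ * csum p j.val)) *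
    boundaryLeft p (2 * invVar ℂ) (HahnSeries.C ħ) K j * dressedKplus_eq p ħ Kplus j

lemma g_of_scalar (hK : ∀ i j, K i = K j) (hKplus : ∀ i j, Kplus i = Kplus j) :
    g p ħ K Kplus j = gPrefactor p ħ j * (K j * Kplus j) := by
  have h₁ : dressedK p ħ K j = K j := by
    rw [dressedK, Finset.sum_eq_zero fun m _ => by rw [hK m j, sub_self, mul_zero], mul_zero,
      add_zero]
  have h₂ : dressedKplus p ħ Kplus j = Kplus j := by
    rw [dressedKplus, Finset.sum_eq_zero fun m _ => by rw [hKplus m j, sub_self, mul_zero],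
      mul_zero, sub_zero]
  rw [g, h₁, h₂, mul_assoc]

end BoundaryFunctions

/-! ### The chain -/

section SiteOperators

variable {n L : ℕ} {p : Fin n → ZMod 2} {V : Fin L → Type*} [∀ i, AddCommGroup (V i)]
  [∀ i, Module ℂ (V i)] {𝒱 : ∀ i, ZMod 2 → Submodule ℂ (V i)}
  [∀ i, DirectSum.Decomposition (𝒱 i)] {π : ∀ i, SuperYangian p →ₐ[ℂ] Module.End ℂ (V i)}

lemma isSiteFamily_siteOp (hπ : ∀ i, IsGradedRep p (𝒱 i) (π i)) :
    IsSiteFamily p (siteOp p 𝒱 π) where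
  zero j a b := siteOp_zero p 𝒱 π j a b
  exchange j r s a b c d := by
    simp only [← sgn_smul_eq]
    exact siteOp_exchange p 𝒱 π j r s a b c d
  supercomm i j hij r s a b c d := by
    rw [← sgn_smul_eq]
    exact siteOp_supercomm hπ hij r s a b c d

lemma IsHighestWeightVector.coeff_zero {V : Type*} [AddCommGroup V] [Module ℂ V]
    {π : SuperYangian p →ₐ[ℂ] Module.End ℂ V} {v : V} {ℓ : Fin n → ℕ → ℂ}
    (h : IsHighestWeightVector p π v ℓ) (a : Fin n) : ℓ a 0 = 1 := by
  have := h.diag 0 a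
  rw [map_genT_zero, if_pos rfl, Module.End.one_apply] at this
  refine smul_left_injective ℂ h.ne_zero ?_
  simp only [one_smul]
  exact this.symm

lemma isTriangularSeries_seriesMonodromy (hπ : ∀ i, IsGradedRep p (𝒱 i) (π i)) {v : ∀ i, V i}
    {ℓ : Fin L → Fin n → ℕ → ℂ} (hv : ∀ i, IsHighestWeightVector p (π i) (v i) (ℓ i)) :
    IsTriangularSeries (seriesMonodromy (siteOp p 𝒱 π) (List.finRange L))
      (PiTensorProduct.tprod ℂ v) (weightSeries ℓ) :=
  have h := seriesMonodromy_tprod hπ (List.finRange L) (List.pairwise_lt_finRange L) v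
    fun i _ => ⟨(hv i).lower, (hv i).diag⟩
  ⟨h.1, h.2⟩

lemma monodromy_eq (ħ : ℂ) (α : Fin L → ℂ) {ε : ℂ} (hε : ε ≠ 0) :
    (monodromy p 𝒱 π ħ α ε : Matrix (Fin n) (Fin n) (OperatorSeries (Module.End ℂ (⨂[ℂ] i, V i)))) =
      siteFactor α (const ε * u) • monodromyAt (siteOp p 𝒱 π) ħ (PowerSeries.C ε)
        (List.finRange L) :=
  prod_siteMatrix (siteOp p 𝒱 π) ħ hε fun j => const ε * u - const (α j)

end SiteOperators

end SuperChain

end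

/-! ### Assembly of the theorem. -/

theorem mainTheorem6 {n L : ℕ} (p : Fin n → ZMod 2) (ħ : ℂ)
    {V : Fin L → Type*} [∀ i, AddCommGroup (V i)] [∀ i, Module ℂ (V i)]
    (𝒱 : ∀ i, ZMod 2 → Submodule ℂ (V i)) [∀ i, DirectSum.Decomposition (𝒱 i)]
    (π : ∀ i, SuperChain.SuperYangian p →ₐ[ℂ] Module.End ℂ (V i))
    (hπ : ∀ i, SuperChain.IsGradedRep p (𝒱 i) (π i))
    (v : ∀ i, V i) (ℓ : Fin L → Fin n → ℕ → ℂ)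
    (hv : ∀ i, SuperChain.IsHighestWeightVector p (π i) (v i) (ℓ i))
    (α : Fin L → ℂ) (K Kplus : Fin n → LaurentSeries ℂ) :
    IsUnit (SuperChain.monodromy p 𝒱 π ħ α (-1)) ∧
      PiTensorProduct.tprod ℂ v ≠ 0 ∧
      SuperChain.inverseNorm p ħ α ℓ ≠ 0 ∧
      SuperChain.HasSeriesEigenvalue
        (SuperChain.scalarOp (SuperChain.inverseNorm p ħ α ℓ) *
          SuperChain.openTransfer p 𝒱 π ħ α K Kplus)
        (PiTensorProduct.tprod ℂ v)
        (SuperChain.pseudovacuumValue p ħ α ℓ K Kplus) ∧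
      ((∀ i j, K i = K j) → (∀ i j, Kplus i = Kplus j) → ∀ j,
        SuperChain.g p ħ K Kplus j = SuperChain.gPrefactor p ħ j * (K j * Kplus j)) := by
  have hℓ : ∀ j a, ℓ j a 0 = 1 := fun j a => (hv j).coeff_zero a
  have hD := SuperChain.inverseNorm_ne_zero p ħ α hℓ
  have e₁ : SuperChain.const 1 * SuperChain.u = SuperChain.u := by
    rw [SuperChain.const, map_one, one_mul]
  have e₂ : SuperChain.const (-1) * SuperChain.u = SuperChain.spectral (-1) := by
    rw [SuperChain.const, map_neg, map_one, SuperChain.spectral, map_neg, map_one, mul_neg,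
      mul_one]
    exact neg_one_mul SuperChain.u
  have e₃ : SuperChain.spectral 1 = SuperChain.u := by
    rw [SuperChain.spectral, map_one, mul_one]
    rfl
  have hT := SuperChain.monodromy_eq (p := p) (𝒱 := 𝒱) (π := π) ħ α (one_ne_zero (α := ℂ))
  have hT₁ := SuperChain.monodromy_eq (p := p) (𝒱 := 𝒱) (π := π) ħ α
    (neg_ne_zero.2 (one_ne_zero (α := ℂ)))
  rw [map_one, e₁] at hT
  rw [map_neg, map_one, e₂] at hT₁
  have hs := SuperChain.siteFactor_spectral_ne_zero (g := -1) α (by simp)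
  obtain ⟨hunit, key⟩ := SuperChain.openTransfer_smul (SuperChain.isSiteFamily_siteOp hπ)
    (List.nodup_finRange L) (SuperChain.isTriangularSeries_seriesMonodromy hπ hv)
    (SuperChain.constantCoeff_weightSeries hℓ) (SuperChain.isPivot_weight p ħ α hℓ) hs
    (SuperChain.inverseNorm p ħ α ℓ) K Kplus hT hT₁
  refine ⟨hunit, SuperChain.tprod_ne_zero fun i => (hv i).ne_zero, hD, ?_,
    fun hK hKplus j => SuperChain.g_of_scalar p ħ K Kplus j hK hKplus⟩
  -- With `x` the site factor at `-u` and `y = inverseNorm`, the normalization leaves only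
  -- `pivotNumerator`.
  have hb : ∀ x y z : LaurentSeries ℂ, x ≠ 0 → y ≠ 0 → y * (x⁻¹ * (x * z / y)) = z := by
    intro x y z hx hy
    field_simp
  have hval : ∀ j, SuperChain.pivotNumerator p ħ α ℓ j * (SuperChain.siteFactor α SuperChain.u *
      SuperChain.atSpectral ħ 1 (SuperChain.weightSeries ℓ j)) = SuperChain.beta p ħ α ℓ j :=
    fun j => by
      rw [SuperChain.beta_eq, ← e₃, SuperChain.weight_spectral ħ α ℓ (by simp)]
  simp only [hb _ _ _ hs hD, hval, ← SuperChain.g_eq, ← SuperChain.const_sgn] at key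
  exact SuperChain.smul_cyclicVector_eq.1 key
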